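/- Let $A=(a_{ij})_{1\le i,j\le n}$ be an integer matrix with $a_{ii}=2$ and $a_{ij}\in\{0,-1,-2,-3\}$ for $i\ne j$, and let $d_1,\dots,d_n\in\{1,2,3\}$ be such that $(d_ia_{ij})$ is symmetric and positive definite. Let $k$ be a field and let $q\in k$ be nonzero with $q^{2d_i}\neq 1$ for all $i$; put $q_i=q^{d_i}$. For $v\in k^\times$ let $\begin{bmatrix}m\\ s\end{bmatrix}_v$ be the value at $v$ of the Gaussian binomial coefficient $\frac{[m]!}{[s]!\,[m-s]!}$, a Laurent polynomial with integer coefficients, where $[N]=\frac{v^N-v^{-N}}{v-v^{-1}}$. Let $U_q$ be the $k$-algebra with generators $E_i,F_i,K_i,K_i^{-1}$ $(1\le i\le n)$ and relations $$K_iK_j=K_jK_i,\quad K_iK_i^{-1}=1=K_i^{-1}K_i,\quad K_iE_j=q^{d_ia_{ij}}E_jK_i,\quad K_iF_j=q^{-d_ia_{ij}}F_jK_i,$$ $$E_iF_j-F_jE_i=\delta_{ij}\frac{K_i-K_i^{-1}}{q_i-q_i^{-1}},$$ and, for $i\neq j$, $$\sum_{r+s=1-a_{ij}}(-1)^s\begin{bmatrix}1-a_{ij}\\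 s\end{bmatrix}_{q_i}E_i^rE_jE_i^s=0,\qquad \sum_{r+s=1-a_{ij}}(-1)^s\begin{bmatrix}1-a_{ij}\\ s\end{bmatrix}_{q_i}F_i^rF_jF_i^s=0 .$$ It is a Hopf algebra with $\Delta(E_i)=E_i\otimes1+K_i\otimes E_i$, $\Delta(F_i)=F_i\otimes K_i^{-1}+1\otimes F_i$, $\Delta(K_i)=K_i\otimes K_i$, $\varepsilon(E_i)=\varepsilon(F_i)=0$, $\varepsilon(K_i)=1$, $S(E_i)=-K_i^{-1}E_i$, $S(F_i)=-F_iK_i$, $S(K_i)=K_i^{-1}$. Let $U_q^{\ge0}$ (resp. $U_q^{\le0}$) be the Hopf subalgebra generated by all $E_i$ (resp. all $F_i$) and all $K_i^{\pm1}$. For $\mu\in\mathbb N^n$, an element of $U_q^{\ge 0}$ (resp. $U_q^{\le 0}$) is said to have degree $\mu$ if it is a linear combination of products of a word in the $E_i$ (resp. $F_i$) containing each letter $E_i$ (resp. $F_i$) exactly $\mu_i$ times with an element of the subalgebra generated by the $K_i^{\pm1}$. Then there is exactly one bilinear pairing $\varphi:U_q^{\ge0}\times U_q^{\le0}\to k$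 such that, for all $i,j$ and all $x,x'\in U_q^{\ge0}$, $y,y'\in U_q^{\le0}$ (with $\varphi(x\otimes x',y\otimes y')=\varphi(x,y)\varphi(x',y')$): * $\varphi(1,1)=\varphi(1,K_i)=\varphi(K_i,1)=1$; * $\varphi(x,y)=0$ if $x$ and $y$ have degrees $\mu\ne\nu$ respectively; * $\varphi(E_i,F_j)=\delta_{ij}\frac1{q^{2d_i}-1}$, $\varphi(K_i,K_j)=q^{d_ia_{ij}}$, $\varphi(K_i,K_j^{-1})=q^{-d_ia_{ij}}$; * $\varphi(x,yy')=\varphi(\Delta^{\mathrm{op}}(x),y\otimes y')$, $\varphi(xx',y)=\varphi(x\otimes x',\Delta(y))$, $\varphi(S(x),y)=\varphi(x,S^{-1}(y))$. Let $D_q$ be the quantum double of $(U_q^{\ge0},U_q^{\le0},\varphi)$: the vector space $U_q^{\ge0}\otimes U_q^{\le0}$ with unit $1\otimes1$ and multiplication $$(x\otimes y)(x'\otimes y')=\sum\varphi(x'_{(1)},y_{(1)})\,(xx'_{(2)}\otimes y_{(2)}y')\,\varphi(x'_{(3)},S^{-1}(y_{(3)})).$$ Then $D_q$ is isomorphic,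 as a $k$-algebra, to the algebra with generators $E_i,F_i,K_i,K_i^{-1},\widetilde K_i,\widetilde K_i^{-1}$ $(1\le i\le n)$ and relations $$K_iK_j=K_jK_i,\quad \widetilde K_i\widetilde K_j=\widetilde K_j\widetilde K_i,\quad K_i\widetilde K_j=\widetilde K_jK_i,\quad K_iK_i^{-1}=1=K_i^{-1}K_i,\quad \widetilde K_i\widetilde K_i^{-1}=1=\widetilde K_i^{-1}\widetilde K_i,$$ $$K_iE_j=q^{d_ia_{ij}}E_jK_i,\quad K_iF_j=q^{-d_ia_{ij}}F_jK_i,\quad \widetilde K_iE_j=q^{d_ia_{ij}}E_j\widetilde K_i,\quad \widetilde K_iF_j=q^{-d_ia_{ij}}F_j\widetilde K_i,$$ $$E_iF_j-F_jE_i=\delta_{ij}\frac{K_i-\widetilde K_i^{-1}}{q_i-q_i^{-1}},$$ together with the two families of quantum Serre relations displayed above, for $i\ne j$. An isomorphism is given by $E_i\mapsto E_i\otimes1$, $F_i\mapsto q_i(1\otimes F_i)$, $K_i^{\pm1}\mapsto K_i^{\pm1}\otimes1$, $\widetilde K_i^{\pm1}\mapsto1\otimes K_i^{\pm1}$. -/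

import Mathlib

open scoped TensorProduct

noncomputable section

namespace QD

universe u v w

/-! ### Gaussian binomial coefficients and quantum Serre expressions -/

section Serre

variable {k : Type u} [Field k]

/-- The quantum integer `[m]_v = (v ^ m - v ^ (-m)) / (v - v⁻¹)`. -/
def qInt (v : k) (m : ℕ) : k := (v ^ m - v⁻¹ ^ m) / (v - v⁻¹)

/-- The quantum factorial `[m]_v! = [1]_v [2]_v ⋯ [m]_v`. -/
def qFact (v : k) : ℕ → k
  | 0 => 1
  | m + 1 => qInt v (m + 1) * qFact v m

/-- The (symmetric) Gaussian binomial coefficient, a Laurent polynomial with integer coefficients,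
evaluated at `v`. It is defined through the Pascal recursion so that it also makes sense when
some quantum integer vanishes at `v`; `qBinom_mul_qFact` below is the usual factorial formula. -/
def qBinom (v : k) : ℕ → ℕ → k
  | _, 0 => 1
  | 0, _ + 1 => 0
  | m + 1, s + 1 => v ^ (s + 1 : ℤ) * qBinom v m (s + 1) + v ^ (s - m : ℤ) * qBinom v m s

@[simp] lemma qBinom_zero_right (v : k) (m : ℕ) : qBinom v m 0 = 1 := by
  cases m <;> simp [qBinom]

@[simp] lemma qBinom_zero_succ (v : k) (s : ℕ) : qBinom v 0 (s + 1) = 0 := by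
  simp [qBinom]

lemma qBinom_succ_succ (v : k) (m s : ℕ) : qBinom v (m + 1) (s + 1) =
    v ^ (s + 1 : ℤ) * qBinom v m (s + 1) + v ^ (s - m : ℤ) * qBinom v m s := by
  simp [qBinom]

lemma qBinom_eq_zero (v : k) (m s : ℕ) (h : m < s) : qBinom v m s = 0 := by
  induction m generalizing s with
  | zero => cases s with
    | zero => omega
    | succ s => simp
  | succ m ih => cases s with
    | zero => omega
    | succ s => rw [qBinom_succ_succ, ih _ (by omega), ih _ (by omega)]; simp

lemma qBinom_self (v : k) (m : ℕ) : qBinom v m m = 1 := by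
  induction m with
  | zero => simp
  | succ m ih => rw [qBinom_succ_succ, qBinom_eq_zero v m (m + 1) (by omega), ih]; simp

/-- The factorial formula for the Gaussian binomial coefficients. -/
theorem qBinom_mul_qFact (v : k) (hv : v ≠ 0) (hv' : v ^ 2 ≠ 1) (m s : ℕ) :
    qBinom v (m + s) s * (qFact v s * qFact v m) = qFact v (m + s) := by
  have hd : v - v⁻¹ ≠ 0 := by
    intro h
    apply hv'
    field_simp at h
    linear_combination h
  have hq (a b : ℕ) : v ^ (b : ℤ) * qInt v a + v ^ (-a : ℤ) * qInt v b = qInt v (a + b) := by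
    unfold qInt
    simp only [zpow_natCast, zpow_neg, pow_add, ← inv_pow]
    ring
  induction h : m + s generalizing m s with
  | zero =>
    obtain ⟨rfl, rfl⟩ : m = 0 ∧ s = 0 := by omega
    simp [qFact]
  | succ N ih =>
    cases s with
    | zero => obtain rfl : m = N + 1 := by omega
              simp [qFact]
    | succ s =>
      cases m with
      | zero =>
        obtain rfl : s = N := by omega
        rw [qBinom_self]; simp [qFact]
      | succ m =>
        have h1 := ih m (s + 1) (by omega)
        have h2 := ih (m + 1) s (by omega)
        have h3 := hq (m + 1) (s + 1)
        rw [qBinom_succ_succ]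
        have e : (s - N : ℤ) = - ((m + 1 : ℕ) : ℤ) := by push_cast; omega
        have e2 : m + 1 + (s + 1) = N + 1 := by omega
        rw [e]
        rw [e2] at h3
        simp only [qFact] at *
        rw [← h3]
        push_cast at *
        linear_combination (v ^ (s + 1 : ℤ)) * qInt v (m + 1) * h1 +
          (v ^ (-(m + 1) : ℤ)) * qInt v (s + 1) * h2

lemma qBinom_succ_succ' (v : k) (hv : v ≠ 0) (m s : ℕ) : qBinom v (m + 1) (s + 1) =
    v ^ (-(s + 1) : ℤ) * qBinom v m (s + 1) + v ^ (m - s : ℤ) * qBinom v m s := by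
  induction m generalizing s with
  | zero => cases s <;> simp [qBinom_succ_succ]
  | succ m ih =>
    have key (a b c d : ℤ) (h : a + b = c + d) : v ^ a * v ^ b = v ^ c * v ^ d := by
      rw [← zpow_add₀ hv, ← zpow_add₀ hv, h]
    rw [qBinom_succ_succ v (m + 1) s]
    have hm := qBinom_succ_succ v m s
    have hi := ih s
    cases s with
    | zero =>
      have h1 := key (0 + 1) (m - 0) (m + 1 - 0) 0 (by ring)
      have h2 := key (0 - (m + 1)) 0 (-(0 + 1)) (0 - m) (by ring)
      have h3 := key (0 + 1) (-(0 + 1)) (-(0 + 1)) (0 + 1) (by ring)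
      simp only [zpow_zero, mul_one] at h1 h2
      push_cast at *
      simp only [qBinom_zero_right] at *
      linear_combination v ^ (1 : ℤ) * hi - v ^ (-1 : ℤ) * hm + qBinom v m 1 * h3 + h1 + h2
    | succ s =>
      have hm' := qBinom_succ_succ v m s
      have hi' := ih s
      push_cast at *
      have h1 := key (s + 1 + 1) (m - (s + 1)) (m + 1 - (s + 1)) (s + 1) (by ring)
      have h2 := key (s + 1 - (m + 1)) (-(s + 1)) (-(s + 1 + 1)) (s + 1 - m) (by ring)
      have h3 := key (s + 1 + 1) (-(s + 1 + 1)) (-(s + 1 + 1)) (s + 1 + 1) (by ring)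
      have h4 := key (s + 1 - (m + 1)) (m - s) (m + 1 - (s + 1)) (s - m) (by ring)
      linear_combination v ^ (s + 1 + 1 : ℤ) * hi - v ^ (-(s + 1 + 1) : ℤ) * hm
        + v ^ (s + 1 - (m + 1) : ℤ) * hi' - v ^ (m + 1 - (s + 1) : ℤ) * hm'
        + qBinom v m (s + 1 + 1) * h3 + qBinom v m (s + 1) * h1
        + qBinom v m (s + 1) * h2 + qBinom v m s * h4

lemma qBinom_inv (v : k) (hv : v ≠ 0) (m s : ℕ) : qBinom v⁻¹ m s = qBinom v m s := by
  induction m generalizing s with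
  | zero => cases s <;> simp
  | succ m ih => cases s with
    | zero => simp
    | succ s =>
      rw [qBinom_succ_succ, qBinom_succ_succ' v hv, ih, ih, inv_zpow', inv_zpow', neg_sub]

lemma qBinom_symm (v : k) (hv : v ≠ 0) (m s : ℕ) : qBinom v (m + s) s = qBinom v (m + s) m := by
  induction h : m + s generalizing m s with
  | zero =>
    obtain ⟨rfl, rfl⟩ : m = 0 ∧ s = 0 := by omega
    rfl
  | succ N ih =>
    cases s with
    | zero => obtain rfl : m = N + 1 := by omega
              simp [qBinom_self]
    | succ s => cases m with
      | zero => obtain rfl : s = N := by omega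
                simp [qBinom_self]
      | succ m =>
        rw [qBinom_succ_succ, qBinom_succ_succ' v hv, ih m (s + 1) (by omega),
          ← ih (m + 1) s (by omega)]
        have e : (s - N : ℤ) = -(m + 1) := by omega
        have e' : (N - m : ℤ) = (s + 1) := by omega
        rw [e, e']
        ring

variable {B : Type v} [Ring B] [Algebra k B]

/-- The quantum Serre expression
`∑_{r + s = m} (-1) ^ s [m choose s]_v x ^ r y x ^ s`. -/
def serre (v : k) (m : ℕ) (x y : B) : B :=
  ∑ s ∈ Finset.range (m + 1), ((-1) ^ s * qBinom v m s) • (x ^ (m - s) * y * x ^ s)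

lemma serre_map {C : Type*} [Ring C] [Algebra k C] (f : B →ₐ[k] C) (v : k) (m : ℕ) (x y : B) :
    f (serre v m x y) = serre v m (f x) (f y) := by
  simp [serre]

lemma serre_inv (v : k) (hv : v ≠ 0) (m : ℕ) (x y : B) : serre v⁻¹ m x y = serre v m x y := by
  simp [serre, qBinom_inv v hv]

lemma serre_add_right (v : k) (m : ℕ) (x y z : B) :
    serre v m x (y + z) = serre v m x y + serre v m x z := by
  simp [serre, mul_add, add_mul, smul_add, Finset.sum_add_distrib]

lemma serre_op (v : k) (hv : v ≠ 0) (m : ℕ) (x y : B) :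
    serre v m (MulOpposite.op x) (MulOpposite.op y) =
      MulOpposite.op ((-1 : k) ^ m • serre v m x y) := by
  apply MulOpposite.unop_injective
  rw [MulOpposite.unop_op]
  unfold serre
  rw [Finset.smul_sum, ← Finset.sum_range_reflect, Finset.unop_sum]
  refine Finset.sum_congr rfl fun s hs => ?_
  have hs : s ≤ m := by simpa [Nat.lt_succ_iff] using hs
  obtain ⟨t, rfl⟩ := Nat.exists_eq_add_of_le hs
  have e : s + t + 1 - 1 - s = t := by omega
  have e' : s + t - t = s := by omega
  have e'' : s + t - s = t := by omega
  rw [e, e', e'', smul_smul]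
  simp only [MulOpposite.unop_smul, MulOpposite.unop_mul, MulOpposite.unop_pow,
    MulOpposite.unop_op, mul_assoc]
  rw [← qBinom_symm v hv s t, ← mul_assoc ((-1) ^ (s + t)), ← pow_add]
  congr 2
  rw [show s + t + s = t + 2 * s by ring, pow_add, pow_mul]; simp

/-- Iterated twisted commutators `z ↦ x z - c v ^ (m - 1 - 2 t) z x`. -/
def serreIter (v : k) (x y : B) : ℕ → k → B
  | 0, _ => y
  | m + 1, c => x * serreIter v x y m (c * v) - (c * v ^ (-m : ℤ)) • (serreIter v x y m (c * v) * x)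

lemma serreIter_eq (v : k) (hv : v ≠ 0) (x y : B) (m : ℕ) (c : k) :
    serreIter v x y m c = ∑ s ∈ Finset.range (m + 1),
      ((-1) ^ s * qBinom v m s * c ^ s) • (x ^ (m - s) * y * x ^ s) := by
  induction m generalizing c with
  | zero => simp [serreIter]
  | succ m ih =>
    rw [serreIter, ih, Finset.sum_mul, Finset.smul_sum, Finset.mul_sum]
    conv_lhs => arg 1; rw [Finset.sum_range_succ']
    conv_rhs => rw [Finset.sum_range_succ']
    have hlast : ∑ s ∈ Finset.range (m + 1), ((-1 : k) ^ (s + 1) * (v ^ (s + 1 : ℤ) *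
        qBinom v m (s + 1)) * c ^ (s + 1)) • (x ^ (m - s) * y * x ^ (s + 1)) =
        ∑ s ∈ Finset.range m, x * (((-1 : k) ^ (s + 1) * qBinom v m (s + 1) * (c * v) ^ (s + 1)) •
          (x ^ (m - (s + 1)) * y * x ^ (s + 1))) := by
      rw [Finset.sum_range_succ, qBinom_eq_zero v m (m + 1) (by omega)]
      simp only [mul_zero, zero_mul, zero_smul, add_zero]
      refine Finset.sum_congr rfl fun s hs => ?_
      have hs : s < m := by simpa using hs
      rw [mul_smul_comm, ← mul_assoc x, ← mul_assoc x, ← pow_succ',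
        show m - (s + 1) + 1 = m - s by omega]
      congr 1
      rw [mul_pow]
      norm_cast
      ring
    have hsec : ∑ s ∈ Finset.range (m + 1), ((-1 : k) ^ (s + 1) * (v ^ (s - m : ℤ) *
        qBinom v m s) * c ^ (s + 1)) • (x ^ (m - s) * y * x ^ (s + 1)) =
        - ∑ s ∈ Finset.range (m + 1), (c * v ^ (-m : ℤ)) • (((-1 : k) ^ s * qBinom v m s *
          (c * v) ^ s) • (x ^ (m - s) * y * x ^ s) * x) := by
      rw [← Finset.sum_neg_distrib]
      refine Finset.sum_congr rfl fun s hs => ?_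
      rw [smul_mul_assoc, smul_smul, mul_assoc _ _ x, ← pow_succ, ← neg_smul]
      congr 1
      rw [mul_pow, sub_eq_add_neg, zpow_add₀ hv, zpow_natCast]
      ring
    have hsum : ∑ s ∈ Finset.range (m + 1), ((-1 : k) ^ (s + 1) * qBinom v (m + 1) (s + 1) *
        c ^ (s + 1)) • (x ^ (m + 1 - (s + 1)) * y * x ^ (s + 1)) =
        ∑ s ∈ Finset.range (m + 1), ((-1 : k) ^ (s + 1) * (v ^ (s + 1 : ℤ) *
        qBinom v m (s + 1)) * c ^ (s + 1)) • (x ^ (m - s) * y * x ^ (s + 1)) +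
        ∑ s ∈ Finset.range (m + 1), ((-1 : k) ^ (s + 1) * (v ^ (s - m : ℤ) *
        qBinom v m s) * c ^ (s + 1)) • (x ^ (m - s) * y * x ^ (s + 1)) := by
      rw [← Finset.sum_add_distrib]
      refine Finset.sum_congr rfl fun s hs => ?_
      rw [← add_smul, qBinom_succ_succ, show m + 1 - (s + 1) = m - s by omega]
      congr 1
      ring
    rw [hsum, hlast, hsec]
    simp only [pow_zero, qBinom_zero_right, mul_one, one_smul, Nat.sub_zero, pow_succ', mul_assoc]
    abel

lemma serre_eq_serreIter (v : k) (hv : v ≠ 0) (x y : B) (m : ℕ) :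
    serre v m x y = serreIter v x y m 1 := by
  rw [serreIter_eq v hv]; simp [serre]

/-- The additivity behind compatibility of the comultiplication with the Serre relations. -/
lemma serre_add_left (v : k) (hv : v ≠ 0) (m : ℕ) (X Y z : B) (hXY : Y * X = v ^ (-2 : ℤ) • (X * Y))
    (hz : Y * z = v ^ (m - 1 : ℤ) • (z * Y)) :
    serre v m (X + Y) z = serre v m X z := by
  rw [serre_eq_serreIter v hv, serre_eq_serreIter v hv]
  suffices H : ∀ t : ℕ, ∀ c : k, c = v ^ (m - t : ℤ) →
      serreIter v (X + Y) z t c = serreIter v X z t c ∧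
      Y * serreIter v X z t c = v ^ (m - 1 - 2 * t : ℤ) • (serreIter v X z t c * Y) from
    (H m 1 (by simp)).1
  intro t
  induction t with
  | zero =>
    intro c hc
    refine ⟨rfl, ?_⟩
    simpa [serreIter] using hz
  | succ t ih =>
    intro c hc
    obtain ⟨h1, h2⟩ := ih (c * v) (by
      rw [hc]; nth_rw 2 [← zpow_one v]; rw [← zpow_add₀ hv]; congr 1; push_cast; ring)
    set w := serreIter v X z t (c * v) with hw
    have hcoef : c * v ^ (-t : ℤ) = v ^ (m - 1 - 2 * t : ℤ) := by
      rw [hc, ← zpow_add₀ hv]; congr 1; push_cast; ring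
    have e1 : serreIter v X z (t + 1) c = X * w - v ^ (m - 1 - 2 * t : ℤ) • (w * X) := by
      rw [serreIter, hcoef]
    constructor
    · rw [e1, serreIter, h1, hcoef, add_mul, mul_add, h2, smul_add]
      abel
    · rw [e1, mul_sub, mul_smul_comm, ← mul_assoc, hXY, ← mul_assoc, h2, smul_mul_assoc,
        smul_mul_assoc, mul_assoc X, h2, mul_assoc w, hXY, sub_mul, smul_mul_assoc, smul_sub]
      simp only [mul_smul_comm, smul_smul, ← zpow_add₀ hv, mul_assoc]
      congr 2 <;> congr 1 <;> push_cast <;> ring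

lemma serre_add (v : k) (hv : v ≠ 0) (m : ℕ) (X Y z w : B)
    (hXY : Y * X = v ^ (-2 : ℤ) • (X * Y))
    (hz : Y * z = v ^ (m - 1 : ℤ) • (z * Y)) (hw : X * w = v ^ (1 - m : ℤ) • (w * X)) :
    serre v m (X + Y) (z + w) = serre v m X z + serre v m Y w := by
  rw [serre_add_right, serre_add_left v hv m X Y z hXY hz, ← serre_inv v hv m (X + Y) w, add_comm X Y,
    serre_add_left v⁻¹ (inv_ne_zero hv) m Y X w, serre_inv v hv]
  · rw [hXY, smul_smul, inv_zpow', ← zpow_add₀ hv]; simp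
  · rw [hw, inv_zpow', neg_sub]

/-- Twisting the arguments of a Serre expression by elements that commute up to scalars. -/
lemma serre_mul_left (v : k) (hv : v ≠ 0) (m : ℕ) (g g' e e' : B) (α β : k)
    (hg : e * g = α • (g * e)) (hg' : e * g' = β • (g' * e)) (hge : e' * g = β • (g * e'))
    (hgg : g' * g = g * g') (hs : serre v m e e' = 0) :
    serre v m (g * e) (g' * e') = 0 := by
  rw [serre_eq_serreIter v hv] at *
  suffices H : ∀ t : ℕ, ∀ c : k, (∃ γ : k, serreIter v (g * e) (g' * e') t c =
      γ • (g ^ t * g' * serreIter v e e' t c)) ∧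
      serreIter v e e' t c * g = (α ^ t * β) • (g * serreIter v e e' t c) by
    obtain ⟨⟨γ, h⟩, -⟩ := H m 1
    rw [h, hs, mul_zero, smul_zero]
  have hcomm (t : ℕ) : e * (g ^ t * g') = (α ^ t * β) • (g ^ t * g' * e) := by
    induction t with
    | zero => simpa using hg'
    | succ t ih =>
      rw [pow_succ', mul_assoc g, ← mul_assoc e, hg, smul_mul_assoc, mul_assoc g, ih,
        mul_smul_comm, smul_smul, mul_assoc g, pow_succ', mul_assoc α]
  have hg2 (t : ℕ) : g ^ t * g' * g = g ^ (t + 1) * g' := by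
    rw [mul_assoc, hgg, ← mul_assoc, pow_succ]
  have hg3 (t : ℕ) : g * (g ^ t * g') = g ^ (t + 1) * g' := by
    rw [← mul_assoc, pow_succ']
  intro t
  induction t with
  | zero => exact fun c => ⟨⟨1, by simp [serreIter]⟩, by simpa [serreIter] using hge⟩
  | succ t ih =>
    intro c
    obtain ⟨⟨γ, h1⟩, h2⟩ := ih (c * v)
    rw [serreIter, h1, serreIter]
    generalize serreIter v e e' t (c * v) = w at *
    constructor
    · refine ⟨γ * (α ^ t * β), ?_⟩
      have a1 : g * e * (γ • (g ^ t * g' * w)) =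
          (γ * (α ^ t * β)) • (g ^ (t + 1) * g' * (e * w)) := by
        rw [mul_smul_comm, mul_assoc g, ← mul_assoc e, hcomm, smul_mul_assoc, mul_smul_comm,
          smul_smul, mul_assoc _ e, ← mul_assoc g, hg3]
      have a2 : γ • (g ^ t * g' * w) * (g * e) =
          (γ * (α ^ t * β)) • (g ^ (t + 1) * g' * (w * e)) := by
        rw [smul_mul_assoc, mul_assoc _ w, ← mul_assoc w, h2, smul_mul_assoc, mul_smul_comm,
          smul_smul, mul_assoc g, ← mul_assoc _ g, hg2]
      rw [a1, a2, mul_sub, smul_sub, mul_smul_comm, smul_comm]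
    · rw [sub_mul, mul_assoc e, h2, mul_smul_comm, ← mul_assoc e, hg, smul_mul_assoc,
        smul_mul_assoc, mul_assoc w, hg, mul_smul_comm, ← mul_assoc w, h2, smul_mul_assoc,
        mul_sub, mul_smul_comm, smul_sub]
      simp only [smul_smul, mul_assoc, pow_succ]
      congr 2 <;> ring

lemma serre_smul (v : k) (m : ℕ) (c c' : k) (x y : B) :
    serre v m (c • x) (c' • y) = (c ^ m * c') • serre v m x y := by
  rw [serre, serre, Finset.smul_sum]
  refine Finset.sum_congr rfl fun s hs => ?_
  have hs : s ≤ m := by simpa [Nat.lt_succ_iff] using hs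
  obtain ⟨t, rfl⟩ := Nat.exists_eq_add_of_le hs
  rw [show s + t - s = t by omega]
  simp only [smul_pow, smul_mul_assoc, mul_smul_comm, smul_smul]
  congr 1
  ring

/-- Serre expressions of pure tensors with commuting first components. -/
lemma serre_tmul_left {C : Type*} [Ring C] [Algebra k C] (v : k) (m : ℕ) (g g' : B) (e e' : C)
    (hgg : g' * g = g * g') :
    serre v m (g ⊗ₜ[k] e) (g' ⊗ₜ[k] e') = (g ^ m * g') ⊗ₜ[k] serre v m e e' := by
  rw [serre, serre, TensorProduct.tmul_sum]
  refine Finset.sum_congr rfl fun s hs => ?_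
  have hs : s ≤ m := by simpa [Nat.lt_succ_iff] using hs
  obtain ⟨t, rfl⟩ := Nat.exists_eq_add_of_le hs
  rw [show s + t - s = t by omega, TensorProduct.tmul_smul]
  simp only [Algebra.TensorProduct.tmul_pow, Algebra.TensorProduct.tmul_mul_tmul]
  have h : Commute g' g := hgg
  rw [mul_assoc (g ^ t), (h.pow_right s).eq, ← mul_assoc, ← pow_add, add_comm t s]

lemma serre_tmul_right {C : Type*} [Ring C] [Algebra k C] (v : k) (m : ℕ) (g g' : B) (e e' : C)
    (hgg : g' * g = g * g') :
    serre v m (e ⊗ₜ[k] g) (e' ⊗ₜ[k] g') = serre v m e e' ⊗ₜ[k] (g ^ m * g') := by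
  have h := congrArg (Algebra.TensorProduct.comm k B C) (serre_tmul_left v m g g' e e' hgg)
  change (Algebra.TensorProduct.comm k B C).toAlgHom _ = _ at h
  rw [serre_map] at h
  exact h

end Serre

/-! ### Finite-type Cartan matrices and the quantized enveloping algebra -/

/-- A finite-type Cartan matrix `a` of size `n` with a symmetrizing vector `d`, together with a
parameter `q` of the field `k` which is invertible and satisfies `q ^ (2 d_i) ≠ 1` for all `i`. -/
structure Datum (k : Type u) [Field k] (n : ℕ) where
  /-- the Cartan matrix -/
  a : Matrix (Fin n) (Fin n) ℤ
  /-- the symmetrizing integers -/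
  d : Fin n → ℤ
  /-- the quantum parameter -/
  q : k
  diag : ∀ i, a i i = 2
  offDiag : ∀ i j, i ≠ j → a i j ∈ ({-3, -2, -1, 0} : Set ℤ)
  d_mem : ∀ i, d i ∈ ({1, 2, 3} : Set ℤ)
  symm : ∀ i j, d i * a i j = d j * a j i
  posDef : (Matrix.of fun i j => ((d i * a i j : ℤ) : ℝ)).PosDef
  q_ne_zero : q ≠ 0
  q_pow_ne_one : ∀ i, q ^ (2 * d i) ≠ 1

variable {k : Type u} [Field k] {n : ℕ}

/-- Symbols for the generators `E_i, F_i, K_i, K_i⁻¹` of the quantized enveloping algebra. -/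
inductive UGen (n : ℕ) : Type
  | E (i : Fin n)
  | F (i : Fin n)
  | K (i : Fin n)
  | Kinv (i : Fin n)

namespace Datum

variable (D : Datum k n)

/-- `q_i = q ^ d_i`. -/
def qi (i : Fin n) : k := D.q ^ D.d i

/-- The exponent `1 - a_ij` of the Serre relations (used only for `i ≠ j`). -/
def serreExp (i j : Fin n) : ℕ := (1 - D.a i j).toNat

end Datum

/-- The defining relations of the quantized enveloping algebra, for elements
`e_i, f_i, κ_i, κ'_i` of an arbitrary algebra in the roles of `E_i, F_i, K_i, K_i⁻¹`. -/
structure URelations (D : Datum k n) {B : Type v} [Ring B] [Algebra k B]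
    (e f κ κ' : Fin n → B) : Prop where
  K_K : ∀ i j, κ i * κ j = κ j * κ i
  K_Kinv : ∀ i, κ i * κ' i = 1
  Kinv_K : ∀ i, κ' i * κ i = 1
  K_E : ∀ i j, κ i * e j = D.q ^ (D.d i * D.a i j) • (e j * κ i)
  K_F : ∀ i j, κ i * f j = D.q ^ (-(D.d i * D.a i j)) • (f j * κ i)
  E_F : ∀ i j, e i * f j - f j * e i =
    if i = j then (D.qi i - (D.qi i)⁻¹)⁻¹ • (κ i - κ' i) else 0
  serre_E : ∀ i j, i ≠ j → serre (D.qi i) (D.serreExp i j) (e i) (e j) = 0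
  serre_F : ∀ i j, i ≠ j → serre (D.qi i) (D.serreExp i j) (f i) (f j) = 0

namespace URelations

variable {D : Datum k n} {B : Type v} [Ring B] [Algebra k B] {e f κ κ' : Fin n → B}

lemma inv_comm {x g g' : B} {c : k} (hc : c ≠ 0) (h1 : g * g' = 1) (h2 : g' * g = 1)
    (h : g * x = c • (x * g)) : g' * x = c⁻¹ • (x * g') := by
  have h3 : x * g' = c • (g' * x) := by
    calc x * g' = g' * (g * x) * g' := by rw [← mul_assoc g', h2, one_mul]
      _ = c • (g' * x * (g * g')) := by
        rw [h, mul_smul_comm, smul_mul_assoc]; simp only [mul_assoc]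
      _ = _ := by rw [h1, mul_one]
  rw [h3, smul_smul, inv_mul_cancel₀ hc, one_smul]

lemma swap {x y : B} {c : k} (hc : c ≠ 0) (h : x * y = c • (y * x)) :
    y * x = c⁻¹ • (x * y) := by
  rw [h, smul_smul, inv_mul_cancel₀ hc, one_smul]

lemma Kinv_comm_K (h : URelations D e f κ κ') (i j : Fin n) : κ' i * κ j = κ j * κ' i := by
  simpa using inv_comm (k := k) one_ne_zero (h.K_Kinv i) (h.Kinv_K i)
    (by simpa using h.K_K i j)


lemma Kinv_comm_Kinv (h : URelations D e f κ κ') (i j : Fin n) : κ' i * κ' j = κ' j * κ' i := by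
  simpa using inv_comm (k := k) one_ne_zero (h.K_Kinv i) (h.Kinv_K i)
    (by simpa using (h.Kinv_comm_K j i).symm)

lemma Kinv_E (h : URelations D e f κ κ') (i j : Fin n) : κ' i * e j = D.q ^ (-(D.d i * D.a i j)) • (e j * κ' i) := by
  rw [zpow_neg]
  exact inv_comm (zpow_ne_zero _ D.q_ne_zero) (h.K_Kinv i) (h.Kinv_K i) (h.K_E i j)

lemma Kinv_F (h : URelations D e f κ κ') (i j : Fin n) : κ' i * f j = D.q ^ (D.d i * D.a i j) • (f j * κ' i) := by
  have := inv_comm (zpow_ne_zero _ D.q_ne_zero) (h.K_Kinv i) (h.Kinv_K i) (h.K_F i j)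
  rwa [← zpow_neg, neg_neg] at this

lemma E_K (h : URelations D e f κ κ') (i j : Fin n) : e j * κ i = D.q ^ (-(D.d i * D.a i j)) • (κ i * e j) := by
  rw [zpow_neg]
  exact swap (zpow_ne_zero _ D.q_ne_zero) (h.K_E i j)

lemma F_K (h : URelations D e f κ κ') (i j : Fin n) : f j * κ i = D.q ^ (D.d i * D.a i j) • (κ i * f j) := by
  have := swap (zpow_ne_zero _ D.q_ne_zero) (h.K_F i j)
  rwa [← zpow_neg, neg_neg] at this

lemma E_Kinv (h : URelations D e f κ κ') (i j : Fin n) : e j * κ' i = D.q ^ (D.d i * D.a i j) • (κ' i * e j) := by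
  have := swap (zpow_ne_zero _ D.q_ne_zero) (h.Kinv_E i j)
  rwa [← zpow_neg, neg_neg] at this

lemma F_Kinv (h : URelations D e f κ κ') (i j : Fin n) : f j * κ' i = D.q ^ (-(D.d i * D.a i j)) • (κ' i * f j) := by
  rw [zpow_neg]
  exact swap (zpow_ne_zero _ D.q_ne_zero) (h.Kinv_F i j)

lemma qi_ne_zero (i : Fin n) : D.qi i ≠ 0 := zpow_ne_zero _ D.q_ne_zero

lemma qi_zpow (i : Fin n) (z : ℤ) : D.qi i ^ z = D.q ^ (D.d i * z) := by
  rw [Datum.qi, zpow_mul]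

lemma serreExp_eq {i j : Fin n} (hij : i ≠ j) : (D.serreExp i j : ℤ) = 1 - D.a i j := by
  have := D.offDiag i j hij
  simp only [Set.mem_insert_iff, Set.mem_singleton_iff] at this
  unfold Datum.serreExp
  omega

/-- The elements prescribed by the comultiplication satisfy the defining relations. -/
lemma comul (h : URelations D e f κ κ') : URelations D (B := B ⊗[k] B)
    (fun i => e i ⊗ₜ 1 + κ i ⊗ₜ e i) (fun i => f i ⊗ₜ κ' i + 1 ⊗ₜ f i)
    (fun i => κ i ⊗ₜ κ i) (fun i => κ' i ⊗ₜ κ' i) where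
  K_K i j := by simp [h.K_K i j]
  K_Kinv i := by simp [h.K_Kinv i, Algebra.TensorProduct.one_def]
  Kinv_K i := by simp [h.Kinv_K i, Algebra.TensorProduct.one_def]
  K_E i j := by
    simp only [mul_add, add_mul, Algebra.TensorProduct.tmul_mul_tmul, h.K_E i j, h.K_K i j,
      TensorProduct.tmul_smul, smul_add, mul_one, one_mul, ← TensorProduct.smul_tmul']
  K_F i j := by
    simp only [mul_add, add_mul, Algebra.TensorProduct.tmul_mul_tmul, h.K_F i j,
      ← h.Kinv_comm_K j i,
      TensorProduct.tmul_smul, smul_add, mul_one, one_mul, ← TensorProduct.smul_tmul']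
  E_F i j := by
    have h1 : (κ i ⊗ₜ[k] e i) * (f j ⊗ₜ[k] κ' j) = (f j ⊗ₜ[k] κ' j) * (κ i ⊗ₜ[k] e i) := by
      simp only [Algebra.TensorProduct.tmul_mul_tmul, h.K_F i j, h.E_Kinv j i,
        TensorProduct.tmul_smul, ← TensorProduct.smul_tmul', smul_smul, D.symm j i,
        ← zpow_add₀ D.q_ne_zero]
      simp
    have h2 : (e i ⊗ₜ[k] (1 : B)) * ((1 : B) ⊗ₜ[k] f j) = ((1 : B) ⊗ₜ[k] f j) * (e i ⊗ₜ[k] (1 : B)) := by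
      simp
    have h3 : (e i ⊗ₜ[k] (1 : B)) * (f j ⊗ₜ[k] κ' j) - (f j ⊗ₜ[k] κ' j) * (e i ⊗ₜ[k] (1 : B)) =
        (e i * f j - f j * e i) ⊗ₜ[k] κ' j := by
      simp [TensorProduct.sub_tmul]
    have h4 : (κ i ⊗ₜ[k] e i) * ((1 : B) ⊗ₜ[k] f j) - ((1 : B) ⊗ₜ[k] f j) * (κ i ⊗ₜ[k] e i) =
        κ i ⊗ₜ[k] (e i * f j - f j * e i) := by
      simp [TensorProduct.tmul_sub]
    have h5 : (e i ⊗ₜ[k] (1 : B) + κ i ⊗ₜ[k] e i) * (f j ⊗ₜ[k] κ' j + (1 : B) ⊗ₜ[k] f j) -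
        (f j ⊗ₜ[k] κ' j + (1 : B) ⊗ₜ[k] f j) * (e i ⊗ₜ[k] (1 : B) + κ i ⊗ₜ[k] e i) =
        (e i * f j - f j * e i) ⊗ₜ[k] κ' j + κ i ⊗ₜ[k] (e i * f j - f j * e i) := by
      rw [← h3, ← h4, mul_add, mul_add, add_mul, add_mul, add_mul, add_mul, h1, h2]
      abel
    rw [h5, h.E_F i j]
    split_ifs with hij
    · subst hij
      simp only [TensorProduct.tmul_smul, ← TensorProduct.smul_tmul', TensorProduct.sub_tmul,
        TensorProduct.tmul_sub]
      rw [← smul_add]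
      congr 1
      abel
    · simp
  serre_E i j hij := by
    rw [add_comm, add_comm (e j ⊗ₜ[k] (1 : B)), serre_add _ (qi_ne_zero i),
      serre_tmul_left _ _ _ _ _ _ (h.K_K j i), serre_tmul_right _ _ _ _ _ _ (by simp),
      h.serre_E i j hij]
    · simp
    · simp only [Algebra.TensorProduct.tmul_mul_tmul, h.E_K i i, qi_zpow, D.diag,
        ← TensorProduct.smul_tmul', one_mul, mul_one]
      congr 2; ring
    · simp only [Algebra.TensorProduct.tmul_mul_tmul, h.E_K j i, qi_zpow, serreExp_eq hij,
        ← TensorProduct.smul_tmul', one_mul, mul_one]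
      congr 2; rw [D.symm j i]; ring
    · simp only [Algebra.TensorProduct.tmul_mul_tmul, h.K_E i j, qi_zpow, serreExp_eq hij,
        ← TensorProduct.smul_tmul', one_mul, mul_one]
      congr 2; ring
  serre_F i j hij := by
    rw [serre_add _ (qi_ne_zero i),
      serre_tmul_right _ _ _ _ _ _ (h.Kinv_comm_Kinv j i),
      serre_tmul_left _ _ _ _ _ _ (by simp),
      h.serre_F i j hij]
    · simp
    · simp only [Algebra.TensorProduct.tmul_mul_tmul, h.F_Kinv i i, qi_zpow, D.diag,
        TensorProduct.tmul_smul, one_mul, mul_one]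
      congr 2; ring
    · simp only [Algebra.TensorProduct.tmul_mul_tmul, h.F_Kinv j i, qi_zpow, serreExp_eq hij,
        TensorProduct.tmul_smul, one_mul, mul_one]
      congr 2; rw [D.symm j i]; ring
    · simp only [Algebra.TensorProduct.tmul_mul_tmul, h.Kinv_F i j, qi_zpow, serreExp_eq hij,
        TensorProduct.tmul_smul, one_mul, mul_one]
      congr 2; ring

open MulOpposite in
/-- A family of relations in the opposite algebra, used for the antipode and its inverse. -/
lemma anti (h : URelations D e f κ κ') (c c' : Fin n → k) (hc : ∀ i, c i * c' i = D.q ^ (2 * D.d i)) :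
    URelations D (B := Bᵐᵒᵖ)
      (fun i => op (-(c i • (κ' i * e i)))) (fun i => op (-(c' i • (κ i * f i))))
      (fun i => op (κ' i)) (fun i => op (κ i)) where
  K_K i j := by rw [← op_mul, ← op_mul, h.Kinv_comm_Kinv j i]
  K_Kinv i := by rw [← op_mul, h.K_Kinv i, op_one]
  Kinv_K i := by rw [← op_mul, h.Kinv_K i, op_one]
  K_E i j := by
    rw [← op_mul, ← op_mul, ← op_smul]
    simp only [neg_mul, mul_neg, smul_mul_assoc, mul_smul_comm, smul_neg, mul_assoc, h.E_Kinv i j]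
    rw [← mul_assoc, h.Kinv_comm_Kinv j i, mul_assoc, smul_comm]
  K_F i j := by
    rw [← op_mul, ← op_mul, ← op_smul]
    simp only [neg_mul, mul_neg, smul_mul_assoc, mul_smul_comm, smul_neg, mul_assoc, h.F_Kinv i j]
    rw [← mul_assoc, ← h.Kinv_comm_K i j, mul_assoc, smul_comm]
  E_F i j := by
    have key : (κ j * f j) * (κ' i * e i) - (κ' i * e i) * (κ j * f j) =
        D.q ^ (-(D.d i * D.a i j)) • (κ' i * κ j * (f j * e i - e i * f j)) := by
      have h1 : (κ j * f j) * (κ' i * e i) =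
          D.q ^ (-(D.d i * D.a i j)) • (κ' i * κ j * (f j * e i)) := by
        rw [mul_assoc, ← mul_assoc (f j), h.F_Kinv i j, smul_mul_assoc, mul_smul_comm,
          mul_assoc (κ' i), ← mul_assoc (κ j), h.Kinv_comm_K i j, mul_assoc]
      have h2 : (κ' i * e i) * (κ j * f j) =
          D.q ^ (-(D.d i * D.a i j)) • (κ' i * κ j * (e i * f j)) := by
        rw [mul_assoc, ← mul_assoc (e i), h.E_K j i, smul_mul_assoc, mul_smul_comm,
          mul_assoc (κ j), ← mul_assoc (κ' i), D.symm j i]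
      rw [h1, h2, ← smul_sub, ← mul_sub]
    have h3 : f j * e i - e i * f j =
        if i = j then (D.qi i - (D.qi i)⁻¹)⁻¹ • (κ' i - κ i) else 0 := by
      rw [← neg_sub, h.E_F i j]
      split_ifs
      · rw [← smul_neg, neg_sub]
      · simp
    rw [← op_mul, ← op_mul, ← op_sub]
    have h4 : -(c' j • (κ j * f j)) * -(c i • (κ' i * e i)) -
        -(c i • (κ' i * e i)) * -(c' j • (κ j * f j)) = (c i * c' j) •
        ((κ j * f j) * (κ' i * e i) - (κ' i * e i) * (κ j * f j)) := by
      simp only [neg_mul_neg, smul_mul_assoc, mul_smul_comm, smul_smul, smul_sub]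
      rw [mul_comm (c' j)]
    rw [h4, key, h3]
    split_ifs with hij
    · subst hij
      rw [h.Kinv_K, one_mul, smul_smul, hc, D.diag, ← zpow_add₀ D.q_ne_zero,
        show 2 * D.d i + -(D.d i * 2) = 0 by ring, zpow_zero, one_smul, op_smul, op_sub]
    · simp
  serre_E i j hij := by
    rw [serre_op _ (qi_ne_zero i), ← neg_smul, ← neg_smul, serre_smul,
      serre_mul_left _ (qi_ne_zero i) _ _ _ _ _ _ _ (h.E_Kinv i i) (h.E_Kinv j i)
      (by rw [h.E_Kinv i j, D.symm i j]) (h.Kinv_comm_Kinv j i) (h.serre_E i j hij)]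
    simp
  serre_F i j hij := by
    rw [serre_op _ (qi_ne_zero i), ← neg_smul, ← neg_smul, serre_smul,
      serre_mul_left _ (qi_ne_zero i) _ _ _ _ _ _ _ (h.F_K i i) (h.F_K j i)
      (by rw [h.F_K i j, D.symm i j]) (h.K_K j i) (h.serre_F i j hij)]
    simp

open MulOpposite in
/-- The elements prescribed by the antipode satisfy the relations in the opposite algebra. -/
lemma antipode (h : URelations D e f κ κ') : URelations D (B := Bᵐᵒᵖ)
      (fun i => op (-(κ' i * e i))) (fun i => op (-(f i * κ i)))
      (fun i => op (κ' i)) (fun i => op (κ i)) := by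
  have := h.anti (fun _ => 1) (fun i => D.q ^ (2 * D.d i)) (by simp)
  convert this using 4 with i i
  · simp
  · rw [h.F_K i i, D.diag, mul_comm]

open MulOpposite in
/-- The elements prescribed by the inverse antipode satisfy the relations in the opposite
algebra. -/
lemma antipodeInv (h : URelations D e f κ κ') : URelations D (B := Bᵐᵒᵖ)
      (fun i => op (-(e i * κ' i))) (fun i => op (-(κ i * f i)))
      (fun i => op (κ' i)) (fun i => op (κ i)) := by
  have := h.anti (fun i => D.q ^ (2 * D.d i)) (fun _ => 1) (by simp)
  convert this using 4 with i i
  · rw [h.E_Kinv i i, D.diag, mul_comm]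
  · simp

/-- The elements prescribed by the counit satisfy the defining relations. -/
lemma counit : URelations D (B := k) (fun _ => 0) (fun _ => 0) (fun _ => 1) (fun _ => 1) where
  K_K := by simp
  K_Kinv := by simp
  Kinv_K := by simp
  K_E := by simp
  K_F := by simp
  E_F := by simp
  serre_E i j _ := by simp [serre]
  serre_F i j _ := by simp [serre]

end URelations

/-- The free algebra generator attached to a symbol. -/
abbrev gen (k : Type u) [Field k] {X : Type} (x : X) : FreeAlgebra k X := FreeAlgebra.ι k x

open UGen in
/-- The defining relations of the quantized enveloping algebra `U_q`. -/
inductive URel (D : Datum k n) : FreeAlgebra k (UGen n) → FreeAlgebra k (UGen n) → Prop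
  | K_K (i j) : URel D (gen k (K i) * gen k (K j)) (gen k (K j) * gen k (K i))
  | K_Kinv (i) : URel D (gen k (K i) * gen k (Kinv i)) 1
  | Kinv_K (i) : URel D (gen k (Kinv i) * gen k (K i)) 1
  | K_E (i j) : URel D (gen k (K i) * gen k (E j))
      (D.q ^ (D.d i * D.a i j) • (gen k (E j) * gen k (K i)))
  | K_F (i j) : URel D (gen k (K i) * gen k (F j))
      (D.q ^ (-(D.d i * D.a i j)) • (gen k (F j) * gen k (K i)))
  | E_F (i j) : URel D (gen k (E i) * gen k (F j) - gen k (F j) * gen k (E i))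
      (if i = j then (D.qi i - (D.qi i)⁻¹)⁻¹ • (gen k (K i) - gen k (Kinv i)) else 0)
  | serre_E (i j) : i ≠ j →
      URel D (serre (D.qi i) (D.serreExp i j) (gen k (E i)) (gen k (E j))) 0
  | serre_F (i j) : i ≠ j →
      URel D (serre (D.qi i) (D.serreExp i j) (gen k (F i)) (gen k (F j))) 0

/-- The quantized enveloping algebra `U_q`. -/
def Uq (D : Datum k n) : Type u := RingQuot (URel D)

namespace Uq

instance (D : Datum k n) : Ring (Uq D) := inferInstanceAs (Ring (RingQuot (URel D)))
instance instAlgebra (D : Datum k n) : Algebra k (Uq D) :=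
  inferInstanceAs (Algebra k (RingQuot (URel D)))

variable (D : Datum k n)

/-- The quotient map from the free algebra. -/
def mk : FreeAlgebra k (UGen n) →ₐ[k] Uq D := RingQuot.mkAlgHom k (URel D)

variable {D} in
/-- The generator `E_i`. -/
def E (i : Fin n) : Uq D := mk D (gen k (UGen.E i))
variable {D} in
/-- The generator `F_i`. -/
def F (i : Fin n) : Uq D := mk D (gen k (UGen.F i))
variable {D} in
/-- The generator `K_i`. -/
def K (i : Fin n) : Uq D := mk D (gen k (UGen.K i))
variable {D} in
/-- The generator `K_i⁻¹`. -/
def Kinv (i : Fin n) : Uq D := mk D (gen k (UGen.Kinv i))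

variable {D}

lemma mk_rel {x y : FreeAlgebra k (UGen n)} (h : URel D x y) : mk D x = mk D y :=
  RingQuot.mkAlgHom_rel k h

lemma relations : URelations D (B := Uq D) E F K Kinv where
  K_K i j := by simpa [E, F, K, Kinv] using mk_rel (URel.K_K (D := D) i j)
  K_Kinv i := by simpa [E, F, K, Kinv] using mk_rel (URel.K_Kinv (D := D) i)
  Kinv_K i := by simpa [E, F, K, Kinv] using mk_rel (URel.Kinv_K (D := D) i)
  K_E i j := by simpa [E, F, K, Kinv] using mk_rel (URel.K_E (D := D) i j)
  K_F i j := by simpa [E, F, K, Kinv] using mk_rel (URel.K_F (D := D) i j)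
  E_F i j := by
    have := mk_rel (URel.E_F (D := D) i j)
    rw [map_sub, map_mul, map_mul] at this
    refine this.trans ?_
    split_ifs <;> simp [K, Kinv]
  serre_E i j hij := by
    simpa [E, F, serre_map] using mk_rel (URel.serre_E (D := D) i j hij)
  serre_F i j hij := by
    simpa [E, F, serre_map] using mk_rel (URel.serre_F (D := D) i j hij)

section lift

variable {B : Type v} [Ring B] [Algebra k B] {e f κ κ' : Fin n → B}

/-- The images of the generating symbols. -/
def genMap (e f κ κ' : Fin n → B) : UGen n → B
  | .E i => e i
  | .F i => f i
  | .K i => κ i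
  | .Kinv i => κ' i

/-- The universal property of `U_q`. -/
def lift (h : URelations D e f κ κ') : Uq D →ₐ[k] B :=
  RingQuot.liftAlgHom k ⟨FreeAlgebra.lift k (genMap e f κ κ'), by
    intro x y hxy
    cases hxy with
    | K_K i j => simpa [genMap] using h.K_K i j
    | K_Kinv i => simpa [genMap] using h.K_Kinv i
    | Kinv_K i => simpa [genMap] using h.Kinv_K i
    | K_E i j => simpa [genMap] using h.K_E i j
    | K_F i j => simpa [genMap] using h.K_F i j
    | E_F i j =>
      have := h.E_F i j
      split_ifs at this ⊢ <;> simpa [genMap] using this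
    | serre_E i j hij => simpa [genMap, serre_map] using h.serre_E i j hij
    | serre_F i j hij => simpa [genMap, serre_map] using h.serre_F i j hij⟩

lemma lift_mk (h : URelations D e f κ κ') (x : FreeAlgebra k (UGen n)) :
    lift h (mk D x) = FreeAlgebra.lift k (genMap e f κ κ') x :=
  RingQuot.liftAlgHom_mkAlgHom_apply ..

@[simp] lemma lift_E (h : URelations D e f κ κ') (i : Fin n) : lift h (E i) = e i := by
  simp [E, lift_mk, genMap]
@[simp] lemma lift_F (h : URelations D e f κ κ') (i : Fin n) : lift h (F i) = f i := by
  simp [F, lift_mk, genMap]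
@[simp] lemma lift_K (h : URelations D e f κ κ') (i : Fin n) : lift h (K i) = κ i := by
  simp [K, lift_mk, genMap]
@[simp] lemma lift_Kinv (h : URelations D e f κ κ') (i : Fin n) : lift h (Kinv i) = κ' i := by
  simp [Kinv, lift_mk, genMap]

lemma hom_ext {g g' : Uq D →ₐ[k] B} (hE : ∀ i, g (E i) = g' (E i))
    (hF : ∀ i, g (F i) = g' (F i)) (hK : ∀ i, g (K i) = g' (K i))
    (hKinv : ∀ i, g (Kinv i) = g' (Kinv i)) : g = g' := by
  apply RingQuot.ringQuot_ext'
  apply FreeAlgebra.hom_ext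
  funext x
  cases x with
  | E i => exact hE i
  | F i => exact hF i
  | K i => exact hK i
  | Kinv i => exact hKinv i

end lift

/-- Induction over the generators of `U_q`. -/
lemma induction {P : Uq D → Prop} (hE : ∀ i, P (E i)) (hF : ∀ i, P (F i)) (hK : ∀ i, P (K i))
    (hKinv : ∀ i, P (Kinv i)) (halg : ∀ c : k, P (algebraMap k _ c))
    (hadd : ∀ x y, P x → P y → P (x + y)) (hmul : ∀ x y, P x → P y → P (x * y)) (x : Uq D) :
    P x := by
  obtain ⟨x, rfl⟩ : ∃ y, mk D y = x := RingQuot.mkAlgHom_surjective k (URel D) x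
  induction x using FreeAlgebra.induction with
  | grade0 r => simpa using halg r
  | grade1 x =>
    cases x with
    | E i => exact hE i
    | F i => exact hF i
    | K i => exact hK i
    | Kinv i => exact hKinv i
  | mul a b ha hb => simpa using hmul _ _ ha hb
  | add a b ha hb => simpa using hadd _ _ ha hb

variable (D)

/-- The comultiplication: `Δ(E_i) = E_i ⊗ 1 + K_i ⊗ E_i`, `Δ(F_i) = F_i ⊗ K_i⁻¹ + 1 ⊗ F_i`,
`Δ(K_i) = K_i ⊗ K_i`. -/
def comulHom : Uq D →ₐ[k] Uq D ⊗[k] Uq D := lift (relations (D := D)).comul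

/-- The counit: `ε(E_i) = ε(F_i) = 0`, `ε(K_i) = 1`. -/
def counitHom : Uq D →ₐ[k] k := lift URelations.counit

/-- The antipode, as a homomorphism to the opposite algebra:
`S(E_i) = -K_i⁻¹ E_i`, `S(F_i) = -F_i K_i`, `S(K_i) = K_i⁻¹`. -/
def antipodeHom : Uq D →ₐ[k] (Uq D)ᵐᵒᵖ := lift (relations (D := D)).antipode

/-- The inverse antipode, as a homomorphism to the opposite algebra. -/
def antipodeInvHom : Uq D →ₐ[k] (Uq D)ᵐᵒᵖ := lift (relations (D := D)).antipodeInv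

instance : Bialgebra k (Uq D) :=
  Bialgebra.ofAlgHom (comulHom D) (counitHom D)
    (by
      refine hom_ext ?_ ?_ ?_ ?_ <;> intro i <;>
      simp [comulHom, TensorProduct.tmul_add, TensorProduct.add_tmul,
        Algebra.TensorProduct.one_def, add_assoc])
    (by
      refine hom_ext ?_ ?_ ?_ ?_ <;> intro i <;> simp [comulHom, counitHom])
    (by
      refine hom_ext ?_ ?_ ?_ ?_ <;> intro i <;> simp [comulHom, counitHom])

lemma comul_apply (x : Uq D) : Coalgebra.comul (R := k) x = comulHom D x := rfl
lemma counit_apply (x : Uq D) : Coalgebra.counit (R := k) x = counitHom D x := rfl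

/-- The antipode of `U_q` as a linear map. -/
def S : Uq D →ₗ[k] Uq D :=
  (MulOpposite.opLinearEquiv k).symm.toLinearMap ∘ₗ (antipodeHom D).toLinearMap

/-- The inverse of the antipode of `U_q` as a linear map. -/
def Sinv : Uq D →ₗ[k] Uq D :=
  (MulOpposite.opLinearEquiv k).symm.toLinearMap ∘ₗ (antipodeInvHom D).toLinearMap

@[simp] lemma S_mul (x y : Uq D) : S D (x * y) = S D y * S D x := by simp [S]
@[simp] lemma S_algebraMap (c : k) : S D (algebraMap k _ c) = algebraMap k _ c := by simp [S]
@[simp] lemma S_E (i : Fin n) : S D (E i) = -(Kinv i * E i) := by simp [S, antipodeHom]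
@[simp] lemma S_F (i : Fin n) : S D (F i) = -(F i * K i) := by simp [S, antipodeHom]
@[simp] lemma S_K (i : Fin n) : S D (K i) = Kinv i := by simp [S, antipodeHom]
@[simp] lemma S_Kinv (i : Fin n) : S D (Kinv i) = K i := by simp [S, antipodeHom]
@[simp] lemma S_one : S D 1 = 1 := by simp [S]
@[simp] lemma Sinv_mul (x y : Uq D) : Sinv D (x * y) = Sinv D y * Sinv D x := by simp [Sinv]
@[simp] lemma Sinv_algebraMap (c : k) : Sinv D (algebraMap k _ c) = algebraMap k _ c := by
  simp [Sinv]
@[simp] lemma Sinv_E (i : Fin n) : Sinv D (E i) = -(E i * Kinv i) := by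
  simp [Sinv, antipodeInvHom]
@[simp] lemma Sinv_F (i : Fin n) : Sinv D (F i) = -(K i * F i) := by
  simp [Sinv, antipodeInvHom]
@[simp] lemma Sinv_K (i : Fin n) : Sinv D (K i) = Kinv i := by simp [Sinv, antipodeInvHom]
@[simp] lemma Sinv_Kinv (i : Fin n) : Sinv D (Kinv i) = K i := by simp [Sinv, antipodeInvHom]

@[simp] lemma K_mul_Kinv (i : Fin n) : (K i * Kinv i : Uq D) = 1 := relations.K_Kinv i
@[simp] lemma Kinv_mul_K (i : Fin n) : (Kinv i * K i : Uq D) = 1 := relations.Kinv_K i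

lemma S_Sinv (x : Uq D) : S D (Sinv D x) = x := by
  induction x using induction with
  | hE i => simp [← mul_assoc]
  | hF i => simp [mul_assoc]
  | hK i => simp
  | hKinv i => simp
  | halg c => simp
  | hadd x y hx hy => simp [hx, hy]
  | hmul x y hx hy => simp [hx, hy]

lemma Sinv_S (x : Uq D) : Sinv D (S D x) = x := by
  induction x using induction with
  | hE i => simp [mul_assoc]
  | hF i => simp [← mul_assoc]
  | hK i => simp
  | hKinv i => simp
  | halg c => simp
  | hadd x y hx hy => simp [hx, hy]
  | hmul x y hx hy => simp [hx, hy]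

instance : HopfAlgebra k (Uq D) where
  antipode := S D
  mul_antipode_rTensor_comul := by
    ext x
    change LinearMap.mul' k _ ((S D).rTensor _ (comulHom D x)) = algebraMap k _ (counitHom D x)
    induction x using induction with
    | hE i => simp [comulHom, counitHom]
    | hF i => simp [comulHom, counitHom, mul_assoc]
    | hK i => simp [comulHom, counitHom]
    | hKinv i => simp [comulHom, counitHom]
    | halg c => simp [Algebra.TensorProduct.algebraMap_apply]
    | hadd x y hx hy => simp only [map_add, hx, hy]
    | hmul x y hx hy =>
      have H (t : Uq D ⊗[k] Uq D) (b c : Uq D) :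
          LinearMap.mul' k _ ((S D).rTensor _ (t * b ⊗ₜ c)) =
          S D b * LinearMap.mul' k _ ((S D).rTensor _ t) * c := by
        induction t with
        | zero => simp
        | tmul a a' => simp [mul_assoc]
        | add t t' h h' => simp only [add_mul, map_add, h, h', mul_add]
      have H' (t : Uq D ⊗[k] Uq D) :
          LinearMap.mul' k _ ((S D).rTensor _ (comulHom D x * t)) =
          algebraMap k _ (counitHom D x) * LinearMap.mul' k _ ((S D).rTensor _ t) := by
        induction t with
        | zero => simp
        | tmul a a' =>
          rw [H, hx, ← Algebra.commutes]; simp [mul_assoc]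
        | add t t' h h' => simp only [mul_add, map_add, h, h']
      rw [map_mul, H', hy, map_mul, map_mul]
  mul_antipode_lTensor_comul := by
    ext x
    change LinearMap.mul' k _ ((S D).lTensor _ (comulHom D x)) = algebraMap k _ (counitHom D x)
    induction x using induction with
    | hE i => simp [comulHom, counitHom, ← mul_assoc]
    | hF i => simp [comulHom, counitHom]
    | hK i => simp [comulHom, counitHom]
    | hKinv i => simp [comulHom, counitHom]
    | halg c => simp [Algebra.TensorProduct.algebraMap_apply]
    | hadd x y hx hy => simp only [map_add, hx, hy]
    | hmul x y hx hy =>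
      have H (t : Uq D ⊗[k] Uq D) (b c : Uq D) :
          LinearMap.mul' k _ ((S D).lTensor _ (b ⊗ₜ c * t)) =
          b * LinearMap.mul' k _ ((S D).lTensor _ t) * S D c := by
        induction t with
        | zero => simp
        | tmul a a' => simp [mul_assoc]
        | add t t' h h' => simp only [add_mul, map_add, h, h', mul_add]
      have H' (t : Uq D ⊗[k] Uq D) :
          LinearMap.mul' k _ ((S D).lTensor _ (t * comulHom D y)) =
          LinearMap.mul' k _ ((S D).lTensor _ t) * algebraMap k _ (counitHom D y) := by
        induction t with
        | zero => simp
        | tmul a a' =>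
          rw [H, hy, mul_assoc, Algebra.commutes]; simp [mul_assoc]
        | add t t' h h' => simp only [add_mul, map_add, h, h']
      rw [map_mul, H', hx, map_mul, map_mul]

end Uq

/-! ### Hopf subalgebras -/

section HopfSub

variable {H : Type v} [Ring H] [HopfAlgebra k H]

/-- A subalgebra `B` of a Hopf algebra over a field is a Hopf subalgebra if `Δ(B) ⊆ B ⊗ B` and
`S(B) ⊆ B`. -/
structure IsHopfSubalgebra (B : Subalgebra k H) : Prop where
  comul_mem : ∀ x ∈ B, Coalgebra.comul (R := k) x ∈ (Algebra.TensorProduct.map B.val B.val).range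
  antipode_mem : ∀ x ∈ B, HopfAlgebra.antipode k x ∈ B

namespace IsHopfSubalgebra

variable {B : Subalgebra k H}

lemma map_val_injective (B : Subalgebra k H) :
    Function.Injective (Algebra.TensorProduct.map B.val B.val) :=
  TensorProduct.map_injective_of_flat_flat B.val.toLinearMap B.val.toLinearMap
    Subtype.val_injective Subtype.val_injective

lemma map_map_val_injective (B : Subalgebra k H) :
    Function.Injective (Algebra.TensorProduct.map B.val (Algebra.TensorProduct.map B.val B.val)) :=
  TensorProduct.map_injective_of_flat_flat B.val.toLinearMap
    (Algebra.TensorProduct.map B.val B.val).toLinearMap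
    Subtype.val_injective (map_val_injective B)

variable (hB : IsHopfSubalgebra B)

/-- The restricted comultiplication. -/
def comulHom : B →ₐ[k] B ⊗[k] B :=
  (AlgEquiv.ofInjective (Algebra.TensorProduct.map B.val B.val)
    (map_val_injective B)).symm.toAlgHom.comp
  (((Bialgebra.comulAlgHom k H).comp B.val).codRestrict _ fun x => hB.comul_mem x x.2)

lemma map_comulHom (x : B) : Algebra.TensorProduct.map B.val B.val (hB.comulHom x) =
    Coalgebra.comul (R := k) (x : H) := by
  have := AlgEquiv.ofInjective_apply (Algebra.TensorProduct.map B.val B.val)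
    (map_val_injective B) (hB.comulHom x)
  rw [← this]
  exact congrArg Subtype.val (AlgEquiv.apply_symm_apply
    (AlgEquiv.ofInjective (Algebra.TensorProduct.map B.val B.val) (map_val_injective B))
    ((((Bialgebra.comulAlgHom k H).comp B.val).codRestrict _ fun x => hB.comul_mem x x.2) x))

/-- The restricted antipode. -/
def antipode : B →ₗ[k] B where
  toFun x := ⟨HopfAlgebra.antipode k (x : H), hB.antipode_mem x x.2⟩
  map_add' x y := by ext; simp
  map_smul' c x := by ext; simp

lemma comulHom_coassoc (x : B) :
    Algebra.TensorProduct.assoc k k k B B B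
      (Algebra.TensorProduct.map hB.comulHom (.id k B) (hB.comulHom x)) =
    Algebra.TensorProduct.map (.id k B) hB.comulHom (hB.comulHom x) := by
  apply map_map_val_injective B
  have h0 (s : B ⊗[k] B) (b : B) :
      Algebra.TensorProduct.map B.val (Algebra.TensorProduct.map B.val B.val)
        (Algebra.TensorProduct.assoc k k k B B B (s ⊗ₜ b)) =
      Algebra.TensorProduct.assoc k k k H H H
        (Algebra.TensorProduct.map B.val B.val s ⊗ₜ (b : H)) := by
    induction s with
    | zero => simp
    | tmul a c => simp
    | add s s' h h' => simp only [TensorProduct.add_tmul, map_add, h, h']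
  have h1 (t : B ⊗[k] B) :
      Algebra.TensorProduct.map B.val (Algebra.TensorProduct.map B.val B.val)
        (Algebra.TensorProduct.assoc k k k B B B
          (Algebra.TensorProduct.map hB.comulHom (.id k B) t)) =
      TensorProduct.assoc k H H H ((Coalgebra.comul (R := k) (A := H)).rTensor H
        (Algebra.TensorProduct.map B.val B.val t)) := by
    induction t with
    | zero => simp
    | tmul a c =>
      rw [Algebra.TensorProduct.map_tmul, h0, map_comulHom]; rfl
    | add s s' h h' => simp only [map_add, h, h']
  have h2 (t : B ⊗[k] B) :
      Algebra.TensorProduct.map B.val (Algebra.TensorProduct.map B.val B.val)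
        (Algebra.TensorProduct.map (.id k B) hB.comulHom t) =
      (Coalgebra.comul (R := k) (A := H)).lTensor H
        (Algebra.TensorProduct.map B.val B.val t) := by
    induction t with
    | zero => simp
    | tmul a c =>
      rw [Algebra.TensorProduct.map_tmul, Algebra.TensorProduct.map_tmul, map_comulHom]; rfl
    | add s s' h h' => simp only [map_add, h, h']
  rw [h1, h2, map_comulHom, Coalgebra.coassoc_apply]

lemma comulHom_counit_left (x : B) :
    Algebra.TensorProduct.map ((Bialgebra.counitAlgHom k H).comp B.val) (.id k B)
      (hB.comulHom x) = 1 ⊗ₜ x := by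
  have hinj : Function.Injective (Algebra.TensorProduct.map (.id k k) B.val) :=
    TensorProduct.map_injective_of_flat_flat LinearMap.id B.val.toLinearMap
      Function.injective_id Subtype.val_injective
  apply hinj
  have h1 (t : B ⊗[k] B) : Algebra.TensorProduct.map (.id k k) B.val
      (Algebra.TensorProduct.map ((Bialgebra.counitAlgHom k H).comp B.val) (.id k B) t) =
      (Coalgebra.counit (R := k) (A := H)).rTensor H
        (Algebra.TensorProduct.map B.val B.val t) := by
    induction t with
    | zero => simp
    | tmul a c => simp
    | add s s' h h' => simp only [map_add, h, h']
  rw [h1, map_comulHom, Coalgebra.rTensor_counit_comul]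
  simp

lemma comulHom_counit_right (x : B) :
    Algebra.TensorProduct.map (.id k B) ((Bialgebra.counitAlgHom k H).comp B.val)
      (hB.comulHom x) = x ⊗ₜ 1 := by
  have hinj : Function.Injective (Algebra.TensorProduct.map B.val (.id k k)) :=
    TensorProduct.map_injective_of_flat_flat B.val.toLinearMap LinearMap.id
      Subtype.val_injective Function.injective_id
  apply hinj
  have h1 (t : B ⊗[k] B) : Algebra.TensorProduct.map B.val (.id k k)
      (Algebra.TensorProduct.map (.id k B) ((Bialgebra.counitAlgHom k H).comp B.val) t) =
      (Coalgebra.counit (R := k) (A := H)).lTensor H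
        (Algebra.TensorProduct.map B.val B.val t) := by
    induction t with
    | zero => simp
    | tmul a c => simp
    | add s s' h h' => simp only [map_add, h, h']
  rw [h1, map_comulHom, Coalgebra.lTensor_counit_comul]
  simp

lemma antipode_left (x : B) : LinearMap.mul' k B (hB.antipode.rTensor B (hB.comulHom x)) =
    algebraMap k B (Coalgebra.counit (R := k) (x : H)) := by
  have h1 (t : B ⊗[k] B) : ((LinearMap.mul' k B (hB.antipode.rTensor B t) : B) : H) =
      LinearMap.mul' k H ((HopfAlgebra.antipode k (A := H)).rTensor H
        (Algebra.TensorProduct.map B.val B.val t)) := by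
    induction t with
    | zero => simp
    | tmul a c => simp [antipode]
    | add s s' h h' => simp only [map_add, h, h', Subalgebra.coe_add]
  apply Subtype.ext
  rw [h1, map_comulHom, HopfAlgebra.mul_antipode_rTensor_comul_apply]
  rfl

lemma antipode_right (x : B) : LinearMap.mul' k B (hB.antipode.lTensor B (hB.comulHom x)) =
    algebraMap k B (Coalgebra.counit (R := k) (x : H)) := by
  have h1 (t : B ⊗[k] B) : ((LinearMap.mul' k B (hB.antipode.lTensor B t) : B) : H) =
      LinearMap.mul' k H ((HopfAlgebra.antipode k (A := H)).lTensor H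
        (Algebra.TensorProduct.map B.val B.val t)) := by
    induction t with
    | zero => simp
    | tmul a c => simp [antipode]
    | add s s' h h' => simp only [map_add, h, h', Subalgebra.coe_add]
  apply Subtype.ext
  rw [h1, map_comulHom, HopfAlgebra.mul_antipode_lTensor_comul_apply]
  rfl

/-- A Hopf subalgebra is a Hopf algebra with the restricted structure maps. -/
abbrev hopfAlgebra : HopfAlgebra k B :=
  letI : Bialgebra k B := Bialgebra.ofAlgHom hB.comulHom ((Bialgebra.counitAlgHom k H).comp B.val)
    (AlgHom.ext hB.comulHom_coassoc) (AlgHom.ext hB.comulHom_counit_left)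
    (AlgHom.ext hB.comulHom_counit_right)
  { antipode := hB.antipode
    mul_antipode_rTensor_comul := LinearMap.ext hB.antipode_left
    mul_antipode_lTensor_comul := LinearMap.ext hB.antipode_right }

end IsHopfSubalgebra

end HopfSub

/-! ### Skew Hopf pairings and the quantum double -/

/-- The antipode of the Hopf algebra `H` is bijective. -/
class BijectiveAntipode (k : Type u) (H : Type v) [Field k] [Ring H] [HopfAlgebra k H] : Prop where
  bijective : Function.Bijective (HopfAlgebra.antipode k (A := H))

/-- The inverse `S⁻¹` of a bijective antipode. -/
def antipodeInv (k : Type u) (H : Type v) [Field k] [Ring H] [HopfAlgebra k H]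
    [BijectiveAntipode k H] : H →ₗ[k] H :=
  (LinearEquiv.ofBijective (HopfAlgebra.antipode k (A := H))
    BijectiveAntipode.bijective).symm.toLinearMap

section Double

variable {H : Type v} {H' : Type w} [Ring H] [HopfAlgebra k H] [Ring H'] [HopfAlgebra k H']

/-- The extension `φ(x ⊗ x', y ⊗ y') = φ(x, y) φ(x', y')` of a bilinear pairing to tensor
squares. -/
def tensorPairing (φ : H →ₗ[k] H' →ₗ[k] k) : H ⊗[k] H →ₗ[k] H' ⊗[k] H' →ₗ[k] k :=
  (TensorProduct.map₂ φ φ).compr₂ (LinearMap.mul' k k)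

/-- The axioms of a skew Hopf pairing relating products, coproducts and antipodes. -/
structure IsSkewHopfPairing [BijectiveAntipode k H'] (φ : H →ₗ[k] H' →ₗ[k] k) : Prop where
  /-- `φ(x, y y') = φ(Δᵒᵖ(x), y ⊗ y')` -/
  mul_right : ∀ x y y',
    φ x (y * y') = tensorPairing φ (TensorProduct.comm k H H (Coalgebra.comul x)) (y ⊗ₜ y')
  /-- `φ(x x', y) = φ(x ⊗ x', Δ(y))` -/
  mul_left : ∀ x x' y, φ (x * x') y = tensorPairing φ (x ⊗ₜ x') (Coalgebra.comul y)
  /-- `φ(S(x), y) = φ(x, S⁻¹(y))` -/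
  antipode : ∀ x y, φ (HopfAlgebra.antipode k x) y = φ x (antipodeInv k H' y)

/-- The iterated comultiplication `x ↦ ∑ x₍₁₎ ⊗ x₍₂₎ ⊗ x₍₃₎`. -/
def comulTwo (k : Type u) (H : Type v) [Field k] [Ring H] [HopfAlgebra k H] :
    H →ₗ[k] H ⊗[k] (H ⊗[k] H) :=
  (Coalgebra.comul (R := k) (A := H)).lTensor H ∘ₗ Coalgebra.comul

/-- The quantum double `D(H, H')` of `(H, H', φ)`: the vector space `H ⊗ H'` with the
multiplication given by `doubleMul φ` below and the unit `1 ⊗ 1`. -/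
def QuantumDouble (_φ : H →ₗ[k] H' →ₗ[k] k) : Type (max v w) := H ⊗[k] H'

namespace QuantumDouble

variable (φ : H →ₗ[k] H' →ₗ[k] k)

instance : AddCommGroup (QuantumDouble φ) := inferInstanceAs (AddCommGroup (H ⊗[k] H'))

instance : Module k (QuantumDouble φ) := inferInstanceAs (Module k (H ⊗[k] H'))

/-- The pure tensor `x ⊗ y` as an element of the quantum double. -/
def tmul (x : H) (y : H') : QuantumDouble φ := (x ⊗ₜ[k] y : H ⊗[k] H')

instance : One (QuantumDouble φ) := ⟨tmul φ 1 1⟩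

end QuantumDouble

variable [BijectiveAntipode k H'] (φ : H →ₗ[k] H' →ₗ[k] k)

/-- The bilinear map
`(x', y) ↦ ∑ φ(x'₍₁₎, y₍₁₎) φ(x'₍₃₎, S⁻¹(y₍₃₎)) x'₍₂₎ ⊗ y₍₂₎`. -/
def cross : H →ₗ[k] H' →ₗ[k] H ⊗[k] H' :=
  ((TensorProduct.map₂ φ (TensorProduct.map₂ (TensorProduct.mk k H H')
    (φ.compl₂ (antipodeInv k H')))).compl₁₂ (comulTwo k H) (comulTwo k H')).compr₂
    ((TensorProduct.rid k (H ⊗[k] H')).toLinearMap ∘ₗ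
      (TensorProduct.lid k ((H ⊗[k] H') ⊗[k] k)).toLinearMap)

/-- The multiplication of the quantum double:
`(x ⊗ y) (x' ⊗ y') = ∑ φ(x'₍₁₎, y₍₁₎) (x x'₍₂₎ ⊗ y₍₂₎ y') φ(x'₍₃₎, S⁻¹(y₍₃₎))`. -/
def doubleMul : H ⊗[k] H' →ₗ[k] H ⊗[k] H' →ₗ[k] H ⊗[k] H' :=
  TensorProduct.lift <| LinearMap.mk₂ k
    (fun x y => TensorProduct.lift <| LinearMap.mk₂ k
      (fun x' y' => TensorProduct.map (LinearMap.mul k H x) ((LinearMap.mul k H').flip y')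
        (cross φ x' y))
      (by intros; simp) (by intros; simp)
      (by intros; rw [map_add, TensorProduct.map_add_right]; rfl)
      (by intros; rw [map_smul, TensorProduct.map_smul_right]; rfl))
    (by
      intro x₁ x₂ y
      ext x' y'
      simp only [map_add, TensorProduct.map_add_left]
      rfl)
    (by
      intro c x y
      ext x' y'
      simp only [map_smul, TensorProduct.map_smul_left]
      rfl)
    (by
      intro x y₁ y₂
      ext x' y'
      simp)
    (by
      intro c x y
      ext x' y'
      simp)

lemma doubleMul_tmul (x x' : H) (y y' : H') :
    doubleMul φ (x ⊗ₜ y) (x' ⊗ₜ y') =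
      TensorProduct.map (LinearMap.mul k H x) ((LinearMap.mul k H').flip y') (cross φ x' y) :=
  rfl

instance : Mul (QuantumDouble φ) := ⟨fun a b => doubleMul φ a b⟩

end Double

/-! ### The Hopf subalgebras `U_q^{≥0}`, `U_q^{≤0}` and their pairing -/

namespace Uq

variable (D : Datum k n)

/-- The subalgebra `U_q^0` generated by the `K_i^{±1}`. -/
def zeroPart : Subalgebra k (Uq D) := Algebra.adjoin k (Set.range K ∪ Set.range Kinv)

/-- The subalgebra `U_q^{≥0} = U_q^+ U_q^0`, generated by the `E_i` and the `K_i^{±1}`. -/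
def geZero : Subalgebra k (Uq D) :=
  Algebra.adjoin k (Set.range E ∪ (Set.range K ∪ Set.range Kinv))

/-- The subalgebra `U_q^{≤0} = U_q^- U_q^0`, generated by the `F_i` and the `K_i^{±1}`. -/
def leZero : Subalgebra k (Uq D) :=
  Algebra.adjoin k (Set.range F ∪ (Set.range K ∪ Set.range Kinv))

variable {D}

lemma E_mem (i : Fin n) : (E i : Uq D) ∈ geZero D :=
  Algebra.subset_adjoin (Or.inl ⟨i, rfl⟩)
lemma K_mem_geZero (i : Fin n) : (K i : Uq D) ∈ geZero D :=
  Algebra.subset_adjoin (Or.inr (Or.inl ⟨i, rfl⟩))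
lemma Kinv_mem_geZero (i : Fin n) : (Kinv i : Uq D) ∈ geZero D :=
  Algebra.subset_adjoin (Or.inr (Or.inr ⟨i, rfl⟩))
lemma F_mem (i : Fin n) : (F i : Uq D) ∈ leZero D :=
  Algebra.subset_adjoin (Or.inl ⟨i, rfl⟩)
lemma K_mem_leZero (i : Fin n) : (K i : Uq D) ∈ leZero D :=
  Algebra.subset_adjoin (Or.inr (Or.inl ⟨i, rfl⟩))
lemma Kinv_mem_leZero (i : Fin n) : (Kinv i : Uq D) ∈ leZero D :=
  Algebra.subset_adjoin (Or.inr (Or.inr ⟨i, rfl⟩))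

lemma map_mem_of_anti {s : Set (Uq D)} (T : Uq D →ₗ[k] Uq D)
    (hmul : ∀ x y, T (x * y) = T y * T x)
    (halg : ∀ c : k, T (algebraMap k _ c) = algebraMap k _ c)
    (hs : ∀ x ∈ s, T x ∈ Algebra.adjoin k s) (x : Uq D) (hx : x ∈ Algebra.adjoin k s) :
    T x ∈ Algebra.adjoin k s := by
  induction hx using Algebra.adjoin_induction with
  | mem x hx => exact hs x hx
  | algebraMap c => rw [halg]; exact Subalgebra.algebraMap_mem _ c
  | add x y _ _ hx hy => rw [map_add]; exact add_mem hx hy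
  | mul x y _ _ hx hy => rw [hmul]; exact mul_mem hy hx

lemma comul_mem_of_gens {s : Set (Uq D)}
    (hs : ∀ x ∈ s, comulHom D x ∈ (Algebra.TensorProduct.map (Algebra.adjoin k s).val
      (Algebra.adjoin k s).val).range) (x : Uq D) (hx : x ∈ Algebra.adjoin k s) :
    comulHom D x ∈ (Algebra.TensorProduct.map (Algebra.adjoin k s).val
      (Algebra.adjoin k s).val).range := by
  have : Algebra.adjoin k s ≤ ((Algebra.TensorProduct.map (Algebra.adjoin k s).val
      (Algebra.adjoin k s).val).range).comap (comulHom D) := Algebra.adjoin_le hs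
  exact this hx

lemma tmul_mem {B : Subalgebra k (Uq D)} {x y : Uq D} (hx : x ∈ B) (hy : y ∈ B) :
    x ⊗ₜ[k] y ∈ (Algebra.TensorProduct.map B.val B.val).range :=
  ⟨(⟨x, hx⟩ : B) ⊗ₜ (⟨y, hy⟩ : B), rfl⟩

lemma isHopfSubalgebra_geZero : IsHopfSubalgebra (geZero D) where
  comul_mem := comul_mem_of_gens (by
    rintro _ (⟨i, rfl⟩ | ⟨i, rfl⟩ | ⟨i, rfl⟩)
    · simp only [comulHom, lift_E]
      exact add_mem (tmul_mem (E_mem i) (one_mem _)) (tmul_mem (K_mem_geZero i) (E_mem i))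
    · simp only [comulHom, lift_K]
      exact tmul_mem (K_mem_geZero i) (K_mem_geZero i)
    · simp only [comulHom, lift_Kinv]
      exact tmul_mem (Kinv_mem_geZero i) (Kinv_mem_geZero i))
  antipode_mem := map_mem_of_anti (S D) (S_mul D) (S_algebraMap D) (by
    rintro _ (⟨i, rfl⟩ | ⟨i, rfl⟩ | ⟨i, rfl⟩)
    · rw [S_E]; exact neg_mem (mul_mem (Kinv_mem_geZero i) (E_mem i))
    · rw [S_K]; exact Kinv_mem_geZero i
    · rw [S_Kinv]; exact K_mem_geZero i)

lemma isHopfSubalgebra_leZero : IsHopfSubalgebra (leZero D) where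
  comul_mem := comul_mem_of_gens (by
    rintro _ (⟨i, rfl⟩ | ⟨i, rfl⟩ | ⟨i, rfl⟩)
    · simp only [comulHom, lift_F]
      exact add_mem (tmul_mem (F_mem i) (Kinv_mem_leZero i)) (tmul_mem (one_mem _) (F_mem i))
    · simp only [comulHom, lift_K]
      exact tmul_mem (K_mem_leZero i) (K_mem_leZero i)
    · simp only [comulHom, lift_Kinv]
      exact tmul_mem (Kinv_mem_leZero i) (Kinv_mem_leZero i))
  antipode_mem := map_mem_of_anti (S D) (S_mul D) (S_algebraMap D) (by
    rintro _ (⟨i, rfl⟩ | ⟨i, rfl⟩ | ⟨i, rfl⟩)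
    · rw [S_F]; exact neg_mem (mul_mem (F_mem i) (K_mem_leZero i))
    · rw [S_K]; exact Kinv_mem_leZero i
    · rw [S_Kinv]; exact K_mem_leZero i)

lemma Sinv_mem_leZero (x : Uq D) (hx : x ∈ leZero D) : Sinv D x ∈ leZero D :=
  map_mem_of_anti (Sinv D) (Sinv_mul D) (Sinv_algebraMap D) (by
    rintro _ (⟨i, rfl⟩ | ⟨i, rfl⟩ | ⟨i, rfl⟩)
    · rw [Sinv_F]; exact neg_mem (mul_mem (K_mem_leZero i) (F_mem i))
    · rw [Sinv_K]; exact Kinv_mem_leZero i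
    · rw [Sinv_Kinv]; exact K_mem_leZero i) x hx

instance : HopfAlgebra k (geZero D) := isHopfSubalgebra_geZero.hopfAlgebra

instance : HopfAlgebra k (leZero D) := isHopfSubalgebra_leZero.hopfAlgebra

instance : BijectiveAntipode k (leZero D) where
  bijective := by
    constructor
    · intro x y hxy
      have h : S D x = S D y := congrArg Subtype.val hxy
      apply Subtype.ext
      rw [← Sinv_S D x, h, Sinv_S]
    · intro (x : leZero D)
      exact ⟨⟨Sinv D x, Sinv_mem_leZero (x : Uq D) x.2⟩, Subtype.ext (S_Sinv D x)⟩

/-- `E_i` as an element of `U_q^{≥0}`. -/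
def geE (i : Fin n) : geZero D := ⟨E i, E_mem i⟩
/-- `K_i` as an element of `U_q^{≥0}`. -/
def geK (i : Fin n) : geZero D := ⟨K i, K_mem_geZero i⟩
/-- `K_i⁻¹` as an element of `U_q^{≥0}`. -/
def geKinv (i : Fin n) : geZero D := ⟨Kinv i, Kinv_mem_geZero i⟩
/-- `F_i` as an element of `U_q^{≤0}`. -/
def leF (i : Fin n) : leZero D := ⟨F i, F_mem i⟩
/-- `K_i` as an element of `U_q^{≤0}`. -/
def leK (i : Fin n) : leZero D := ⟨K i, K_mem_leZero i⟩
/-- `K_i⁻¹` as an element of `U_q^{≤0}`. -/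
def leKinv (i : Fin n) : leZero D := ⟨Kinv i, Kinv_mem_leZero i⟩

variable (D)

/-- The elements of `U_q^{≥0}` of weight `∑ μ_i α_i`: the span of the products of a monomial in the
`E_i` containing each `E_i` exactly `μ_i` times with an element of `U_q^0`. -/
def posWeight (μ : Fin n → ℕ) : Submodule k (Uq D) :=
  Submodule.span k {x | ∃ l : List (Fin n), (∀ i, l.count i = μ i) ∧
    ∃ u ∈ zeroPart D, x = (l.map E).prod * u}

/-- The elements of `U_q^{≤0}` of weight `-∑ μ_i α_i`: the span of the products of a monomial in
the `F_i` containing each `F_i` exactly `μ_i` times with an element of `U_q^0`. -/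
def negWeight (μ : Fin n → ℕ) : Submodule k (Uq D) :=
  Submodule.span k {y | ∃ l : List (Fin n), (∀ i, l.count i = μ i) ∧
    ∃ u ∈ zeroPart D, y = (l.map F).prod * u}

variable {D}

/-- The defining properties of the Lusztig (skew Hopf) pairing of `U_q^{≥0}` and `U_q^{≤0}`. -/
structure IsLusztigPairing (φ : geZero D →ₗ[k] leZero D →ₗ[k] k) : Prop
    extends IsSkewHopfPairing φ where
  one_one : φ 1 1 = 1
  one_K : ∀ i, φ 1 (leK i) = 1
  K_one : ∀ i, φ (geK i) 1 = 1
  weight : ∀ (μ ν : Fin n → ℕ) (x : geZero D) (y : leZero D), μ ≠ ν →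
    (x : Uq D) ∈ posWeight D μ → (y : Uq D) ∈ negWeight D ν → φ x y = 0
  E_F : ∀ i j, φ (geE i) (leF j) = if i = j then (D.q ^ (2 * D.d i) - 1)⁻¹ else 0
  K_K : ∀ i j, φ (geK i) (leK j) = D.q ^ (D.d i * D.a i j)
  K_Kinv : ∀ i j, φ (geK i) (leKinv j) = D.q ^ (-(D.d i * D.a i j))

end Uq

/-! ### The algebra given by generators and relations -/

/-- Symbols for the generators `E_i, F_i, K_i, K_i⁻¹, K̃_i, K̃_i⁻¹`. -/
inductive DGen (n : ℕ) : Type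
  | E (i : Fin n)
  | F (i : Fin n)
  | K (i : Fin n)
  | Kinv (i : Fin n)
  | Kt (i : Fin n)
  | Ktinv (i : Fin n)

open DGen in
/-- The defining relations of the presentation of the quantum double. -/
inductive DRel (D : Datum k n) : FreeAlgebra k (DGen n) → FreeAlgebra k (DGen n) → Prop
  | K_K (i j) : DRel D (gen k (K i) * gen k (K j)) (gen k (K j) * gen k (K i))
  | K_Kinv (i) : DRel D (gen k (K i) * gen k (Kinv i)) 1
  | Kinv_K (i) : DRel D (gen k (Kinv i) * gen k (K i)) 1
  | Kt_Kt (i j) : DRel D (gen k (Kt i) * gen k (Kt j)) (gen k (Kt j) * gen k (Kt i))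
  | Kt_Ktinv (i) : DRel D (gen k (Kt i) * gen k (Ktinv i)) 1
  | Ktinv_Kt (i) : DRel D (gen k (Ktinv i) * gen k (Kt i)) 1
  | K_Kt (i j) : DRel D (gen k (K i) * gen k (Kt j)) (gen k (Kt j) * gen k (K i))
  | K_E (i j) : DRel D (gen k (K i) * gen k (E j))
      (D.q ^ (D.d i * D.a i j) • (gen k (E j) * gen k (K i)))
  | K_F (i j) : DRel D (gen k (K i) * gen k (F j))
      (D.q ^ (-(D.d i * D.a i j)) • (gen k (F j) * gen k (K i)))
  | Kt_E (i j) : DRel D (gen k (Kt i) * gen k (E j))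
      (D.q ^ (D.d i * D.a i j) • (gen k (E j) * gen k (Kt i)))
  | Kt_F (i j) : DRel D (gen k (Kt i) * gen k (F j))
      (D.q ^ (-(D.d i * D.a i j)) • (gen k (F j) * gen k (Kt i)))
  | E_F (i j) : DRel D (gen k (E i) * gen k (F j) - gen k (F j) * gen k (E i))
      (if i = j then (D.qi i - (D.qi i)⁻¹)⁻¹ • (gen k (K i) - gen k (Ktinv i)) else 0)
  | serre_E (i j) : i ≠ j →
      DRel D (serre (D.qi i) (D.serreExp i j) (gen k (E i)) (gen k (E j))) 0
  | serre_F (i j) : i ≠ j →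
      DRel D (serre (D.qi i) (D.serreExp i j) (gen k (F i)) (gen k (F j))) 0

/-- The algebra presented by the generators `E_i, F_i, K_i^{±1}, K̃_i^{±1}` and the relations
`DRel`. -/
abbrev DPres (D : Datum k n) : Type u := RingQuot (DRel D)

/-- The image of a generating symbol in the presented algebra. -/
def DPres.of (D : Datum k n) (x : DGen n) : DPres D := RingQuot.mkAlgHom k (DRel D) (gen k x)

end QD

end

/-!
Both Borel parts are first treated as abstract algebras: `Borel D 1` and `Borel D (-1)` are given by
generators and relations, so that a homomorphism out of them, in particular a comultiplication, is
defined by its values on generators. The argument needs neither a triangular decomposition nor a PBW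
basis of `U_q`.

*The pairing of the abstract Borel algebras.* A pairing that turns products on the negative side
into coproducts on the positive side is an algebra homomorphism `y ↦ φ(·, y)` from `Borel D (-1)` to
the algebra `DualAlg` of functionals on `Borel D 1` under (opposite) convolution. The images of the
`K_i` are characters and those of the `F_i` are read off from a representation by upper triangular
`2 × 2` matrices. Under the coproduct dual to the product, the difference of the two sides of each
defining relation is skew-primitive, and a skew-primitive functional that vanishes on the generators
vanishes (`eq_zero_of_isSkewPrimitive`). A Serre element vanishes on the generators because it is a
combination of products of at least two functionals that vanish on `1` and all `K_i`, while each
term of the coproduct of `E_i` has `1` or `K_i` as a factor (`borelRelations_dual`). This gives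
`pairing`.

*The double.* A pairing of bialgebras with a convolution inverse, a `SkewPairing`, makes `H ⊗ H'` an
associative algebra `SkewPairing.Double`. Associativity follows from two hexagon identities for the
cross map `(x, y) ↦ (1 ⊗ y)(x ⊗ 1)` (`SkewPairing.cross_mul_left`, `SkewPairing.cross_mul_right`).
For Borel algebras with the prescribed values of the pairing on
generators, the cross map of two generators gives exactly the relations of the presented algebra
`DPres D` (`IsBorelPairing.dRelations`).

*The Hopf subalgebras are Borel algebras.* In the double of the abstract Borel algebras the elements
`K_i⁻¹ K̃_i` are central, and its quotient by the ideal generated by all `K_i⁻¹ K̃_i - 1` satisfies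
the relations of `U_q` up to rescaling the `F_i`. Retractions of the double to its two tensor
factors kill this ideal, so both Borel algebras embed into the quotient, and therefore into `U_q`
(`lift_pos_injective`, `lift_neg_injective`). This identifies `U_q^{≥0}` and `U_q^{≤0}` with the
abstract Borel algebras (`posEquiv`, `negEquiv`), and `pairing` is transported along these
isomorphisms to `lusztigPairing`.

*The remaining properties of the pairing.* Compatibility with products and coproducts determines a
pairing from its values on generators (`pairing_ext`). This proves uniqueness, and also the antipode
axiom, because `φ(S(x), y)` and `φ(x, S⁻¹(y))` both reverse products and agree on generators.
Orthogonality of different weights holds on generators and propagates to products, since the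
coproducts respect degrees (`IsLusztigPrePairing.weight`).

*The presentation.* The relations in the double define a homomorphism `toDouble` from `DPres D` to
the double. The map `ofTensor`, which sends `x ⊗ y` to the product of the images of `x` and `y` in
`DPres D` (with `F_i` rescaled by `q_i⁻¹`), is a section of it, and it is surjective, since the
commutation relations of `DPres D` move all `E_i` and `K_i` to the left of all `F_i` and `K̃_i`
(`ofTensor_surjective`). So `toDouble` is bijective.
-/

open scoped TensorProduct

noncomputable section

namespace QD

universe u v w

/-! ### Translations of a coalgebra by functionals -/

section Translation

variable {k : Type u} [Field k] {C : Type v} [AddCommGroup C] [Module k C] [Coalgebra k C]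

/-- The left translation `y ↦ ∑ f(y₍₁₎) y₍₂₎` of a coalgebra by a functional `f`. -/
def leftTr (f : C →ₗ[k] k) : C →ₗ[k] C :=
  TensorProduct.lid k C ∘ₗ f.rTensor C ∘ₗ Coalgebra.comul

/-- The right translation `y ↦ ∑ y₍₁₎ f(y₍₂₎)` of a coalgebra by a functional `f`. -/
def rightTr (f : C →ₗ[k] k) : C →ₗ[k] C :=
  TensorProduct.rid k C ∘ₗ f.lTensor C ∘ₗ Coalgebra.comul

/-- The convolution product `y ↦ ∑ f(y₍₁₎) g(y₍₂₎)` of two functionals. -/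
def convFun (f g : C →ₗ[k] k) : C →ₗ[k] k :=
  LinearMap.mul' k k ∘ₗ TensorProduct.map f g ∘ₗ Coalgebra.comul

lemma leftTr_leftTr (f g : C →ₗ[k] k) (y : C) :
    leftTr g (leftTr f y) = leftTr (convFun f g) y := by
  let G : C ⊗[k] (C ⊗[k] C) →ₗ[k] C :=
    (TensorProduct.lid k C).toLinearMap ∘ₗ
      TensorProduct.map f ((TensorProduct.lid k C).toLinearMap ∘ₗ g.rTensor C)
  have h1 (t : C ⊗[k] C) : leftTr g (TensorProduct.lid k C (f.rTensor C t)) =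
      G (Coalgebra.comul.lTensor C t) := by
    induction t with
    | zero => simp
    | tmul a b => simp [G, leftTr]
    | add a b ha hb => simp only [map_add, ha, hb]
  have h2 (t : C ⊗[k] C) : TensorProduct.lid k C ((convFun f g).rTensor C t) =
      G (TensorProduct.assoc k C C C (Coalgebra.comul.rTensor C t)) := by
    induction t with
    | zero => simp
    | tmul a b =>
      simp only [convFun, LinearMap.rTensor_tmul, LinearMap.comp_apply]
      generalize (Coalgebra.comul (R := k) a) = s
      induction s with
      | zero => simp
      | tmul c d => simp [G, smul_smul, mul_comm]
      | add c d hc hd => simp only [map_add, TensorProduct.add_tmul, hc, hd]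
    | add a b ha hb => simp only [map_add, ha, hb]
  have h3 : leftTr g (leftTr f y) = G (Coalgebra.comul.lTensor C (Coalgebra.comul (R := k) y)) :=
    h1 _
  rw [h3, ← Coalgebra.coassoc_apply, ← h2]
  rfl

lemma rightTr_rightTr (f g : C →ₗ[k] k) (y : C) :
    rightTr f (rightTr g y) = rightTr (convFun f g) y := by
  let G : C ⊗[k] (C ⊗[k] C) →ₗ[k] C :=
    (TensorProduct.rid k C).toLinearMap ∘ₗ TensorProduct.map LinearMap.id (LinearMap.mul' k k ∘ₗ
      TensorProduct.map f g)
  have h1 (t : C ⊗[k] C) : rightTr f (TensorProduct.rid k C (g.lTensor C t)) =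
      G (TensorProduct.assoc k C C C (Coalgebra.comul.rTensor C t)) := by
    induction t with
    | zero => simp
    | tmul a b =>
      simp only [rightTr, LinearMap.lTensor_tmul, LinearMap.comp_apply, TensorProduct.rid_tmul,
        LinearEquiv.coe_coe, map_smul, LinearMap.rTensor_tmul]
      generalize (Coalgebra.comul (R := k) a) = s
      induction s with
      | zero => simp
      | tmul c d => simp [G, smul_smul, mul_comm]
      | add c d hc hd => simp only [map_add, TensorProduct.add_tmul, smul_add, hc, hd]
    | add a b ha hb => simp only [map_add, ha, hb]
  have h2 (t : C ⊗[k] C) : TensorProduct.rid k C ((convFun f g).lTensor C t) =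
      G (Coalgebra.comul.lTensor C t) := by
    induction t with
    | zero => simp
    | tmul a b => simp [G, convFun]
    | add a b ha hb => simp only [map_add, ha, hb]
  have h3 : rightTr f (rightTr g y) =
      G (TensorProduct.assoc k C C C (Coalgebra.comul.rTensor C (Coalgebra.comul (R := k) y))) :=
    h1 _
  rw [h3, Coalgebra.coassoc_apply, ← h2]
  rfl

lemma leftTr_rightTr (f g : C →ₗ[k] k) (y : C) :
    leftTr f (rightTr g y) = rightTr g (leftTr f y) := by
  let G : C ⊗[k] (C ⊗[k] C) →ₗ[k] C :=
    (TensorProduct.lid k C).toLinearMap ∘ₗ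
      TensorProduct.map f ((TensorProduct.rid k C).toLinearMap ∘ₗ g.lTensor C)
  have h1 (t : C ⊗[k] C) : leftTr f (TensorProduct.rid k C (g.lTensor C t)) =
      G (TensorProduct.assoc k C C C (Coalgebra.comul.rTensor C t)) := by
    induction t with
    | zero => simp
    | tmul a b =>
      simp only [leftTr, LinearMap.lTensor_tmul, LinearMap.comp_apply, TensorProduct.rid_tmul,
        LinearEquiv.coe_coe, map_smul, LinearMap.rTensor_tmul]
      generalize (Coalgebra.comul (R := k) a) = s
      induction s with
      | zero => simp
      | tmul c d => simp [G, smul_smul, mul_comm]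
      | add c d hc hd => simp only [map_add, TensorProduct.add_tmul, smul_add, hc, hd]
    | add a b ha hb => simp only [map_add, ha, hb]
  have h2 (t : C ⊗[k] C) : rightTr g (TensorProduct.lid k C (f.rTensor C t)) =
      G (Coalgebra.comul.lTensor C t) := by
    induction t with
    | zero => simp
    | tmul a b => simp [G, rightTr]
    | add a b ha hb => simp only [map_add, ha, hb]
  have h3 : rightTr g (leftTr f y) = G (Coalgebra.comul.lTensor C (Coalgebra.comul (R := k) y)) :=
    h2 _
  have h4 : leftTr f (rightTr g y) =
      G (TensorProduct.assoc k C C C (Coalgebra.comul.rTensor C (Coalgebra.comul (R := k) y))) :=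
    h1 _
  rw [h3, h4, Coalgebra.coassoc_apply]

lemma leftTr_counit (y : C) : leftTr (Coalgebra.counit (R := k)) y = y := by
  simp [leftTr]

lemma rightTr_counit (y : C) : rightTr (Coalgebra.counit (R := k)) y = y := by
  simp [rightTr]

end Translation

/-! ### The double of a skew pairing of bialgebras -/

/-- The extension of a bilinear pairing `φ` to `C ⊗ C` and `C' ⊗ C'` by
`(x ⊗ x', y ⊗ y') ↦ φ(x, y) φ(x', y')`: this is `tensorPairing`, for vector spaces without any
algebra structure. -/
def pairTensor {k : Type u} [Field k] {C : Type v} {C' : Type w} [AddCommGroup C] [Module k C]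
    [AddCommGroup C'] [Module k C'] (φ : C →ₗ[k] C' →ₗ[k] k) :
    C ⊗[k] C →ₗ[k] C' ⊗[k] C' →ₗ[k] k :=
  (TensorProduct.map₂ φ φ).compr₂ (LinearMap.mul' k k)

@[simp] lemma pairTensor_tmul {k : Type u} [Field k] {C : Type v} {C' : Type w} [AddCommGroup C]
    [Module k C] [AddCommGroup C'] [Module k C'] (φ : C →ₗ[k] C' →ₗ[k] k) (x x' : C) (y y' : C') :
    pairTensor φ (x ⊗ₜ x') (y ⊗ₜ y') = φ x y * φ x' y' := rfl

/-- A skew pairing of the bialgebras `H` and `H'`: a pairing `φ` with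
`φ(x, y y') = ∑ φ(x₍₂₎, y) φ(x₍₁₎, y')` and `φ(x x', y) = ∑ φ(x, y₍₁₎) φ(x', y₍₂₎)`, together with
a pairing `ψ` that satisfies the opposite identities. If `H` has an antipode `S`, then
`ψ(x, y) = φ(S(x), y)`. -/
structure SkewPairing (k : Type u) [Field k] (H : Type v) (H' : Type w) [Ring H] [Bialgebra k H]
    [Ring H'] [Bialgebra k H'] where
  /-- the pairing -/
  φ : H →ₗ[k] H' →ₗ[k] k
  /-- the opposite pairing -/
  ψ : H →ₗ[k] H' →ₗ[k] k
  one_left : ∀ y, φ 1 y = Coalgebra.counit (R := k) y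
  one_right : ∀ x, φ x 1 = Coalgebra.counit (R := k) x
  mul_left : ∀ x x' y, φ (x * x') y = pairTensor φ (x ⊗ₜ x') (Coalgebra.comul y)
  mul_right : ∀ x y y',
    φ x (y * y') = pairTensor φ (TensorProduct.comm k H H (Coalgebra.comul x)) (y ⊗ₜ y')
  one_left' : ∀ y, ψ 1 y = Coalgebra.counit (R := k) y
  one_right' : ∀ x, ψ x 1 = Coalgebra.counit (R := k) x
  mul_left' : ∀ x x' y, ψ (x * x') y = pairTensor ψ (x' ⊗ₜ x) (Coalgebra.comul y)
  mul_right' : ∀ x y y', ψ x (y * y') = pairTensor ψ (Coalgebra.comul x) (y ⊗ₜ y')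

/-- The iterated comultiplication `x ↦ ∑ x₍₁₎ ⊗ x₍₂₎ ⊗ x₍₃₎` of a coalgebra. -/
def comul₃ (k : Type u) (C : Type v) [Field k] [AddCommGroup C] [Module k C] [Coalgebra k C] :
    C →ₗ[k] C ⊗[k] (C ⊗[k] C) :=
  (Coalgebra.comul (R := k) (A := C)).lTensor C ∘ₗ Coalgebra.comul

namespace SkewPairing

variable {k : Type u} [Field k] {H : Type v} {H' : Type w} [Ring H] [Bialgebra k H]
  [Ring H'] [Bialgebra k H'] (P : SkewPairing k H H')

lemma convFun_left (x x' : H) : convFun (P.φ x) (P.φ x') = P.φ (x * x') := by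
  ext y
  rw [P.mul_left]
  simp only [convFun, LinearMap.comp_apply]
  generalize (Coalgebra.comul (R := k) y) = s
  induction s with
  | zero => simp
  | tmul c d => simp
  | add c d hc hd => simp only [map_add, hc, hd]

lemma convFun_left' (x x' : H) : convFun (P.ψ x') (P.ψ x) = P.ψ (x * x') := by
  ext y
  rw [P.mul_left']
  simp only [convFun, LinearMap.comp_apply]
  generalize (Coalgebra.comul (R := k) y) = s
  induction s with
  | zero => simp
  | tmul c d => simp
  | add c d hc hd => simp only [map_add, hc, hd]

lemma convFun_right (y y' : H') : convFun (P.φ.flip y') (P.φ.flip y) = P.φ.flip (y * y') := by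
  ext x
  rw [LinearMap.flip_apply, P.mul_right]
  simp only [convFun, LinearMap.comp_apply]
  generalize (Coalgebra.comul (R := k) x) = s
  induction s with
  | zero => simp
  | tmul c d => simp [mul_comm]
  | add c d hc hd => simp only [map_add, LinearMap.add_apply, hc, hd]

lemma convFun_right' (y y' : H') : convFun (P.ψ.flip y) (P.ψ.flip y') = P.ψ.flip (y * y') := by
  ext x
  rw [LinearMap.flip_apply, P.mul_right']
  simp only [convFun, LinearMap.comp_apply]
  generalize (Coalgebra.comul (R := k) x) = s
  induction s with
  | zero => simp
  | tmul c d => simp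
  | add c d hc hd => simp only [map_add, LinearMap.add_apply, hc, hd]

/-- The bilinear map
`(x₁ ⊗ x₂ ⊗ x₃, y₁ ⊗ y₂ ⊗ y₃) ↦ φ(x₁, y₁) ψ(x₃, y₃) x₂ ⊗ y₂`. -/
def contract : H ⊗[k] (H ⊗[k] H) →ₗ[k] H' ⊗[k] (H' ⊗[k] H') →ₗ[k] H ⊗[k] H' :=
  (TensorProduct.map₂ P.φ (TensorProduct.map₂ (TensorProduct.mk k H H') P.ψ)).compr₂
    ((TensorProduct.rid k (H ⊗[k] H')).toLinearMap ∘ₗ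
      (TensorProduct.lid k ((H ⊗[k] H') ⊗[k] k)).toLinearMap)

lemma contract_tmul (x₁ x₂ x₃ : H) (y₁ y₂ y₃ : H') :
    P.contract (x₁ ⊗ₜ (x₂ ⊗ₜ x₃)) (y₁ ⊗ₜ (y₂ ⊗ₜ y₃)) =
      (P.φ x₁ y₁ * P.ψ x₃ y₃) • (x₂ ⊗ₜ y₂) := by
  simp [contract, mul_smul]

/-- The bilinear map
`(x, y) ↦ ∑ φ(x₍₁₎, y₍₁₎) ψ(x₍₃₎, y₍₃₎) x₍₂₎ ⊗ y₍₂₎`, which moves `y` past `x` in the double. -/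
def cross : H →ₗ[k] H' →ₗ[k] H ⊗[k] H' :=
  P.contract.compl₁₂ (comul₃ k H) (comul₃ k H')

lemma contract_tmul_comul (a b c : H) (y : H') :
    P.contract (a ⊗ₜ (b ⊗ₜ c)) (comul₃ k H' y) = b ⊗ₜ rightTr (P.ψ c) (leftTr (P.φ a) y) := by
  simp only [comul₃, leftTr, LinearMap.comp_apply]
  generalize (Coalgebra.comul (R := k) y) = s
  induction s with
  | zero => simp
  | tmul d e =>
    simp only [LinearMap.lTensor_tmul, LinearMap.rTensor_tmul, LinearEquiv.coe_coe,
      TensorProduct.lid_tmul, map_smul, rightTr, LinearMap.comp_apply]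
    generalize (Coalgebra.comul (R := k) e) = t
    induction t with
    | zero => simp
    | tmul e f => simp [contract_tmul, mul_smul]
    | add t t' h h' => simp only [map_add, TensorProduct.tmul_add, smul_add, h, h']
  | add s s' h h' => simp only [map_add, TensorProduct.tmul_add, h, h']

lemma contract_comul_tmul (x : H) (a b c : H') :
    P.contract (comul₃ k H x) (a ⊗ₜ (b ⊗ₜ c)) =
      rightTr (P.ψ.flip c) (leftTr (P.φ.flip a) x) ⊗ₜ b := by
  simp only [comul₃, leftTr, LinearMap.comp_apply]
  generalize (Coalgebra.comul (R := k) x) = s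
  induction s with
  | zero => simp
  | tmul d e =>
    simp only [LinearMap.lTensor_tmul, LinearMap.rTensor_tmul, LinearEquiv.coe_coe,
      TensorProduct.lid_tmul, map_smul, rightTr, LinearMap.comp_apply]
    generalize (Coalgebra.comul (R := k) e) = t
    induction t with
    | zero => simp
    | tmul e f => simp [contract_tmul, mul_smul, TensorProduct.smul_tmul']
    | add t t' h h' =>
      simp only [map_add, TensorProduct.tmul_add, TensorProduct.add_tmul, smul_add, h, h',
        LinearMap.add_apply]
  | add s s' h h' => simp only [map_add, TensorProduct.add_tmul, LinearMap.add_apply, h, h']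

/-- The multiplication of the double,
`(x ⊗ y) (x' ⊗ y') = ∑ φ(x'₍₁₎, y₍₁₎) (x x'₍₂₎ ⊗ y₍₂₎ y') ψ(x'₍₃₎, y₍₃₎)`. -/
def mul : H ⊗[k] H' →ₗ[k] H ⊗[k] H' →ₗ[k] H ⊗[k] H' :=
  TensorProduct.lift <| LinearMap.mk₂ k
    (fun x y => TensorProduct.lift <| LinearMap.mk₂ k
      (fun x' y' => TensorProduct.map (LinearMap.mul k H x) ((LinearMap.mul k H').flip y')
        (P.cross x' y))
      (by intros; simp) (by intros; simp)
      (by intros; rw [map_add, TensorProduct.map_add_right]; rfl)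
      (by intros; rw [map_smul, TensorProduct.map_smul_right]; rfl))
    (by
      intro x₁ x₂ y
      ext x' y'
      simp only [map_add, TensorProduct.map_add_left]
      rfl)
    (by
      intro c x y
      ext x' y'
      simp only [map_smul, TensorProduct.map_smul_left]
      rfl)
    (by
      intro x y₁ y₂
      ext x' y'
      simp)
    (by
      intro c x y
      ext x' y'
      simp)

/-- The `(H, H')`-bimodule structure `z ↦ x z y` of `H ⊗ H'`. -/
abbrev bi (x : H) (y : H') : H ⊗[k] H' →ₗ[k] H ⊗[k] H' :=
  TensorProduct.map (LinearMap.mul k H x) ((LinearMap.mul k H').flip y)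

lemma mul_tmul (x x' : H) (y y' : H') :
    P.mul (x ⊗ₜ y) (x' ⊗ₜ y') = bi x y' (P.cross x' y) :=
  rfl

lemma bi_bi (x x' : H) (y y' : H') (z : H ⊗[k] H') :
    bi x y (bi x' y' z) = bi (x * x') (y' * y) z := by
  induction z with
  | zero => simp
  | tmul a b => simp [mul_assoc]
  | add a b ha hb => simp only [map_add, ha, hb]

lemma bi_one_one (z : H ⊗[k] H') : bi 1 1 z = z := by
  induction z with
  | zero => simp
  | tmul a b => simp
  | add a b ha hb => simp only [map_add, ha, hb]

lemma mul_bi_left (x : H) (z z' : H ⊗[k] H') : P.mul (bi x 1 z) z' = bi x 1 (P.mul z z') := by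
  induction z with
  | zero => simp
  | add a b ha hb => simp only [map_add, LinearMap.add_apply, ha, hb]
  | tmul a b =>
    induction z' with
    | zero => simp
    | add a b ha hb => simp only [map_add, ha, hb]
    | tmul c d =>
      rw [mul_tmul, bi_bi, TensorProduct.map_tmul, LinearMap.flip_apply, LinearMap.mul_apply',
        LinearMap.mul_apply', mul_tmul, mul_one, mul_one]

lemma mul_bi_right (y : H') (z z' : H ⊗[k] H') : P.mul z (bi 1 y z') = bi 1 y (P.mul z z') := by
  induction z with
  | zero => simp
  | add a b ha hb => simp only [map_add, LinearMap.add_apply, ha, hb]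
  | tmul a b =>
    induction z' with
    | zero => simp
    | add a b ha hb => simp only [map_add, ha, hb]
    | tmul c d =>
      rw [mul_tmul, bi_bi, TensorProduct.map_tmul, LinearMap.flip_apply, LinearMap.mul_apply',
        LinearMap.mul_apply', mul_tmul, one_mul, one_mul]

lemma comul₃_mul (x x' : H) : comul₃ k H (x * x') = comul₃ k H x * comul₃ k H x' := by
  have h (t t' : H ⊗[k] H) : (Coalgebra.comul (R := k) (A := H)).lTensor H (t * t') =
      (Coalgebra.comul (R := k) (A := H)).lTensor H t *
        (Coalgebra.comul (R := k) (A := H)).lTensor H t' := by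
    induction t with
    | zero => simp
    | add a b ha hb => simp only [map_add, add_mul, ha, hb]
    | tmul a b =>
      induction t' with
      | zero => simp
      | add a b ha hb => simp only [map_add, mul_add, ha, hb]
      | tmul c d => simp
  simp only [comul₃, LinearMap.comp_apply, Bialgebra.comul_mul, h]

/-- The first hexagon identity: `cross(x x', y) = cross(x, y) (x' ⊗ 1)`. -/
lemma cross_mul_left (x x' : H) (y : H') :
    P.cross (x * x') y = P.mul (P.cross x y) (x' ⊗ₜ 1) := by
  simp only [cross, LinearMap.compl₁₂_apply, comul₃_mul]
  generalize comul₃ k H x = t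
  have key (t' : H ⊗[k] (H ⊗[k] H)) (z : H ⊗[k] H')
      (ht' : comul₃ k H x' = t') : P.mul z (x' ⊗ₜ 1) =
      TensorProduct.lift (LinearMap.mk₂ k (fun a b => bi a 1 (P.contract t' (comul₃ k H' b)))
        (by intros; simp [bi, TensorProduct.map_add_left])
        (by intros; simp [bi, TensorProduct.map_smul_left])
        (by intros; simp) (by intros; simp)) z := by
    induction z with
    | zero => simp
    | add a b ha hb => simp only [map_add, LinearMap.add_apply, ha, hb]
    | tmul a b => rw [mul_tmul, cross, LinearMap.compl₁₂_apply, ht']; simp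
  rw [key _ _ rfl]
  generalize comul₃ k H x' = t'
  induction t with
  | zero => simp
  | add a b ha hb => simp only [map_add, add_mul, LinearMap.add_apply, ha, hb]
  | tmul a t =>
    induction t with
    | zero => simp
    | add a b ha hb =>
      simp only [map_add, TensorProduct.tmul_add, add_mul, LinearMap.add_apply, ha, hb]
    | tmul b c =>
      rw [contract_tmul_comul]
      simp only [TensorProduct.lift.tmul, LinearMap.mk₂_apply]
      induction t' with
      | zero => simp
      | add a b ha hb => simp only [map_add, mul_add, LinearMap.add_apply, ha, hb]
      | tmul a' t' =>
        induction t' with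
        | zero => simp
        | add a b ha hb =>
          simp only [map_add, TensorProduct.tmul_add, mul_add, LinearMap.add_apply, ha, hb]
        | tmul b' c' =>
          rw [contract_tmul_comul]
          simp only [Algebra.TensorProduct.tmul_mul_tmul]
          rw [contract_tmul_comul, ← convFun_left, ← convFun_left', ← leftTr_leftTr,
            ← rightTr_rightTr, leftTr_rightTr]
          simp

/-- The second hexagon identity: `cross(x, y y') = (1 ⊗ y) cross(x, y')`. -/
lemma cross_mul_right (x : H) (y y' : H') :
    P.cross x (y * y') = P.mul (1 ⊗ₜ y) (P.cross x y') := by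
  simp only [cross, LinearMap.compl₁₂_apply, comul₃_mul]
  generalize comul₃ k H' y' = t'
  have key (t : H' ⊗[k] (H' ⊗[k] H')) (z : H ⊗[k] H')
      (ht : comul₃ k H' y = t) : P.mul (1 ⊗ₜ y) z =
      TensorProduct.lift (LinearMap.mk₂ k (fun a b => bi 1 b (P.contract (comul₃ k H a) t))
        (by intros; simp) (by intros; simp)
        (by intros; simp [bi, TensorProduct.map_add_right])
        (by intros; simp [bi, TensorProduct.map_smul_right])) z := by
    induction z with
    | zero => simp
    | add a b ha hb => simp only [map_add, ha, hb]
    | tmul a b => rw [mul_tmul, cross, LinearMap.compl₁₂_apply, ht]; simp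
  rw [key _ _ rfl]
  generalize comul₃ k H' y = t
  induction t' with
  | zero => simp
  | add a b ha hb => simp only [map_add, mul_add, ha, hb]
  | tmul a' t' =>
    induction t' with
    | zero => simp
    | add a b ha hb => simp only [map_add, TensorProduct.tmul_add, mul_add, ha, hb]
    | tmul b' c' =>
      rw [contract_comul_tmul]
      simp only [TensorProduct.lift.tmul, LinearMap.mk₂_apply]
      induction t with
      | zero => simp
      | add a b ha hb => simp only [map_add, add_mul, ha, hb]
      | tmul a t =>
        induction t with
        | zero => simp
        | add a b ha hb => simp only [map_add, TensorProduct.tmul_add, add_mul, ha, hb]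
        | tmul b c =>
          rw [contract_comul_tmul]
          simp only [Algebra.TensorProduct.tmul_mul_tmul]
          rw [contract_comul_tmul, ← convFun_right, ← convFun_right', ← leftTr_leftTr,
            ← rightTr_rightTr, leftTr_rightTr]
          simp

lemma cross_one_left (y : H') : P.cross 1 y = 1 ⊗ₜ y := by
  have h : comul₃ k H 1 = 1 ⊗ₜ (1 ⊗ₜ 1) := by
    simp [comul₃, Algebra.TensorProduct.one_def]
  have h1 : P.φ 1 = Coalgebra.counit (R := k) := LinearMap.ext P.one_left
  have h2 : P.ψ 1 = Coalgebra.counit (R := k) := LinearMap.ext P.one_left'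
  rw [cross, LinearMap.compl₁₂_apply, h, contract_tmul_comul, h1, h2, leftTr_counit,
    rightTr_counit]

lemma cross_one_right (x : H) : P.cross x 1 = x ⊗ₜ 1 := by
  have h : comul₃ k H' 1 = 1 ⊗ₜ (1 ⊗ₜ 1) := by
    simp [comul₃, Algebra.TensorProduct.one_def]
  have h1 : P.φ.flip 1 = Coalgebra.counit (R := k) := LinearMap.ext P.one_right
  have h2 : P.ψ.flip 1 = Coalgebra.counit (R := k) := LinearMap.ext P.one_right'
  rw [cross, LinearMap.compl₁₂_apply, h, contract_comul_tmul, h1, h2, leftTr_counit,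
    rightTr_counit]

lemma mul_bi_middle_right (z z' : H ⊗[k] H') (y : H') :
    P.mul (bi 1 y z) z' = P.mul z (P.mul (1 ⊗ₜ y) z') := by
  induction z with
  | zero => simp
  | add a b ha hb => simp only [map_add, LinearMap.add_apply, ha, hb]
  | tmul a b =>
    induction z' with
    | zero => simp
    | add a b ha hb => simp only [map_add, ha, hb]
    | tmul c d =>
      rw [TensorProduct.map_tmul, mul_tmul, mul_tmul, LinearMap.flip_apply, LinearMap.mul_apply',
        LinearMap.mul_apply', cross_mul_right, one_mul, mul_bi_right]
      have h (w : H ⊗[k] H') : P.mul (a ⊗ₜ b) w = bi a 1 (P.mul (1 ⊗ₜ b) w) := by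
        rw [← mul_bi_left]; simp
      rw [h, bi_bi, one_mul, one_mul]

lemma mul_bi_middle_left (z z' : H ⊗[k] H') (x : H) :
    P.mul z (bi x 1 z') = P.mul (P.mul z (x ⊗ₜ 1)) z' := by
  induction z' with
  | zero => simp
  | add a b ha hb => simp only [map_add, ha, hb]
  | tmul c d =>
    induction z with
    | zero => simp
    | add a b ha hb => simp only [map_add, LinearMap.add_apply, ha, hb]
    | tmul a b =>
      have h (w : H ⊗[k] H') : P.mul w (c ⊗ₜ d) = bi 1 d (P.mul w (c ⊗ₜ 1)) := by
        rw [← mul_bi_right]; simp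
      rw [TensorProduct.map_tmul, mul_tmul, mul_tmul, LinearMap.flip_apply, LinearMap.mul_apply',
        LinearMap.mul_apply', cross_mul_left, mul_one, h (bi a 1 _), mul_bi_left,
        bi_bi, one_mul, one_mul]

/-- The multiplication of the double is associative: both bracketings of
`(x ⊗ y) (x' ⊗ y') (x'' ⊗ y'')` are `x (cross x' y) (cross x'' y') y''`. -/
lemma mul_assoc' (z z' z'' : H ⊗[k] H') : P.mul (P.mul z z') z'' = P.mul z (P.mul z' z'') := by
  induction z with
  | zero => simp
  | add a b ha hb => simp only [map_add, LinearMap.add_apply, ha, hb]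
  | tmul x y =>
  induction z' with
  | zero => simp
  | add a b ha hb => simp only [map_add, LinearMap.add_apply, ha, hb]
  | tmul x' y' =>
  induction z'' with
  | zero => simp
  | add a b ha hb => simp only [map_add, ha, hb]
  | tmul x'' y'' =>
    have h1 : P.mul (x ⊗ₜ y) (x' ⊗ₜ y') = bi x 1 (bi 1 y' (P.cross x' y)) := by
      rw [mul_tmul, bi_bi, mul_one, mul_one]
    have h2 : P.mul (x' ⊗ₜ y') (x'' ⊗ₜ y'') = bi 1 y'' (bi x' 1 (P.cross x'' y')) := by
      rw [mul_tmul, bi_bi, one_mul, one_mul]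
    have h3 : P.mul (1 ⊗ₜ y') (x'' ⊗ₜ y'') = bi 1 y'' (P.cross x'' y') := by
      rw [mul_tmul]
    have h4 : P.mul (x ⊗ₜ y) (x' ⊗ₜ 1) = bi x 1 (P.cross x' y) := by
      rw [mul_tmul]
    rw [h1, h2, mul_bi_left, mul_bi_middle_right, h3, mul_bi_right, mul_bi_right,
      mul_bi_middle_left, h4, mul_bi_left, bi_bi, bi_bi, mul_one, one_mul, mul_one, one_mul]

lemma one_mul' (z : H ⊗[k] H') : P.mul (1 ⊗ₜ 1) z = z := by
  induction z with
  | zero => simp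
  | add a b ha hb => simp only [map_add, ha, hb]
  | tmul x y => rw [mul_tmul, cross_one_right]; simp

lemma mul_one' (z : H ⊗[k] H') : P.mul z (1 ⊗ₜ 1) = z := by
  induction z with
  | zero => simp
  | add a b ha hb => simp only [map_add, LinearMap.add_apply, ha, hb]
  | tmul x y => rw [mul_tmul, cross_one_left]; simp

/-- The double of the bialgebras `H` and `H'` along the skew pairing `P`. -/
def Double (_P : SkewPairing k H H') : Type (max v w) := H ⊗[k] H'

instance : AddCommGroup P.Double := inferInstanceAs (AddCommGroup (H ⊗[k] H'))
instance : Module k P.Double := inferInstanceAs (Module k (H ⊗[k] H'))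

/-- The pure tensor `x ⊗ y` as an element of the double. -/
def tmul (x : H) (y : H') : P.Double := (x ⊗ₜ[k] y : H ⊗[k] H')

instance : Ring P.Double where
  __ := (inferInstance : AddCommGroup P.Double)
  mul z z' := P.mul z z'
  one := P.tmul 1 1
  mul_assoc := P.mul_assoc'
  one_mul := P.one_mul'
  mul_one := P.mul_one'
  left_distrib z := map_add (P.mul z)
  right_distrib z z' w := LinearMap.map_add₂ P.mul z z' w
  zero_mul z := LinearMap.map_zero₂ P.mul z
  mul_zero z := map_zero (P.mul z)
instance : Algebra k P.Double :=
  Algebra.ofModule (fun c z z' => LinearMap.map_smul₂ P.mul c z z')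
    (fun c z z' => map_smul (P.mul z) c z')

lemma tmul_mul_tmul (x x' : H) (y y' : H') :
    (P.tmul x y * P.tmul x' y' : P.Double) = bi x y' (P.cross x' y) := rfl

/-- The embedding `x ↦ x ⊗ 1` of the first factor into the double. -/
def inl : H →ₐ[k] P.Double :=
  AlgHom.ofLinearMap ((TensorProduct.mk k H H').flip 1) rfl (by
    intro x x'
    change _ = P.tmul x 1 * P.tmul x' 1
    rw [tmul_mul_tmul, cross_one_right]
    simp
    rfl)

/-- The embedding `y ↦ 1 ⊗ y` of the second factor into the double. -/
def inr : H' →ₐ[k] P.Double :=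
  AlgHom.ofLinearMap (TensorProduct.mk k H H' 1) rfl (by
    intro y y'
    change _ = P.tmul 1 y * P.tmul 1 y'
    rw [tmul_mul_tmul, cross_one_left]
    simp
    rfl)

lemma inl_apply (x : H) : P.inl x = P.tmul x 1 := rfl

lemma inr_apply (y : H') : P.inr y = P.tmul 1 y := rfl

lemma inl_mul_inr (x : H) (y : H') : P.inl x * P.inr y = P.tmul x y := by
  rw [inl_apply, inr_apply, tmul_mul_tmul, cross_one_left]
  simp
  rfl

lemma inr_mul_inl (x : H) (y : H') : P.inr y * P.inl x = (P.cross x y : H ⊗[k] H') := by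
  rw [inl_apply, inr_apply, tmul_mul_tmul, bi_one_one]

@[elab_as_elim]
lemma double_induction {p : P.Double → Prop} (z : P.Double) (zero : p 0)
    (tmul : ∀ x y, p (P.tmul x y)) (add : ∀ z z', p z → p z' → p (z + z')) : p z :=
  TensorProduct.induction_on (motive := p) z zero tmul add

end SkewPairing

/-! ### Borel algebras by generators and relations -/

section Borel

variable {k : Type u} [Field k] {n : ℕ}

/-- The relations between `e_i, κ_i, κ'_i` in the roles of `E_i, K_i, K_i⁻¹` (for `η = 1`) or
`F_i, K_i, K_i⁻¹` (for `η = -1`), the Serre relations excepted. -/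
structure TorusRelations (D : Datum k n) (η : ℤ) {B : Type v} [Ring B] [Algebra k B]
    (e κ κ' : Fin n → B) : Prop where
  K_K : ∀ i j, κ i * κ j = κ j * κ i
  K_Kinv : ∀ i, κ i * κ' i = 1
  Kinv_K : ∀ i, κ' i * κ i = 1
  K_E : ∀ i j, κ i * e j = D.q ^ (η * (D.d i * D.a i j)) • (e j * κ i)

/-- The defining relations of the Borel algebras: `TorusRelations` and the Serre relations. -/
structure BorelRelations (D : Datum k n) (η : ℤ) {B : Type v} [Ring B] [Algebra k B]
    (e κ κ' : Fin n → B) : Prop extends TorusRelations D η e κ κ' where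
  serre_E : ∀ i j, i ≠ j → serre (D.qi i) (D.serreExp i j) (e i) (e j) = 0

namespace TorusRelations

variable {D : Datum k n} {η : ℤ} {B : Type v} [Ring B] [Algebra k B] {e κ κ' : Fin n → B}

open URelations (inv_comm swap qi_ne_zero qi_zpow serreExp_eq)

lemma Kinv_comm_K (h : TorusRelations D η e κ κ') (i j : Fin n) : κ' i * κ j = κ j * κ' i := by
  simpa using inv_comm (k := k) one_ne_zero (h.K_Kinv i) (h.Kinv_K i)
    (by simpa using h.K_K i j)

lemma Kinv_comm_Kinv (h : TorusRelations D η e κ κ') (i j : Fin n) :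
    κ' i * κ' j = κ' j * κ' i := by
  simpa using inv_comm (k := k) one_ne_zero (h.K_Kinv i) (h.Kinv_K i)
    (by simpa using (h.Kinv_comm_K j i).symm)

lemma Kinv_E (h : TorusRelations D η e κ κ') (i j : Fin n) :
    κ' i * e j = D.q ^ (-(η * (D.d i * D.a i j))) • (e j * κ' i) := by
  rw [zpow_neg]
  exact inv_comm (zpow_ne_zero _ D.q_ne_zero) (h.K_Kinv i) (h.Kinv_K i) (h.K_E i j)

lemma E_K (h : TorusRelations D η e κ κ') (i j : Fin n) :
    e j * κ i = D.q ^ (-(η * (D.d i * D.a i j))) • (κ i * e j) := by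
  rw [zpow_neg]
  exact swap (zpow_ne_zero _ D.q_ne_zero) (h.K_E i j)

lemma E_Kinv (h : TorusRelations D η e κ κ') (i j : Fin n) :
    e j * κ' i = D.q ^ (η * (D.d i * D.a i j)) • (κ' i * e j) := by
  have := swap (zpow_ne_zero _ D.q_ne_zero) (h.Kinv_E i j)
  rwa [← zpow_neg, neg_neg] at this

lemma map {C : Type w} [Ring C] [Algebra k C] (h : TorusRelations D η e κ κ') (g : B →ₐ[k] C) :
    TorusRelations D η (fun i => g (e i)) (fun i => g (κ i)) (fun i => g (κ' i)) where
  K_K i j := by rw [← map_mul, h.K_K, map_mul]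
  K_Kinv i := by rw [← map_mul, h.K_Kinv, map_one]
  Kinv_K i := by rw [← map_mul, h.Kinv_K, map_one]
  K_E i j := by rw [← map_mul, h.K_E, map_smul, map_mul]

/-- The quantum Serre elements in the `E_i` are skew-primitive. -/
lemma serre_comul_pos (h : TorusRelations D 1 e κ κ') {i j : Fin n} (hij : i ≠ j) :
    serre (D.qi i) (D.serreExp i j) (e i ⊗ₜ[k] (1 : B) + κ i ⊗ₜ e i) (e j ⊗ₜ 1 + κ j ⊗ₜ e j) =
      (κ i ^ D.serreExp i j * κ j) ⊗ₜ serre (D.qi i) (D.serreExp i j) (e i) (e j) +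
      serre (D.qi i) (D.serreExp i j) (e i) (e j) ⊗ₜ 1 := by
  rw [add_comm, add_comm (e j ⊗ₜ[k] (1 : B)), serre_add _ (qi_ne_zero i),
    serre_tmul_left _ _ _ _ _ _ (h.K_K j i), serre_tmul_right _ _ _ _ _ _ (by simp)]
  · simp
  · simp only [Algebra.TensorProduct.tmul_mul_tmul, h.E_K i i, qi_zpow, D.diag,
      ← TensorProduct.smul_tmul', one_mul, mul_one]
    congr 2; ring
  · simp only [Algebra.TensorProduct.tmul_mul_tmul, h.E_K j i, qi_zpow, serreExp_eq hij,
      ← TensorProduct.smul_tmul', one_mul, mul_one]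
    congr 2; rw [D.symm j i]; ring
  · simp only [Algebra.TensorProduct.tmul_mul_tmul, h.K_E i j, qi_zpow, serreExp_eq hij,
      ← TensorProduct.smul_tmul', one_mul, mul_one]
    congr 2; ring

/-- The quantum Serre elements in the `F_i` are skew-primitive. -/
lemma serre_comul_neg (h : TorusRelations D (-1) e κ κ') {i j : Fin n} (hij : i ≠ j) :
    serre (D.qi i) (D.serreExp i j) (e i ⊗ₜ[k] κ' i + (1 : B) ⊗ₜ e i) (e j ⊗ₜ κ' j + 1 ⊗ₜ e j) =
      serre (D.qi i) (D.serreExp i j) (e i) (e j) ⊗ₜ (κ' i ^ D.serreExp i j * κ' j) +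
      1 ⊗ₜ serre (D.qi i) (D.serreExp i j) (e i) (e j) := by
  rw [serre_add _ (qi_ne_zero i),
    serre_tmul_right _ _ _ _ _ _ (h.Kinv_comm_Kinv j i),
    serre_tmul_left _ _ _ _ _ _ (by simp)]
  · simp
  · simp only [Algebra.TensorProduct.tmul_mul_tmul, h.E_Kinv i i, qi_zpow, D.diag,
      TensorProduct.tmul_smul, one_mul, mul_one]
    congr 2; ring
  · simp only [Algebra.TensorProduct.tmul_mul_tmul, h.E_Kinv j i, qi_zpow, serreExp_eq hij,
      TensorProduct.tmul_smul, one_mul, mul_one]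
    congr 2; rw [D.symm j i]; ring
  · simp only [Algebra.TensorProduct.tmul_mul_tmul, h.Kinv_E i j, qi_zpow, serreExp_eq hij,
      TensorProduct.tmul_smul, one_mul, mul_one]
    congr 2; ring

/-- The elements prescribed by the comultiplication of `U_q^{≥0}`. -/
lemma comul_pos (h : TorusRelations D 1 e κ κ') : TorusRelations D 1 (B := B ⊗[k] B)
    (fun i => e i ⊗ₜ 1 + κ i ⊗ₜ e i) (fun i => κ i ⊗ₜ κ i) (fun i => κ' i ⊗ₜ κ' i) where
  K_K i j := by simp [h.K_K i j]
  K_Kinv i := by simp [h.K_Kinv i, Algebra.TensorProduct.one_def]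
  Kinv_K i := by simp [h.Kinv_K i, Algebra.TensorProduct.one_def]
  K_E i j := by
    simp only [mul_add, add_mul, Algebra.TensorProduct.tmul_mul_tmul, h.K_E i j, h.K_K i j,
      TensorProduct.tmul_smul, smul_add, mul_one, one_mul, ← TensorProduct.smul_tmul']

/-- The elements prescribed by the comultiplication of `U_q^{≤0}`. -/
lemma comul_neg (h : TorusRelations D (-1) e κ κ') : TorusRelations D (-1) (B := B ⊗[k] B)
    (fun i => e i ⊗ₜ κ' i + 1 ⊗ₜ e i) (fun i => κ i ⊗ₜ κ i) (fun i => κ' i ⊗ₜ κ' i) where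
  K_K i j := by simp [h.K_K i j]
  K_Kinv i := by simp [h.K_Kinv i, Algebra.TensorProduct.one_def]
  Kinv_K i := by simp [h.Kinv_K i, Algebra.TensorProduct.one_def]
  K_E i j := by
    simp only [mul_add, add_mul, Algebra.TensorProduct.tmul_mul_tmul, h.K_E i j,
      ← h.Kinv_comm_K j i,
      TensorProduct.tmul_smul, smul_add, mul_one, one_mul, ← TensorProduct.smul_tmul']

end TorusRelations

namespace BorelRelations

variable {D : Datum k n} {η : ℤ} {B : Type v} [Ring B] [Algebra k B] {e κ κ' : Fin n → B}

lemma map {C : Type w} [Ring C] [Algebra k C] (h : BorelRelations D η e κ κ') (g : B →ₐ[k] C) :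
    BorelRelations D η (fun i => g (e i)) (fun i => g (κ i)) (fun i => g (κ' i)) where
  __ := h.toTorusRelations.map g
  serre_E i j hij := by rw [← serre_map, h.serre_E i j hij, map_zero]

lemma comul_pos (h : BorelRelations D 1 e κ κ') : BorelRelations D 1 (B := B ⊗[k] B)
    (fun i => e i ⊗ₜ 1 + κ i ⊗ₜ e i) (fun i => κ i ⊗ₜ κ i) (fun i => κ' i ⊗ₜ κ' i) where
  __ := h.toTorusRelations.comul_pos
  serre_E i j hij := by simp [h.toTorusRelations.serre_comul_pos hij, h.serre_E i j hij]

lemma comul_neg (h : BorelRelations D (-1) e κ κ') : BorelRelations D (-1) (B := B ⊗[k] B)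
    (fun i => e i ⊗ₜ κ' i + 1 ⊗ₜ e i) (fun i => κ i ⊗ₜ κ i) (fun i => κ' i ⊗ₜ κ' i) where
  __ := h.toTorusRelations.comul_neg
  serre_E i j hij := by simp [h.toTorusRelations.serre_comul_neg hij, h.serre_E i j hij]

/-- The elements prescribed by a character of the torus, extended by zero. -/
lemma character {c c' : Fin n → k} (h : ∀ i, c i * c' i = 1) :
    BorelRelations D η (B := k) (fun _ => 0) c c' where
  K_K _ _ := mul_comm _ _
  K_Kinv := h
  Kinv_K i := by rw [mul_comm, h]
  K_E := by simp
  serre_E i j _ := by simp [serre]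

open MulOpposite in
/-- The elements prescribed by the antipode of `U_q^{≥0}` satisfy the relations in the opposite
algebra. -/
lemma antipode (h : BorelRelations D 1 e κ κ') : BorelRelations D 1 (B := Bᵐᵒᵖ)
    (fun i => op (-(κ' i * e i))) (fun i => op (κ' i)) (fun i => op (κ i)) where
  K_K i j := by rw [← op_mul, ← op_mul, h.Kinv_comm_Kinv j i]
  K_Kinv i := by rw [← op_mul, h.K_Kinv i, op_one]
  Kinv_K i := by rw [← op_mul, h.Kinv_K i, op_one]
  K_E i j := by
    rw [← op_mul, ← op_mul, ← op_smul]
    simp only [neg_mul, mul_neg, smul_neg, mul_assoc, h.E_Kinv i j]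
    rw [mul_smul_comm, ← mul_assoc (κ' j), h.Kinv_comm_Kinv j i, mul_assoc]
  serre_E i j hij := by
    have h1 := h.E_Kinv i j
    rw [D.symm i j] at h1
    rw [serre_op _ (URelations.qi_ne_zero i), ← neg_one_smul k (κ' i * e i),
      ← neg_one_smul k (κ' j * e j),
      serre_smul, serre_mul_left _ (URelations.qi_ne_zero i) _ _ _ _ _ _ _ (h.E_Kinv i i)
      (h.E_Kinv j i) h1 (h.Kinv_comm_Kinv j i) (h.serre_E i j hij)]
    simp

lemma smul (h : BorelRelations D η e κ κ') (c : Fin n → k) :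
    BorelRelations D η (fun i => c i • e i) κ κ' where
  K_K := h.K_K
  K_Kinv := h.K_Kinv
  Kinv_K := h.Kinv_K
  K_E i j := by rw [mul_smul_comm, h.K_E, smul_mul_assoc, smul_comm]
  serre_E i j hij := by rw [serre_smul, h.serre_E i j hij, smul_zero]

end BorelRelations

/-- Symbols for the generators of the Borel algebras. -/
inductive BGen (n : ℕ) : Type
  | E (i : Fin n)
  | K (i : Fin n)
  | Kinv (i : Fin n)

open BGen in
/-- The defining relations of the Borel algebras, as relations in the free algebra. -/
inductive BRel (D : Datum k n) (η : ℤ) : FreeAlgebra k (BGen n) → FreeAlgebra k (BGen n) → Prop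
  | K_K (i j) : BRel D η (gen k (K i) * gen k (K j)) (gen k (K j) * gen k (K i))
  | K_Kinv (i) : BRel D η (gen k (K i) * gen k (Kinv i)) 1
  | Kinv_K (i) : BRel D η (gen k (Kinv i) * gen k (K i)) 1
  | K_E (i j) : BRel D η (gen k (K i) * gen k (E j))
      (D.q ^ (η * (D.d i * D.a i j)) • (gen k (E j) * gen k (K i)))
  | serre_E (i j) : i ≠ j →
      BRel D η (serre (D.qi i) (D.serreExp i j) (gen k (E i)) (gen k (E j))) 0

/-- The Borel algebra presented by `BRel`. It is the algebra `U_q^{≥0}` for `η = 1` and `U_q^{≤0}`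
for `η = -1`; this is `posEquiv` and `negEquiv` below. -/
def Borel (D : Datum k n) (η : ℤ) : Type u := RingQuot (BRel D η)

namespace Borel

instance (D : Datum k n) (η : ℤ) : Ring (Borel D η) := inferInstanceAs (Ring (RingQuot (BRel D η)))
instance instAlgebra (D : Datum k n) (η : ℤ) : Algebra k (Borel D η) :=
  inferInstanceAs (Algebra k (RingQuot (BRel D η)))

variable (D : Datum k n) (η : ℤ)

/-- The quotient map from the free algebra. -/
def mk : FreeAlgebra k (BGen n) →ₐ[k] Borel D η := RingQuot.mkAlgHom k (BRel D η)

variable {D η}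

/-- The generator `E_i` (for `η = 1`) or `F_i` (for `η = -1`). -/
def E (i : Fin n) : Borel D η := mk D η (gen k (BGen.E i))
/-- The generator `K_i`. -/
def K (i : Fin n) : Borel D η := mk D η (gen k (BGen.K i))
/-- The generator `K_i⁻¹`. -/
def Kinv (i : Fin n) : Borel D η := mk D η (gen k (BGen.Kinv i))

lemma mk_rel {x y : FreeAlgebra k (BGen n)} (h : BRel D η x y) : mk D η x = mk D η y :=
  RingQuot.mkAlgHom_rel k h

variable (D η) in
lemma relations : BorelRelations D η (B := Borel D η) E K Kinv where
  K_K i j := by simpa [E, K, Kinv] using mk_rel (BRel.K_K (D := D) (η := η) i j)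
  K_Kinv i := by simpa [E, K, Kinv] using mk_rel (BRel.K_Kinv (D := D) (η := η) i)
  Kinv_K i := by simpa [E, K, Kinv] using mk_rel (BRel.Kinv_K (D := D) (η := η) i)
  K_E i j := by
    simpa only [E, K, Kinv, map_mul, map_smul] using mk_rel (BRel.K_E (D := D) (η := η) i j)
  serre_E i j hij := by
    simpa [E, serre_map] using mk_rel (BRel.serre_E (D := D) (η := η) i j hij)

section lift

variable {B : Type v} [Ring B] [Algebra k B] {e κ κ' : Fin n → B}

/-- The images of the generating symbols. -/
def genMap (e κ κ' : Fin n → B) : BGen n → B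
  | .E i => e i
  | .K i => κ i
  | .Kinv i => κ' i

/-- The universal property of the Borel algebras. -/
def lift (h : BorelRelations D η e κ κ') : Borel D η →ₐ[k] B :=
  RingQuot.liftAlgHom k ⟨FreeAlgebra.lift k (genMap e κ κ'), by
    intro x y hxy
    cases hxy with
    | K_K i j => simpa [genMap] using h.K_K i j
    | K_Kinv i => simpa [genMap] using h.K_Kinv i
    | Kinv_K i => simpa [genMap] using h.Kinv_K i
    | K_E i j => simpa only [genMap, map_mul, map_smul, FreeAlgebra.lift_ι_apply] using h.K_E i j
    | serre_E i j hij => simpa [genMap, serre_map] using h.serre_E i j hij⟩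

lemma lift_mk (h : BorelRelations D η e κ κ') (x : FreeAlgebra k (BGen n)) :
    lift h (mk D η x) = FreeAlgebra.lift k (genMap e κ κ') x :=
  RingQuot.liftAlgHom_mkAlgHom_apply ..

@[simp] lemma lift_E (h : BorelRelations D η e κ κ') (i : Fin n) : lift h (E i) = e i := by
  simp [E, lift_mk, genMap]
@[simp] lemma lift_K (h : BorelRelations D η e κ κ') (i : Fin n) : lift h (K i) = κ i := by
  simp [K, lift_mk, genMap]
@[simp] lemma lift_Kinv (h : BorelRelations D η e κ κ') (i : Fin n) : lift h (Kinv i) = κ' i := by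
  simp [Kinv, lift_mk, genMap]

lemma hom_ext {g g' : Borel D η →ₐ[k] B} (hE : ∀ i, g (E i) = g' (E i))
    (hK : ∀ i, g (K i) = g' (K i)) (hKinv : ∀ i, g (Kinv i) = g' (Kinv i)) : g = g' := by
  apply RingQuot.ringQuot_ext'
  apply FreeAlgebra.hom_ext
  funext x
  cases x with
  | E i => exact hE i
  | K i => exact hK i
  | Kinv i => exact hKinv i

end lift

lemma induction {P : Borel D η → Prop} (hE : ∀ i, P (E i)) (hK : ∀ i, P (K i))
    (hKinv : ∀ i, P (Kinv i)) (halg : ∀ c : k, P (algebraMap k _ c))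
    (hadd : ∀ x y, P x → P y → P (x + y)) (hmul : ∀ x y, P x → P y → P (x * y)) (x : Borel D η) :
    P x := by
  obtain ⟨x, rfl⟩ : ∃ y, mk D η y = x := RingQuot.mkAlgHom_surjective k (BRel D η) x
  induction x using FreeAlgebra.induction with
  | grade0 r => simpa using halg r
  | grade1 x =>
    cases x with
    | E i => exact hE i
    | K i => exact hK i
    | Kinv i => exact hKinv i
  | mul a b ha hb => simpa using hmul _ _ ha hb
  | add a b ha hb => simpa using hadd _ _ ha hb

lemma range_lift {B : Type v} [Ring B] [Algebra k B] {e κ κ' : Fin n → B}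
    (h : BorelRelations D η e κ κ') :
    (lift h).range = Algebra.adjoin k (Set.range e ∪ (Set.range κ ∪ Set.range κ')) := by
  apply le_antisymm
  · rintro _ ⟨x, rfl⟩
    change lift h x ∈ _
    induction x using induction with
    | hE i => rw [lift_E]; exact Algebra.subset_adjoin (Or.inl ⟨i, rfl⟩)
    | hK i => rw [lift_K]; exact Algebra.subset_adjoin (Or.inr (Or.inl ⟨i, rfl⟩))
    | hKinv i => rw [lift_Kinv]; exact Algebra.subset_adjoin (Or.inr (Or.inr ⟨i, rfl⟩))
    | halg c => rw [AlgHom.commutes]; exact Subalgebra.algebraMap_mem _ c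
    | hadd x y hx hy => rw [map_add]; exact add_mem hx hy
    | hmul x y hx hy => rw [map_mul]; exact mul_mem hx hy
  · refine Algebra.adjoin_le ?_
    rintro _ (⟨i, rfl⟩ | ⟨i, rfl⟩ | ⟨i, rfl⟩)
    · exact ⟨E i, lift_E h i⟩
    · exact ⟨K i, lift_K h i⟩
    · exact ⟨Kinv i, lift_Kinv h i⟩

@[simp] lemma K_mul_Kinv (i : Fin n) : (K i * Kinv i : Borel D η) = 1 := (relations D η).K_Kinv i
@[simp] lemma Kinv_mul_K (i : Fin n) : (Kinv i * K i : Borel D η) = 1 := (relations D η).Kinv_K i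

variable (D η) in
/-- The counit. -/
def counitHom : Borel D η →ₐ[k] k :=
  lift (.character (c := fun _ => 1) (c' := fun _ => 1) (by simp))

variable (D)

/-- The comultiplication of the Borel algebra with `η = 1`:
`Δ(E_i) = E_i ⊗ 1 + K_i ⊗ E_i`, `Δ(K_i) = K_i ⊗ K_i`. -/
def comulPos : Borel D 1 →ₐ[k] Borel D 1 ⊗[k] Borel D 1 := lift (relations D 1).comul_pos

/-- The comultiplication of the Borel algebra with `η = -1`:
`Δ(F_i) = F_i ⊗ K_i⁻¹ + 1 ⊗ F_i`, `Δ(K_i) = K_i ⊗ K_i`. -/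
def comulNeg : Borel D (-1) →ₐ[k] Borel D (-1) ⊗[k] Borel D (-1) :=
  lift (relations D (-1)).comul_neg

instance : Bialgebra k (Borel D 1) :=
  Bialgebra.ofAlgHom (comulPos D) (counitHom D 1)
    (by
      refine hom_ext ?_ ?_ ?_ <;> intro i <;>
      simp [comulPos, TensorProduct.tmul_add, TensorProduct.add_tmul,
        Algebra.TensorProduct.one_def, add_assoc])
    (by refine hom_ext ?_ ?_ ?_ <;> intro i <;> simp [comulPos, counitHom])
    (by refine hom_ext ?_ ?_ ?_ <;> intro i <;> simp [comulPos, counitHom])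

instance : Bialgebra k (Borel D (-1)) :=
  Bialgebra.ofAlgHom (comulNeg D) (counitHom D (-1))
    (by
      refine hom_ext ?_ ?_ ?_ <;> intro i <;>
      simp [comulNeg, TensorProduct.tmul_add, TensorProduct.add_tmul,
        Algebra.TensorProduct.one_def, add_assoc])
    (by refine hom_ext ?_ ?_ ?_ <;> intro i <;> simp [comulNeg, counitHom])
    (by refine hom_ext ?_ ?_ ?_ <;> intro i <;> simp [comulNeg, counitHom])

variable {D}

lemma comul_pos_apply (x : Borel D 1) : Coalgebra.comul (R := k) x = comulPos D x := rfl
lemma counit_pos_apply (x : Borel D 1) : Coalgebra.counit (R := k) x = counitHom D 1 x := rfl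
lemma comul_neg_apply (x : Borel D (-1)) : Coalgebra.comul (R := k) x = comulNeg D x := rfl
lemma counit_neg_apply (x : Borel D (-1)) : Coalgebra.counit (R := k) x = counitHom D (-1) x := rfl

variable (D) in
/-- The antipode of the Borel algebra with `η = 1`, as a homomorphism to the opposite algebra. -/
def antipodeHom : Borel D 1 →ₐ[k] (Borel D 1)ᵐᵒᵖ := lift (relations D 1).antipode

variable (D) in
/-- The antipode of the Borel algebra with `η = 1`. -/
def S : Borel D 1 →ₗ[k] Borel D 1 :=
  (MulOpposite.opLinearEquiv k).symm.toLinearMap ∘ₗ (antipodeHom D).toLinearMap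

@[simp] lemma S_mul (x y : Borel D 1) : S D (x * y) = S D y * S D x := by simp [S]
@[simp] lemma S_one : S D 1 = 1 := by simp [S]
@[simp] lemma S_algebraMap (c : k) : S D (algebraMap k _ c) = algebraMap k _ c := by simp [S]
@[simp] lemma S_E (i : Fin n) : S D (E i) = -(Kinv i * E i) := by simp [S, antipodeHom]
@[simp] lemma S_K (i : Fin n) : S D (K i) = Kinv i := by simp [S, antipodeHom]
@[simp] lemma S_Kinv (i : Fin n) : S D (Kinv i) = K i := by simp [S, antipodeHom]

lemma counit_S (x : Borel D 1) :
    Coalgebra.counit (R := k) (S D x) = Coalgebra.counit (R := k) x := by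
  induction x using induction with
  | hE i => simp [counit_pos_apply, counitHom]
  | hK i => simp [counit_pos_apply, counitHom]
  | hKinv i => simp [counit_pos_apply, counitHom]
  | halg c => simp
  | hadd x y hx hy => simp [hx, hy]
  | hmul x y hx hy => simp [hx, hy, mul_comm]

/-- The antipode reverses the comultiplication. -/
lemma comul_S (x : Borel D 1) : Coalgebra.comul (R := k) (S D x) =
    TensorProduct.comm k _ _ (TensorProduct.map (S D) (S D) (Coalgebra.comul x)) := by
  induction x using induction with
  | hE i =>
    simp only [S_E, comul_pos_apply, map_neg, map_mul, comulPos, lift_E, lift_Kinv, map_add,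
      TensorProduct.map_tmul, TensorProduct.comm_tmul, S_K, S_one]
    simp [mul_add, TensorProduct.neg_tmul, TensorProduct.tmul_neg]
  | hK i => simp [comul_pos_apply, comulPos]
  | hKinv i => simp [comul_pos_apply, comulPos]
  | halg c => simp [Algebra.algebraMap_eq_smul_one, Algebra.TensorProduct.one_def]
  | hadd x y hx hy => simp only [map_add, hx, hy]
  | hmul x y hx hy =>
    have H (t t' : Borel D 1 ⊗[k] Borel D 1) :
        TensorProduct.comm k _ _ (TensorProduct.map (S D) (S D) (t * t')) =
        TensorProduct.comm k _ _ (TensorProduct.map (S D) (S D) t') *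
          TensorProduct.comm k _ _ (TensorProduct.map (S D) (S D) t) := by
      induction t with
      | zero => simp
      | add a b ha hb => simp only [map_add, add_mul, mul_add, ha, hb]
      | tmul a b =>
        induction t' with
        | zero => simp
        | add a b ha hb => simp only [map_add, add_mul, mul_add, ha, hb]
        | tmul c d => simp
    rw [S_mul, Bialgebra.comul_mul, Bialgebra.comul_mul, hx, hy, H]

end Borel

end Borel

/-! ### The convolution algebra of functionals on a bialgebra -/

section Dual

variable {k : Type u} [Field k]

/-- The functionals on a coalgebra with the opposite of the convolution product,
`(f g)(x) = ∑ g(x₍₁₎) f(x₍₂₎)`. -/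
def DualAlg (k : Type u) [Field k] (C : Type v) [AddCommGroup C] [Module k C] [Coalgebra k C] :
    Type (max u v) := (WithConv (C →ₗ[k] k))ᵐᵒᵖ

namespace DualAlg

instance (C : Type v) [AddCommGroup C] [Module k C] [Coalgebra k C] : Ring (DualAlg k C) :=
  inferInstanceAs (Ring (WithConv (C →ₗ[k] k))ᵐᵒᵖ)

instance (C : Type v) [AddCommGroup C] [Module k C] [Coalgebra k C] : Algebra k (DualAlg k C) :=
  inferInstanceAs (Algebra k (WithConv (C →ₗ[k] k))ᵐᵒᵖ)

section Coalgebra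

variable {C : Type v} [AddCommGroup C] [Module k C] [Coalgebra k C]

/-- The elements of `DualAlg k C` as functionals. -/
def ev : DualAlg k C ≃ₗ[k] (C →ₗ[k] k) :=
  (MulOpposite.opLinearEquiv k).symm.trans (WithConv.linearEquiv k _)

lemma ev_mul_repr {ι : Type*} (a b : DualAlg k C) {x : C} (r : Coalgebra.Repr k x ι) :
    ev (a * b) x = ∑ i ∈ r.index, ev b (r.left i) * ev a (r.right i) :=
  r.convMul_apply b.unop a.unop

lemma ev_mul (a b : DualAlg k C) (x : C) :
    ev (a * b) x = LinearMap.mul' k k (TensorProduct.map (ev b) (ev a) (Coalgebra.comul x)) := rfl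

lemma ev_one (x : C) : ev (1 : DualAlg k C) x = Coalgebra.counit (R := k) x := rfl

lemma ext_ev {a b : DualAlg k C} (h : ∀ x, ev a x = ev b x) : a = b :=
  ev.injective (LinearMap.ext h)

end Coalgebra

variable {H : Type v} [Ring H] [Bialgebra k H]

variable (k H) in
/-- The transpose of the multiplication of a bialgebra. -/
def mulDual : DualAlg k H →ₐ[k] DualAlg k (H ⊗[k] H) :=
  AlgHom.ofLinearMap
    (ev.symm.toLinearMap ∘ₗ (LinearMap.lcomp k k (LinearMap.mul' k H)) ∘ₗ ev.toLinearMap)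
    (by
      apply ev.injective
      ext x x'
      simp [ev_one, mul_comm])
    (by
      intro a b
      apply ev.injective
      ext x x'
      simp only [LinearMap.comp_apply, LinearEquiv.coe_coe, LinearEquiv.apply_symm_apply,
        TensorProduct.AlgebraTensorModule.curry_apply, LinearMap.restrictScalars_self,
        TensorProduct.curry_apply, LinearMap.lcomp_apply, LinearMap.mul'_apply]
      rw [ev_mul_repr a b ((Coalgebra.Repr.arbitrary k x).mul (Coalgebra.Repr.arbitrary k x')),
        ev_mul_repr _ _ ((Coalgebra.Repr.arbitrary k x).tmul (Coalgebra.Repr.arbitrary k x'))]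
      rfl)

lemma ev_mulDual (a : DualAlg k H) (x x' : H) : ev (mulDual k H a) (x ⊗ₜ x') = ev a (x * x') := rfl

variable (k H) in
/-- The tensor product of functionals. -/
def tensorDual : DualAlg k H ⊗[k] DualAlg k H →ₐ[k] DualAlg k (H ⊗[k] H) :=
  Algebra.TensorProduct.algHomOfLinearMapTensorProduct
    (ev.symm.toLinearMap ∘ₗ TensorProduct.dualDistrib k H H ∘ₗ
        TensorProduct.map ev.toLinearMap ev.toLinearMap)
    (by
      intro a b a' b'
      apply ev.injective
      ext x x'
      simp only [LinearMap.comp_apply, LinearEquiv.coe_coe, LinearEquiv.apply_symm_apply,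
        TensorProduct.AlgebraTensorModule.curry_apply, LinearMap.restrictScalars_self,
        TensorProduct.curry_apply, TensorProduct.map_tmul, TensorProduct.dualDistrib_apply]
      rw [ev_mul_repr a b (Coalgebra.Repr.arbitrary k x),
        ev_mul_repr a' b' (Coalgebra.Repr.arbitrary k x'),
        ev_mul_repr _ _ ((Coalgebra.Repr.arbitrary k x).tmul (Coalgebra.Repr.arbitrary k x')),
        Finset.sum_mul_sum, ← Finset.sum_product']
      refine Finset.sum_congr rfl fun i _ => ?_
      simp [Coalgebra.Repr.tmul]
      ring)
    (by
      apply ev.injective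
      ext x x'
      simp [ev_one, mul_comm])

lemma ev_tensorDual (a b : DualAlg k H) (x x' : H) :
    ev (tensorDual k H (a ⊗ₜ b)) (x ⊗ₜ x') = ev a x * ev b x' := rfl

/-- A functional `g` is primitive up to the functionals `a` and `b` if
`g(x x') = g(x) a(x') + b(x) g(x')`. -/
def IsSkewPrimitive (g a b : DualAlg k H) : Prop :=
  mulDual k H g = tensorDual k H (g ⊗ₜ a + b ⊗ₜ g)

lemma IsSkewPrimitive.ev_mul {g a b : DualAlg k H} (h : IsSkewPrimitive g a b) (x x' : H) :
    ev g (x * x') = ev g x * ev a x' + ev b x * ev g x' := by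
  rw [← ev_mulDual, h, map_add, map_add, LinearMap.add_apply, ev_tensorDual, ev_tensorDual]

lemma isSkewPrimitive_iff {g a b : DualAlg k H} :
    IsSkewPrimitive g a b ↔ ∀ x x', ev g (x * x') = ev g x * ev a x' + ev b x * ev g x' := by
  refine ⟨fun h => h.ev_mul, fun h => ev.injective ?_⟩
  ext x x'
  exact (h x x').trans (by rw [map_add, map_add]; rfl)

/-- Multiplicative functionals are group-like. -/
lemma mulDual_algHom (χ : H →ₐ[k] k) : mulDual k H (ev.symm χ.toLinearMap) =
    tensorDual k H (ev.symm χ.toLinearMap ⊗ₜ ev.symm χ.toLinearMap) := by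
  apply ev.injective
  ext x x'
  simp only [TensorProduct.AlgebraTensorModule.curry_apply, LinearMap.restrictScalars_self,
        TensorProduct.curry_apply, ev_mulDual, ev_tensorDual]
  simp

end DualAlg

end Dual

/-! ### The pairing of the Borel algebras -/

namespace Borel

open DualAlg

variable {k : Type u} [Field k] {n : ℕ} {D : Datum k n}

/-- A skew-primitive functional on the Borel algebra that vanishes on the generators is zero. -/
lemma eq_zero_of_isSkewPrimitive {g a b : DualAlg k (Borel D 1)} (h : IsSkewPrimitive g a b)
    (h1 : ev g 1 = 0) (hE : ∀ i, ev g (E i) = 0) (hK : ∀ i, ev g (K i) = 0)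
    (hKinv : ∀ i, ev g (Kinv i) = 0) : g = 0 := by
  refine ext_ev fun x => ?_
  rw [map_zero, LinearMap.zero_apply]
  induction x using induction with
  | hE i => exact hE i
  | hK i => exact hK i
  | hKinv i => exact hKinv i
  | halg c => rw [Algebra.algebraMap_eq_smul_one, map_smul, h1, smul_zero]
  | hadd x y hx hy => rw [map_add, hx, hy, add_zero]
  | hmul x y hx hy => rw [h.ev_mul, hx, hy, zero_mul, mul_zero, add_zero]

lemma ev_mul_one (a b : DualAlg k (Borel D 1)) : ev (a * b) 1 = ev b 1 * ev a 1 := by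
  simp [ev_mul, Algebra.TensorProduct.one_def]

lemma ev_mul_E (a b : DualAlg k (Borel D 1)) (i : Fin n) :
    ev (a * b) (E i) = ev b (E i) * ev a 1 + ev b (K i) * ev a (E i) := by
  simp [ev_mul, comul_pos_apply, comulPos]

lemma ev_mul_K (a b : DualAlg k (Borel D 1)) (i : Fin n) :
    ev (a * b) (K i) = ev b (K i) * ev a (K i) := by
  simp [ev_mul, comul_pos_apply, comulPos]

lemma ev_mul_Kinv (a b : DualAlg k (Borel D 1)) (i : Fin n) :
    ev (a * b) (Kinv i) = ev b (Kinv i) * ev a (Kinv i) := by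
  simp [ev_mul, comul_pos_apply, comulPos]

variable (D) in
/-- The multiplicative functional `x ↦ φ(x, K_j)` for `z = 1`, `x ↦ φ(x, K_j⁻¹)` for `z = -1`:
`E_i ↦ 0`, `K_i ↦ q^{z d_i a_ij}`. -/
def charHom (z : ℤ) (j : Fin n) : Borel D 1 →ₐ[k] k :=
  lift (.character (c := fun i => D.q ^ (z * (D.d i * D.a i j)))
    (c' := fun i => D.q ^ (-(z * (D.d i * D.a i j))))
    (fun i => by rw [← zpow_add₀ D.q_ne_zero, add_neg_cancel, zpow_zero]))

variable (D) in
/-- `charHom` as an element of the convolution algebra. -/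
def char (z : ℤ) (j : Fin n) : DualAlg k (Borel D 1) := ev.symm (charHom D z j).toLinearMap

lemma ev_char (z : ℤ) (j : Fin n) (x : Borel D 1) : ev (char D z j) x = charHom D z j x := rfl

lemma serre_eq_zero_of_mul_eq_zero {B : Type v} [Ring B] [Algebra k B] (v : k) {m : ℕ} (hm : m ≠ 0)
    {x y : B} (hxy : x * y = 0) (hyx : y * x = 0) : serre v m x y = 0 := by
  refine Finset.sum_eq_zero fun s hs => ?_
  rcases Nat.eq_zero_or_pos s with rfl | hs'
  · obtain ⟨m, rfl⟩ := Nat.exists_eq_succ_of_ne_zero hm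
    rw [Nat.sub_zero, pow_succ, mul_assoc (x ^ m), hxy]; simp
  · obtain ⟨s, rfl⟩ := Nat.exists_eq_succ_of_ne_zero hs'.ne'
    rw [pow_succ' x s, mul_assoc, ← mul_assoc y, hyx]; simp

lemma serreExp_ne_zero {i j : Fin n} (hij : i ≠ j) : D.serreExp i j ≠ 0 := by
  have h1 := URelations.serreExp_eq (D := D) hij
  have h2 := D.offDiag i j hij
  simp only [Set.mem_insert_iff, Set.mem_singleton_iff] at h2
  omega

variable (D) in
/-- The upper triangular representation whose off-diagonal coefficient is `x ↦ φ(x, F_j)`. -/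
def matHom (j : Fin n) : Borel D 1 →ₐ[k] Matrix (Fin 2) (Fin 2) k :=
  lift (D := D) (η := 1)
    (e := fun i => !![0, if i = j then (D.q ^ (2 * D.d i) - 1)⁻¹ else 0; 0, 0])
    (κ := fun i => !![1, 0; 0, D.q ^ (-(D.d i * D.a i j))])
    (κ' := fun i => !![1, 0; 0, D.q ^ (D.d i * D.a i j)])
    { K_K := fun i i' => by simp [mul_comm]
      K_Kinv := fun i => by
        simp [Matrix.one_fin_two, D.q_ne_zero, zpow_ne_zero]
      Kinv_K := fun i => by
        simp [Matrix.one_fin_two, D.q_ne_zero, zpow_ne_zero]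
      K_E := fun i i' => by
        by_cases h : i' = j
        · subst h
          simp only [zpow_neg, ite_true, one_mul]
          have := zpow_ne_zero (D.d i * D.a i i') D.q_ne_zero
          ext a b
          fin_cases a <;> fin_cases b <;>
            simp [Matrix.mul_apply]
          field_simp
        · simp [h]
      serre_E := fun i i' hij => by
        refine serre_eq_zero_of_mul_eq_zero _ (serreExp_ne_zero hij) ?_ ?_ <;> ext a b <;>
          fin_cases a <;> fin_cases b <;> simp [Matrix.mul_apply] }

lemma matHom_entries (j : Fin n) (x : Borel D 1) :
    matHom D j x 0 0 = Coalgebra.counit (R := k) x ∧ matHom D j x 1 0 = 0 ∧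
      matHom D j x 1 1 = charHom D (-1) j x := by
  induction x using induction with
  | hE i => simp [matHom, counit_pos_apply, counitHom, charHom]
  | hK i => simp [matHom, counit_pos_apply, counitHom, charHom]
  | hKinv i => simp [matHom, counit_pos_apply, counitHom, charHom]
  | halg c => simp [Matrix.algebraMap_matrix_apply]
  | hadd x y hx hy => simp [hx, hy]
  | hmul x y hx hy => simp [hx, hy, Matrix.mul_apply]

variable (D) in
/-- The functional `x ↦ φ(x, F_j)` as an element of the convolution algebra. -/
def der (j : Fin n) : DualAlg k (Borel D 1) :=
  ev.symm (Matrix.entryLinearMap k k (0 : Fin 2) (1 : Fin 2) ∘ₗ (matHom D j).toLinearMap)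

lemma ev_der (j : Fin n) (x : Borel D 1) : ev (der D j) x = matHom D j x 0 1 := rfl

lemma isSkewPrimitive_der (j : Fin n) : IsSkewPrimitive (der D j) (char D (-1) j) 1 := by
  rw [isSkewPrimitive_iff]
  intro x x'
  rw [ev_der, ev_der, ev_der, ev_one, ev_char, map_mul, Matrix.mul_apply, Fin.sum_univ_two,
    (matHom_entries j x).1, (matHom_entries j x').2.2, add_comm]

lemma mulDual_char (z : ℤ) (j : Fin n) : mulDual k _ (char D z j) =
    tensorDual k _ (char D z j ⊗ₜ char D z j) :=
  mulDual_algHom _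

lemma mulDual_der (j : Fin n) : mulDual k _ (der D j) =
    tensorDual k _ (der D j ⊗ₜ char D (-1) j + 1 ⊗ₜ der D j) :=
  isSkewPrimitive_der j

lemma char_comm (z z' : ℤ) (i j : Fin n) :
    char D z i * char D z' j = char D z' j * char D z i := by
  rw [← sub_eq_zero]
  refine eq_zero_of_isSkewPrimitive (a := char D z i * char D z' j)
    (b := char D z' j * char D z i) ?_ ?_ ?_ ?_ ?_
  · rw [IsSkewPrimitive, map_sub, map_mul, map_mul, mulDual_char, mulDual_char, ← map_mul,
      ← map_mul, ← map_sub]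
    simp [TensorProduct.sub_tmul, TensorProduct.tmul_sub]
  · simp [ev_mul_one, mul_comm]
  · simp [ev_mul_E, ev_char, charHom]
  · simp [ev_mul_K, mul_comm]
  · simp [ev_mul_Kinv, mul_comm]

lemma char_mul_char_neg (z : ℤ) (i : Fin n) : char D z i * char D (-z) i = 1 := by
  rw [← sub_eq_zero]
  refine eq_zero_of_isSkewPrimitive (a := char D z i * char D (-z) i) (b := 1) ?_ ?_ ?_ ?_ ?_
  · rw [IsSkewPrimitive, map_sub, map_mul, map_one, mulDual_char, mulDual_char, ← map_mul,
      ← map_one (tensorDual k (Borel D 1)), ← map_sub]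
    simp [TensorProduct.sub_tmul, TensorProduct.tmul_sub, Algebra.TensorProduct.one_def]
  · simp [ev_mul_one, ev_char, ev_one]
  · simp [ev_mul_E, ev_char, ev_one, charHom, counit_pos_apply, counitHom]
  · intro j
    simp [ev_mul_K, ev_char, ev_one, charHom, counit_pos_apply, counitHom, D.q_ne_zero,
      zpow_ne_zero]
  · intro j
    simp [ev_mul_Kinv, ev_char, ev_one, charHom, counit_pos_apply, counitHom, D.q_ne_zero,
      zpow_ne_zero]

lemma torusRelations_dual :
    TorusRelations D (-1) (B := DualAlg k (Borel D 1)) (der D) (char D 1) (char D (-1)) where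
  K_K i j := char_comm _ _ i j
  K_Kinv i := char_mul_char_neg 1 i
  Kinv_K i := char_mul_char_neg (-1) i
  K_E i j := by
    rw [← sub_eq_zero]
    refine eq_zero_of_isSkewPrimitive (a := char D 1 i * char D (-1) j) (b := char D 1 i)
      ?_ ?_ ?_ ?_ ?_
    · rw [IsSkewPrimitive, map_sub, map_smul, map_mul, map_mul, mulDual_char, mulDual_der,
        ← map_mul, ← map_mul, ← map_smul, ← map_sub]
      congr 1
      set_option linter.unusedSimpArgs false in
      simp only [Algebra.TensorProduct.tmul_mul_tmul, TensorProduct.sub_tmul,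
        TensorProduct.tmul_sub, mul_add, add_mul, smul_add, ← TensorProduct.smul_tmul',
        TensorProduct.tmul_smul, one_mul, mul_one, char_comm (-1) 1 j i]
      abel
    · simp [ev_mul_one, ev_char, ev_der]
    · intro l
      by_cases h : l = j
      · subst h
        simp [ev_mul_E, ev_char, ev_der, matHom, charHom, D.symm l i, ← mul_assoc, D.q_ne_zero,
          zpow_ne_zero]
      · simp [ev_mul_E, ev_char, ev_der, matHom, h]
    · simp [ev_mul_K, ev_char, ev_der, matHom]
    · simp [ev_mul_Kinv, ev_char, ev_der, matHom]

/-- The functionals that vanish on the generators `K_i^{±1}` and on `1`. They form an ideal, and the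
products of two of them vanish on all generators. -/
def VanishesOnTorus (g : DualAlg k (Borel D 1)) : Prop :=
  ev g 1 = 0 ∧ (∀ i, ev g (K i) = 0) ∧ ∀ i, ev g (Kinv i) = 0

lemma VanishesOnTorus.mul_right {g : DualAlg k (Borel D 1)} (h : VanishesOnTorus g)
    (g' : DualAlg k (Borel D 1)) : VanishesOnTorus (g * g') := by
  simp [VanishesOnTorus, ev_mul_one, ev_mul_K, ev_mul_Kinv, h.1, h.2.1, h.2.2]

lemma VanishesOnTorus.mul_left {g : DualAlg k (Borel D 1)} (h : VanishesOnTorus g)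
    (g' : DualAlg k (Borel D 1)) : VanishesOnTorus (g' * g) := by
  simp [VanishesOnTorus, ev_mul_one, ev_mul_K, ev_mul_Kinv, h.1, h.2.1, h.2.2]

lemma VanishesOnTorus.ev_mul_E {g g' : DualAlg k (Borel D 1)} (h : VanishesOnTorus g)
    (h' : VanishesOnTorus g') (i : Fin n) : ev (g * g') (E i) = 0 := by
  rw [Borel.ev_mul_E, h.1, h'.2.1, mul_zero, zero_mul, add_zero]

lemma vanishesOnTorus_der (j : Fin n) : VanishesOnTorus (der D j) := by
  simp [VanishesOnTorus, ev_der, matHom]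

lemma ev_serre_eq_zero (v : k) {m : ℕ} (hm : m ≠ 0) {x y : DualAlg k (Borel D 1)}
    (hx : VanishesOnTorus x) (hy : VanishesOnTorus y) :
    VanishesOnTorus (serre v m x y) ∧ ∀ i, ev (serre v m x y) (E i) = 0 := by
  have key (s : ℕ) : VanishesOnTorus (x ^ (m - s) * y * x ^ s) ∧
      ∀ i, ev (x ^ (m - s) * y * x ^ s) (E i) = 0 := by
    refine ⟨(hy.mul_left _).mul_right _, ?_⟩
    rcases Nat.eq_zero_or_pos s with rfl | hs
    · obtain ⟨l, rfl⟩ := Nat.exists_eq_succ_of_ne_zero hm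
      rw [Nat.sub_zero, pow_zero, mul_one, pow_succ]
      exact (hx.mul_left _).ev_mul_E hy
    · obtain ⟨s, rfl⟩ := Nat.exists_eq_succ_of_ne_zero hs.ne'
      rw [pow_succ x s, ← mul_assoc]
      exact ((hy.mul_left _).mul_right _).ev_mul_E hx
  unfold serre VanishesOnTorus
  simp only [map_sum, map_smul, LinearMap.sum_apply, LinearMap.smul_apply, (key _).2,
    (key _).1.1, (key _).1.2.1, (key _).1.2.2, smul_zero, Finset.sum_const_zero, implies_true,
    and_self]

/-- The Serre elements in the functionals `φ(·, F_j)` vanish: they are skew-primitive and vanish on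
the generators, being combinations of products of at least two functionals `φ(·, F_j)`. -/
lemma borelRelations_dual :
    BorelRelations D (-1) (B := DualAlg k (Borel D 1)) (der D) (char D 1) (char D (-1)) where
  __ := torusRelations_dual
  serre_E i j hij := by
    obtain ⟨⟨h1, hK, hKinv⟩, hE⟩ := ev_serre_eq_zero (D.qi i)
      (serreExp_ne_zero (D := D) hij)
      (vanishesOnTorus_der (D := D) i) (vanishesOnTorus_der j)
    refine eq_zero_of_isSkewPrimitive (a := char D (-1) i ^ D.serreExp i j * char D (-1) j)
      (b := 1) ?_ h1 hE hK hKinv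
    rw [IsSkewPrimitive, serre_map, mulDual_der, mulDual_der, ← serre_map,
      torusRelations_dual.serre_comul_neg hij]

variable (D) in
/-- The homomorphism `y ↦ φ(·, y)`. -/
def toDual : Borel D (-1) →ₐ[k] DualAlg k (Borel D 1) := lift borelRelations_dual

variable (D) in
/-- The pairing of the Borel algebras. -/
def pairing : Borel D 1 →ₗ[k] Borel D (-1) →ₗ[k] k :=
  (ev.toLinearMap ∘ₗ (toDual D).toLinearMap).flip

lemma pairing_apply (x : Borel D 1) (y : Borel D (-1)) : pairing D x y = ev (toDual D y) x := rfl

lemma pairing_mul_right (x : Borel D 1) (y y' : Borel D (-1)) : pairing D x (y * y') =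
    pairTensor (pairing D) (TensorProduct.comm k _ _ (Coalgebra.comul x)) (y ⊗ₜ y') := by
  rw [pairing_apply, map_mul, ev_mul]
  generalize (Coalgebra.comul (R := k) x) = t
  induction t with
  | zero => simp
  | tmul a b => simp [pairing_apply, mul_comm]
  | add a b ha hb => simp only [map_add, LinearMap.add_apply, ha, hb]

lemma mulDual_toDual (y : Borel D (-1)) : mulDual k _ (toDual D y) =
    tensorDual k _ (Algebra.TensorProduct.map (toDual D) (toDual D) (comulNeg D y)) := by
  have : (mulDual k _).comp (toDual D) =
      ((tensorDual k _).comp (Algebra.TensorProduct.map (toDual D) (toDual D))).comp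
        (comulNeg D) := by
    refine hom_ext ?_ ?_ ?_ <;> intro i <;>
      simp [toDual, comulNeg, mulDual_der, mulDual_char]
  exact DFunLike.congr_fun this y

lemma pairing_mul_left (x x' : Borel D 1) (y : Borel D (-1)) : pairing D (x * x') y =
    pairTensor (pairing D) (x ⊗ₜ x') (Coalgebra.comul y) := by
  rw [pairing_apply, ← ev_mulDual, mulDual_toDual, comul_neg_apply]
  generalize comulNeg D y = t
  induction t with
  | zero => simp
  | tmul a b => rw [Algebra.TensorProduct.map_tmul, ev_tensorDual]; rfl
  | add a b ha hb => simp only [map_add, LinearMap.add_apply, ha, hb]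

lemma pairing_one_right (x : Borel D 1) : pairing D x 1 = Coalgebra.counit (R := k) x := by
  rw [pairing_apply, map_one, ev_one]

lemma pairing_one_left (y : Borel D (-1)) : pairing D 1 y = Coalgebra.counit (R := k) y := by
  induction y using induction with
  | hE i => simp [pairing_apply, toDual, counit_neg_apply, counitHom, ev_der]
  | hK i => simp [pairing_apply, toDual, counit_neg_apply, counitHom, ev_char]
  | hKinv i => simp [pairing_apply, toDual, counit_neg_apply, counitHom, ev_char]
  | halg c => simp [Algebra.algebraMap_eq_smul_one, pairing_one_right]
  | hadd x y hx hy => simp [hx, hy]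
  | hmul x y hx hy =>
    rw [pairing_mul_right, Bialgebra.comul_one, Algebra.TensorProduct.one_def]
    simp [hx, hy]

lemma pairing_E_E (i j : Fin n) : pairing D (E i) (E j) =
    if i = j then (D.q ^ (2 * D.d i) - 1)⁻¹ else 0 := by
  simp [pairing_apply, toDual, ev_der, matHom]

lemma pairing_K_E (i j : Fin n) : pairing D (K i) (E j) = 0 := by
  simp [pairing_apply, toDual, ev_der, matHom]

lemma pairing_Kinv_E (i j : Fin n) : pairing D (Kinv i) (E j) = 0 := by
  simp [pairing_apply, toDual, ev_der, matHom]

lemma pairing_E_K (i j : Fin n) : pairing D (E i) (K j) = 0 := by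
  simp [pairing_apply, toDual, ev_char, charHom]

lemma pairing_E_Kinv (i j : Fin n) : pairing D (E i) (Kinv j) = 0 := by
  simp [pairing_apply, toDual, ev_char, charHom]

lemma pairing_K_K (i j : Fin n) : pairing D (K i) (K j) = D.q ^ (D.d i * D.a i j) := by
  simp [pairing_apply, toDual, ev_char, charHom]

lemma pairing_K_Kinv (i j : Fin n) : pairing D (K i) (Kinv j) = D.q ^ (-(D.d i * D.a i j)) := by
  simp [pairing_apply, toDual, ev_char, charHom]

lemma pairing_Kinv_K (i j : Fin n) : pairing D (Kinv i) (K j) = D.q ^ (-(D.d i * D.a i j)) := by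
  simp [pairing_apply, toDual, ev_char, charHom]

lemma pairing_Kinv_Kinv (i j : Fin n) : pairing D (Kinv i) (Kinv j) = D.q ^ (D.d i * D.a i j) := by
  simp [pairing_apply, toDual, ev_char, charHom]

variable (D) in
/-- The pairing of the Borel algebras together with the opposite pairing `φ(S(x), y)`. -/
def skewPairing : SkewPairing k (Borel D 1) (Borel D (-1)) where
  φ := pairing D
  ψ := pairing D ∘ₗ S D
  one_left := pairing_one_left
  one_right := pairing_one_right
  mul_left := pairing_mul_left
  mul_right := pairing_mul_right
  one_left' y := by rw [LinearMap.comp_apply, S_one, pairing_one_left]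
  one_right' x := by rw [LinearMap.comp_apply, pairing_one_right, counit_S]
  mul_left' x x' y := by
    rw [LinearMap.comp_apply, S_mul, pairing_mul_left]
    generalize (Coalgebra.comul (R := k) y) = t
    induction t with
    | zero => simp
    | tmul a b => rfl
    | add a b ha hb => simp only [map_add, ha, hb]
  mul_right' x y y' := by
    rw [LinearMap.comp_apply, pairing_mul_right, comul_S]
    generalize (Coalgebra.comul (R := k) x) = t
    induction t with
    | zero => simp
    | tmul a b => rfl
    | add a b ha hb => simp only [map_add, LinearMap.add_apply, ha, hb]

end Borel

/-! ### The presented algebra maps to doubles of Borel algebras -/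

section Presentation

variable {k : Type u} [Field k] {n : ℕ}

/-- The relations `DRel`, for elements of an arbitrary algebra. -/
structure DRelations (D : Datum k n) {B : Type v} [Ring B] [Algebra k B]
    (e f κ κ' τ τ' : Fin n → B) : Prop where
  pos : BorelRelations D 1 e κ κ'
  neg : BorelRelations D (-1) f τ τ'
  K_Kt : ∀ i j, κ i * τ j = τ j * κ i
  K_F : ∀ i j, κ i * f j = D.q ^ (-(D.d i * D.a i j)) • (f j * κ i)
  Kt_E : ∀ i j, τ i * e j = D.q ^ (D.d i * D.a i j) • (e j * τ i)
  E_F : ∀ i j, e i * f j - f j * e i =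
    if i = j then (D.qi i - (D.qi i)⁻¹)⁻¹ • (κ i - τ' i) else 0

namespace DPres

variable {D : Datum k n}

lemma mk_rel {x y : FreeAlgebra k (DGen n)} (h : DRel D x y) :
    RingQuot.mkAlgHom k (DRel D) x = RingQuot.mkAlgHom k (DRel D) y :=
  RingQuot.mkAlgHom_rel k h

variable (D) in
lemma relations : DRelations D (fun i => of D (.E i)) (fun i => of D (.F i)) (fun i => of D (.K i))
    (fun i => of D (.Kinv i)) (fun i => of D (.Kt i)) (fun i => of D (.Ktinv i)) where
  pos :=
    { K_K := fun i j => by simpa only [of, map_mul] using mk_rel (DRel.K_K (D := D) i j)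
      K_Kinv := fun i => by simpa only [of, map_mul, map_one] using mk_rel (DRel.K_Kinv (D := D) i)
      Kinv_K := fun i => by simpa only [of, map_mul, map_one] using mk_rel (DRel.Kinv_K (D := D) i)
      K_E := fun i j => by
        simpa only [of, map_mul, map_smul, one_mul] using mk_rel (DRel.K_E (D := D) i j)
      serre_E := fun i j hij => by
        simpa only [of, serre_map, map_zero] using mk_rel (DRel.serre_E (D := D) i j hij) }
  neg :=
    { K_K := fun i j => by simpa only [of, map_mul] using mk_rel (DRel.Kt_Kt (D := D) i j)
      K_Kinv := fun i => by
        simpa only [of, map_mul, map_one] using mk_rel (DRel.Kt_Ktinv (D := D) i)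
      Kinv_K := fun i => by
        simpa only [of, map_mul, map_one] using mk_rel (DRel.Ktinv_Kt (D := D) i)
      K_E := fun i j => by
        simpa only [of, map_mul, map_smul, neg_one_mul] using mk_rel (DRel.Kt_F (D := D) i j)
      serre_E := fun i j hij => by
        simpa only [of, serre_map, map_zero] using mk_rel (DRel.serre_F (D := D) i j hij) }
  K_Kt i j := by simpa only [of, map_mul] using mk_rel (DRel.K_Kt (D := D) i j)
  K_F i j := by simpa only [of, map_mul, map_smul] using mk_rel (DRel.K_F (D := D) i j)
  Kt_E i j := by simpa only [of, map_mul, map_smul] using mk_rel (DRel.Kt_E (D := D) i j)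
  E_F i j := by
    have := mk_rel (DRel.E_F (D := D) i j)
    rw [map_sub, map_mul, map_mul] at this
    refine this.trans ?_
    split_ifs <;> simp [of]

section lift

variable {B : Type v} [Ring B] [Algebra k B] {e f κ κ' τ τ' : Fin n → B}

/-- The images of the generating symbols. -/
def genMap (e f κ κ' τ τ' : Fin n → B) : DGen n → B
  | .E i => e i
  | .F i => f i
  | .K i => κ i
  | .Kinv i => κ' i
  | .Kt i => τ i
  | .Ktinv i => τ' i

/-- The universal property of the presented algebra. -/
def lift (h : DRelations D e f κ κ' τ τ') : DPres D →ₐ[k] B :=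
  RingQuot.liftAlgHom k ⟨FreeAlgebra.lift k (genMap e f κ κ' τ τ'), by
    intro x y hxy
    cases hxy with
    | K_K i j => simpa [genMap] using h.pos.K_K i j
    | K_Kinv i => simpa [genMap] using h.pos.K_Kinv i
    | Kinv_K i => simpa [genMap] using h.pos.Kinv_K i
    | Kt_Kt i j => simpa [genMap] using h.neg.K_K i j
    | Kt_Ktinv i => simpa [genMap] using h.neg.K_Kinv i
    | Ktinv_Kt i => simpa [genMap] using h.neg.Kinv_K i
    | K_Kt i j => simpa [genMap] using h.K_Kt i j
    | K_E i j => simpa [genMap] using h.pos.K_E i j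
    | K_F i j => simpa [genMap] using h.K_F i j
    | Kt_E i j => simpa [genMap] using h.Kt_E i j
    | Kt_F i j => simpa [genMap] using h.neg.K_E i j
    | E_F i j =>
      have := h.E_F i j
      split_ifs at this ⊢ <;> simpa [genMap] using this
    | serre_E i j hij => simpa [genMap, serre_map] using h.pos.serre_E i j hij
    | serre_F i j hij => simpa [genMap, serre_map] using h.neg.serre_E i j hij⟩

lemma lift_of (h : DRelations D e f κ κ' τ τ') (x : DGen n) :
    lift h (of D x) = genMap e f κ κ' τ τ' x := by
  rw [lift, of, RingQuot.liftAlgHom_mkAlgHom_apply, FreeAlgebra.lift_ι_apply]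

end lift

lemma induction {P : DPres D → Prop} (hof : ∀ x, P (of D x)) (halg : ∀ c : k, P (algebraMap k _ c))
    (hadd : ∀ x y, P x → P y → P (x + y)) (hmul : ∀ x y, P x → P y → P (x * y)) (x : DPres D) :
    P x := by
  obtain ⟨x, rfl⟩ : ∃ y, RingQuot.mkAlgHom k (DRel D) y = x :=
    RingQuot.mkAlgHom_surjective k (DRel D) x
  induction x using FreeAlgebra.induction with
  | grade0 r => simpa using halg r
  | grade1 x => exact hof x
  | mul a b ha hb => simpa using hmul _ _ ha hb
  | add a b ha hb => simpa using hadd _ _ ha hb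

end DPres

/-- Elements `e_i, κ_i, κ'_i` that generate the bialgebra `H` and behave like the elements
`E_i, K_i, K_i⁻¹` of `U_q^{≥0}`. -/
structure PosGens (D : Datum k n) {H : Type v} [Ring H] [Bialgebra k H] (e κ κ' : Fin n → H) :
    Prop where
  rel : BorelRelations D 1 e κ κ'
  comul_e : ∀ i, Coalgebra.comul (R := k) (e i) = e i ⊗ₜ 1 + κ i ⊗ₜ e i
  comul_κ : ∀ i, Coalgebra.comul (R := k) (κ i) = κ i ⊗ₜ κ i
  counit_e : ∀ i, Coalgebra.counit (R := k) (e i) = 0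
  counit_κ : ∀ i, Coalgebra.counit (R := k) (κ i) = 1
  counit_κ' : ∀ i, Coalgebra.counit (R := k) (κ' i) = 1
  adjoin : Algebra.adjoin k (Set.range e ∪ (Set.range κ ∪ Set.range κ')) = ⊤

/-- Elements `f_i, τ_i, τ'_i` that generate the bialgebra `H'` and behave like the elements
`F_i, K_i, K_i⁻¹` of `U_q^{≤0}`. -/
structure NegGens (D : Datum k n) {H' : Type w} [Ring H'] [Bialgebra k H'] (f τ τ' : Fin n → H') :
    Prop where
  rel : BorelRelations D (-1) f τ τ'
  comul_f : ∀ i, Coalgebra.comul (R := k) (f i) = f i ⊗ₜ τ' i + 1 ⊗ₜ f i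
  comul_τ : ∀ i, Coalgebra.comul (R := k) (τ i) = τ i ⊗ₜ τ i
  comul_τ' : ∀ i, Coalgebra.comul (R := k) (τ' i) = τ' i ⊗ₜ τ' i
  counit_f : ∀ i, Coalgebra.counit (R := k) (f i) = 0
  counit_τ : ∀ i, Coalgebra.counit (R := k) (τ i) = 1
  counit_τ' : ∀ i, Coalgebra.counit (R := k) (τ' i) = 1
  adjoin : Algebra.adjoin k (Set.range f ∪ (Set.range τ ∪ Set.range τ')) = ⊤

/-- Induction over generators. -/
lemma adjoin_top_induction {B : Type v} [Ring B] [Algebra k B] {e κ κ' : Fin n → B}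
    (h : Algebra.adjoin k (Set.range e ∪ (Set.range κ ∪ Set.range κ')) = ⊤) {p : B → Prop}
    (he : ∀ i, p (e i)) (hκ : ∀ i, p (κ i)) (hκ' : ∀ i, p (κ' i))
    (halg : ∀ c : k, p (algebraMap k B c)) (hadd : ∀ x y, p x → p y → p (x + y))
    (hmul : ∀ x y, p x → p y → p (x * y)) (x : B) : p x := by
  have hx : x ∈ Algebra.adjoin k (Set.range e ∪ (Set.range κ ∪ Set.range κ')) := by simp [h]
  induction hx using Algebra.adjoin_induction with
  | mem x hx => obtain ⟨i, rfl⟩ | ⟨i, rfl⟩ | ⟨i, rfl⟩ := hx <;> grind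
  | algebraMap c => exact halg c
  | add x y _ _ hx hy => exact hadd x y hx hy
  | mul x y _ _ hx hy => exact hmul x y hx hy

/-- The values on generators of the Lusztig pairing `φ` for `η = 1`, and of `φ(S(x), y)` for
`η = -1`. -/
structure GenValues (D : Datum k n) (η : ℤ) {H : Type v} {H' : Type w} [AddCommGroup H]
    [Module k H] [AddCommGroup H'] [Module k H'] (θ : H →ₗ[k] H' →ₗ[k] k) (e κ κ' : Fin n → H)
    (f τ τ' : Fin n → H') : Prop where
  e_f : ∀ i j, θ (e i) (f j) = if i = j then η * (D.q ^ (2 * D.d i) - 1)⁻¹ else 0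
  κ_f : ∀ i j, θ (κ i) (f j) = 0
  κ'_f : ∀ i j, θ (κ' i) (f j) = 0
  e_τ : ∀ i j, θ (e i) (τ j) = 0
  e_τ' : ∀ i j, θ (e i) (τ' j) = 0
  κ_τ : ∀ i j, θ (κ i) (τ j) = D.q ^ (η * (D.d i * D.a i j))
  κ_τ' : ∀ i j, θ (κ i) (τ' j) = D.q ^ (-(η * (D.d i * D.a i j)))
  κ'_τ : ∀ i j, θ (κ' i) (τ j) = D.q ^ (-(η * (D.d i * D.a i j)))
  κ'_τ' : ∀ i j, θ (κ' i) (τ' j) = D.q ^ (η * (D.d i * D.a i j))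

/-- A skew pairing of bialgebras with generators as in `PosGens` and `NegGens` that takes the
values of the Lusztig pairing. -/
structure IsBorelPairing (D : Datum k n) {H : Type v} {H' : Type w} [Ring H] [Bialgebra k H]
    [Ring H'] [Bialgebra k H'] (P : SkewPairing k H H') (e κ κ' : Fin n → H)
    (f τ τ' : Fin n → H') : Prop where
  pos : PosGens D e κ κ'
  neg : NegGens D f τ τ'
  φ_val : GenValues D 1 P.φ e κ κ' f τ τ'
  ψ_val : GenValues D (-1) P.ψ e κ κ' f τ τ'

namespace IsBorelPairing

variable {D : Datum k n} {H : Type v} {H' : Type w} [Ring H] [Bialgebra k H]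
    [Ring H'] [Bialgebra k H'] {P : SkewPairing k H H'} {e κ κ' : Fin n → H}
    {f τ τ' : Fin n → H'}

lemma comul₃_e (h : IsBorelPairing D P e κ κ' f τ τ') (i : Fin n) : comul₃ k H (e i) =
    e i ⊗ₜ (1 ⊗ₜ 1) + (κ i ⊗ₜ (e i ⊗ₜ 1) + κ i ⊗ₜ (κ i ⊗ₜ e i)) := by
  simp [comul₃, h.pos.comul_e, TensorProduct.tmul_add, Algebra.TensorProduct.one_def]

lemma comul₃_κ (h : IsBorelPairing D P e κ κ' f τ τ') (i : Fin n) :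
    comul₃ k H (κ i) = κ i ⊗ₜ (κ i ⊗ₜ κ i) := by
  simp [comul₃, h.pos.comul_κ]

lemma comul₃_f (h : IsBorelPairing D P e κ κ' f τ τ') (i : Fin n) : comul₃ k H' (f i) =
    f i ⊗ₜ (τ' i ⊗ₜ τ' i) + (1 ⊗ₜ (f i ⊗ₜ τ' i) + 1 ⊗ₜ (1 ⊗ₜ f i)) := by
  simp [comul₃, h.neg.comul_f, h.neg.comul_τ', TensorProduct.tmul_add]

lemma comul₃_τ (h : IsBorelPairing D P e κ κ' f τ τ') (i : Fin n) :
    comul₃ k H' (τ i) = τ i ⊗ₜ (τ i ⊗ₜ τ i) := by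
  simp [comul₃, h.neg.comul_τ]

lemma cross_e_f (h : IsBorelPairing D P e κ κ' f τ τ') (i j : Fin n) :
    P.cross (e i) (f j) = e i ⊗ₜ f j +
      (if i = j then (D.q ^ (2 * D.d i) - 1)⁻¹ else 0) • (1 ⊗ₜ τ' j - κ i ⊗ₜ 1) := by
  rw [SkewPairing.cross, LinearMap.compl₁₂_apply, h.comul₃_e, h.comul₃_f]
  simp only [map_add, LinearMap.add_apply, SkewPairing.contract_tmul, h.φ_val.e_f, h.φ_val.κ_f,
    h.ψ_val.e_f, h.ψ_val.e_τ', P.one_left', P.one_right, h.pos.counit_e, h.pos.counit_κ,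
    h.neg.counit_f, h.neg.counit_τ']
  split_ifs
  · simp [sub_eq_add_neg]
    abel
  · simp

lemma cross_e_τ (h : IsBorelPairing D P e κ κ' f τ τ') (i j : Fin n) :
    P.cross (e i) (τ j) = D.q ^ (D.d i * D.a i j) • (e i ⊗ₜ τ j) := by
  rw [SkewPairing.cross, LinearMap.compl₁₂_apply, h.comul₃_e, h.comul₃_τ]
  simp [SkewPairing.contract_tmul, h.φ_val.e_τ, h.φ_val.κ_τ, h.ψ_val.e_τ, P.one_left',
    h.neg.counit_τ]

lemma cross_κ_f (h : IsBorelPairing D P e κ κ' f τ τ') (i j : Fin n) :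
    P.cross (κ i) (f j) = D.q ^ (D.d i * D.a i j) • (κ i ⊗ₜ f j) := by
  rw [SkewPairing.cross, LinearMap.compl₁₂_apply, h.comul₃_κ, h.comul₃_f]
  simp [SkewPairing.contract_tmul, h.φ_val.κ_f, h.ψ_val.κ_τ', h.ψ_val.κ_f, P.one_right,
    h.pos.counit_κ]

lemma cross_κ_τ (h : IsBorelPairing D P e κ κ' f τ τ') (i j : Fin n) :
    P.cross (κ i) (τ j) = κ i ⊗ₜ τ j := by
  rw [SkewPairing.cross, LinearMap.compl₁₂_apply, h.comul₃_κ, h.comul₃_τ]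
  simp [SkewPairing.contract_tmul, h.φ_val.κ_τ, h.ψ_val.κ_τ, D.q_ne_zero, zpow_ne_zero]


lemma _root_.QD.Datum.qi_mul_inv (i : Fin n) :
    D.qi i * (D.q ^ (2 * D.d i) - 1)⁻¹ = (D.qi i - (D.qi i)⁻¹)⁻¹ := by
  have h0 := URelations.qi_ne_zero (D := D) i
  have h1 : D.q ^ (2 * D.d i) = D.qi i * D.qi i := by
    rw [Datum.qi, ← zpow_add₀ D.q_ne_zero, two_mul]
  have h2 : D.qi i * D.qi i - 1 ≠ 0 := by
    rw [← h1]; exact sub_ne_zero.2 (D.q_pow_ne_one i)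
  have h3 : D.qi i - (D.qi i)⁻¹ = (D.qi i * D.qi i - 1) * (D.qi i)⁻¹ := by
    field_simp
  rw [h1, h3, mul_inv, inv_inv, mul_comm]

/-- The double of a Borel pairing satisfies the relations of the presented algebra. -/
lemma dRelations (h : IsBorelPairing D P e κ κ' f τ τ') :
    DRelations D (fun i => P.inl (e i)) (fun i => D.qi i • P.inr (f i))
    (fun i => P.inl (κ i)) (fun i => P.inl (κ' i)) (fun i => P.inr (τ i))
    (fun i => P.inr (τ' i)) where
  pos := h.pos.rel.map P.inl
  neg := (h.neg.rel.map P.inr).smul D.qi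
  K_Kt i j := by
    rw [P.inr_mul_inl, h.cross_κ_τ, P.inl_mul_inr]
    rfl
  K_F i j := by
    have hc : P.inr (f j) * P.inl (κ i) =
        D.q ^ (D.d i * D.a i j) • (P.inl (κ i) * P.inr (f j)) := by
      rw [P.inr_mul_inl, h.cross_κ_f, P.inl_mul_inr]
      rfl
    rw [smul_mul_assoc, hc, mul_smul_comm, smul_comm (D.qi j), zpow_neg,
      inv_smul_smul₀ (zpow_ne_zero _ D.q_ne_zero)]
  Kt_E i j := by
    rw [P.inr_mul_inl, h.cross_e_τ, P.inl_mul_inr, D.symm]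
    rfl
  E_F i j := by
    have hc : P.inr (f j) * P.inl (e i) = P.inl (e i) * P.inr (f j) +
        (if i = j then (D.q ^ (2 * D.d i) - 1)⁻¹ else 0) • (P.inr (τ' j) - P.inl (κ i)) := by
      rw [P.inr_mul_inl, h.cross_e_f, P.inl_mul_inr]
      rfl
    rw [mul_smul_comm, smul_mul_assoc, hc]
    split_ifs with hij
    · subst hij
      rw [← smul_sub, sub_add_cancel_left, ← smul_neg, neg_sub, smul_smul, Datum.qi_mul_inv]
    · simp

end IsBorelPairing

namespace Borel

variable {D : Datum k n}

lemma adjoin_top (η : ℤ) :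
    Algebra.adjoin k (Set.range (E (D := D) (η := η)) ∪ (Set.range K ∪ Set.range Kinv)) = ⊤ := by
  rw [← range_lift (relations D η), eq_top_iff]
  rintro x -
  have : lift (relations D η) = AlgHom.id k _ :=
    hom_ext (fun i => lift_E _ i) (fun i => lift_K _ i) (fun i => lift_Kinv _ i)
  exact ⟨x, DFunLike.congr_fun this x⟩

lemma posGens : PosGens D (H := Borel D 1) E K Kinv where
  rel := relations D 1
  comul_e i := lift_E _ i
  comul_κ i := lift_K _ i
  counit_e i := lift_E _ i
  counit_κ i := lift_K _ i
  counit_κ' i := lift_Kinv _ i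
  adjoin := adjoin_top 1

lemma negGens : NegGens D (H' := Borel D (-1)) E K Kinv where
  rel := relations D (-1)
  comul_f i := lift_E _ i
  comul_τ i := lift_K _ i
  comul_τ' i := lift_Kinv _ i
  counit_f i := lift_E _ i
  counit_τ i := lift_K _ i
  counit_τ' i := lift_Kinv _ i
  adjoin := adjoin_top (-1)

lemma genValues_pairing : GenValues D 1 (pairing D) E K Kinv E K Kinv where
  e_f i j := by rw [pairing_E_E, Int.cast_one, one_mul]
  κ_f := pairing_K_E
  κ'_f := pairing_Kinv_E
  e_τ := pairing_E_K
  e_τ' := pairing_E_Kinv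
  κ_τ i j := by rw [pairing_K_K, one_mul]
  κ_τ' i j := by rw [pairing_K_Kinv, one_mul]
  κ'_τ i j := by rw [pairing_Kinv_K, one_mul]
  κ'_τ' i j := by rw [pairing_Kinv_Kinv, one_mul]

lemma isBorelPairing : IsBorelPairing D (skewPairing D) E K Kinv E K Kinv where
  pos := posGens
  neg := negGens
  φ_val := genValues_pairing
  ψ_val :=
    { e_f := fun i j => by
        change pairing D (S D (E i)) (E j) = _
        rw [S_E, map_neg, LinearMap.neg_apply, pairing_mul_left, negGens.comul_f]
        simp [pairing_Kinv_E, pairing_E_E, pairing_one_right, posGens.counit_κ']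
        split_ifs <;> simp
      κ_f := fun i j => by
        change pairing D (S D (K i)) (E j) = _
        rw [S_K, pairing_Kinv_E]
      κ'_f := fun i j => by
        change pairing D (S D (Kinv i)) (E j) = _
        rw [S_Kinv, pairing_K_E]
      e_τ := fun i j => by
        change pairing D (S D (E i)) (K j) = _
        rw [S_E, map_neg, LinearMap.neg_apply, pairing_mul_left, negGens.comul_τ]
        simp [pairing_E_K]
      e_τ' := fun i j => by
        change pairing D (S D (E i)) (Kinv j) = _
        rw [S_E, map_neg, LinearMap.neg_apply, pairing_mul_left, negGens.comul_τ']
        simp [pairing_E_Kinv]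
      κ_τ := fun i j => by
        change pairing D (S D (K i)) (K j) = _
        rw [S_K, pairing_Kinv_K, neg_one_mul]
      κ_τ' := fun i j => by
        change pairing D (S D (K i)) (Kinv j) = _
        rw [S_K, pairing_Kinv_Kinv, neg_one_mul, neg_neg]
      κ'_τ := fun i j => by
        change pairing D (S D (Kinv i)) (K j) = _
        rw [S_Kinv, pairing_K_K, neg_one_mul, neg_neg]
      κ'_τ' := fun i j => by
        change pairing D (S D (Kinv i)) (Kinv j) = _
        rw [S_Kinv, pairing_K_Kinv, neg_one_mul] }

end Borel

end Presentation

/-! ### The Borel algebras embed into the quantized enveloping algebra -/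

section Embedding

variable {k : Type u} [Field k] {n : ℕ} {D : Datum k n}

namespace DRelations

variable {B : Type v} [Ring B] [Algebra k B] {e f κ κ' τ τ' : Fin n → B}

lemma commute_inv {c g g' : B} (h₁ : g * g' = 1) (h₂ : g' * g = 1) (h : Commute c g) :
    Commute c g' :=
  Commute.units_inv_right (u := ⟨g, g', h₁, h₂⟩) h

lemma Kinv_F (h : DRelations D e f κ κ' τ τ') (i j : Fin n) :
    κ' i * f j = D.q ^ (D.d i * D.a i j) • (f j * κ' i) := by
  have := URelations.inv_comm (zpow_ne_zero _ D.q_ne_zero) (h.pos.K_Kinv i) (h.pos.Kinv_K i)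
    (h.K_F i j)
  rwa [← zpow_neg, neg_neg] at this

/-- The elements `K_i⁻¹ K̃_i` commute with all generators: `K_i` and `K̃_i` act on them by the same
character. -/
lemma commute_E (h : DRelations D e f κ κ' τ τ') (i j : Fin n) : Commute (κ' i * τ i) (e j) := by
  rw [Commute, SemiconjBy, mul_assoc, h.Kt_E, mul_smul_comm, ← mul_assoc (κ' i), h.pos.Kinv_E,
    smul_mul_assoc, smul_smul, ← zpow_add₀ D.q_ne_zero, mul_assoc (e j)]
  simp

lemma commute_F (h : DRelations D e f κ κ' τ τ') (i j : Fin n) : Commute (κ' i * τ i) (f j) := by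
  rw [Commute, SemiconjBy, mul_assoc, h.neg.K_E, mul_smul_comm, ← mul_assoc (κ' i), h.Kinv_F,
    smul_mul_assoc, smul_smul, ← zpow_add₀ D.q_ne_zero, mul_assoc (f j)]
  simp

lemma commute_K (h : DRelations D e f κ κ' τ τ') (i j : Fin n) : Commute (κ' i * τ i) (κ j) :=
  Commute.mul_left (h.pos.Kinv_comm_K i j) (h.K_Kt j i).symm

lemma commute_Kinv (h : DRelations D e f κ κ' τ τ') (i j : Fin n) : Commute (κ' i * τ i) (κ' j) :=
  commute_inv (h.pos.K_Kinv j) (h.pos.Kinv_K j) (h.commute_K i j)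

lemma commute_Kt (h : DRelations D e f κ κ' τ τ') (i j : Fin n) : Commute (κ' i * τ i) (τ j) :=
  Commute.mul_left (commute_inv (h.pos.K_Kinv i) (h.pos.Kinv_K i) (h.K_Kt i j).symm).symm
    (h.neg.K_K i j)

lemma commute_Ktinv (h : DRelations D e f κ κ' τ τ') (i j : Fin n) :
    Commute (κ' i * τ i) (τ' j) :=
  commute_inv (h.neg.K_Kinv j) (h.neg.Kinv_K j) (h.commute_Kt i j)

/-- When `K_i` and `K̃_i` are identified, the relations become those of `U_q`. -/
lemma uRelations {C : Type w} [Ring C] [Algebra k C] (h : DRelations D e f κ κ' τ τ')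
    (g : B →ₐ[k] C) (hg : ∀ i, g (τ i) = g (κ i)) :
    URelations D (fun i => g (e i)) (fun i => g (f i)) (fun i => g (κ i)) (fun i => g (κ' i)) where
  K_K := (h.pos.map g).K_K
  K_Kinv := (h.pos.map g).K_Kinv
  Kinv_K := (h.pos.map g).Kinv_K
  K_E i j := by simpa only [one_mul] using (h.pos.map g).K_E i j
  K_F i j := by rw [← map_mul, h.K_F, map_smul, map_mul]
  E_F i j := by
    have h' : g (τ' i) = g (κ' i) := by
      have h₁ : g (τ' i) * g (κ i) = 1 := by rw [← hg, ← map_mul, h.neg.Kinv_K, map_one]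
      have h₂ : g (κ i) * g (κ' i) = 1 := by rw [← map_mul, h.pos.K_Kinv, map_one]
      exact left_inv_eq_right_inv h₁ h₂
    rw [← map_mul, ← map_mul, ← map_sub, h.E_F]
    split_ifs
    · rw [map_smul, map_sub, h']
    · exact map_zero g
  serre_E := (h.pos.map g).serre_E
  serre_F := (h.neg.map g).serre_E

end DRelations

namespace Borel

variable (D) in
/-- The double of the pairing of the two Borel algebras. -/
abbrev dbl : Type u := (skewPairing D).Double

/-- The central element `K_i⁻¹ K̃_i` of the double. -/
def central (i : Fin n) : dbl D := (skewPairing D).inl (Kinv i) * (skewPairing D).inr (K i)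

lemma central_commute (i : Fin n) (z : dbl D) : Commute (central i) z := by
  have h := (isBorelPairing (D := D)).dRelations
  have hl (x : Borel D 1) : Commute (central i) ((skewPairing D).inl x) := by
    induction x using induction with
    | hE j => exact h.commute_E i j
    | hK j => exact h.commute_K i j
    | hKinv j => exact h.commute_Kinv i j
    | halg c => rw [AlgHom.commutes]; exact (Algebra.commutes c _).symm
    | hadd x y hx hy => rw [map_add]; exact hx.add_right hy
    | hmul x y hx hy => rw [map_mul]; exact hx.mul_right hy
  have hr (y : Borel D (-1)) : Commute (central i) ((skewPairing D).inr y) := by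
    induction y using induction with
    | hE j =>
      have := (h.commute_F i j).smul_right (D.qi j)⁻¹
      rwa [inv_smul_smul₀ (URelations.qi_ne_zero j)] at this
    | hK j => exact h.commute_Kt i j
    | hKinv j => exact h.commute_Ktinv i j
    | halg c => rw [AlgHom.commutes]; exact (Algebra.commutes c _).symm
    | hadd x y hx hy => rw [map_add]; exact hx.add_right hy
    | hmul x y hx hy => rw [map_mul]; exact hx.mul_right hy
  induction z using SkewPairing.double_induction with
  | zero => exact Commute.zero_right _
  | add x y hx hy => exact hx.add_right hy
  | tmul x y =>
    rw [← SkewPairing.inl_mul_inr]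
    exact (hl x).mul_right (hr y)

variable (D) in
/-- The ideal of the double that identifies `K_i` and `K̃_i`. -/
def glueIdeal : Ideal (dbl D) := Ideal.span (Set.range fun i => central i - 1)

instance : (glueIdeal D).IsTwoSided where
  mul_mem_of_left := by
    intro a b ha
    induction ha using Submodule.span_induction with
    | mem x hx =>
      obtain ⟨i, rfl⟩ := hx
      have : Commute (central i - 1) b :=
        (central_commute i b).sub_left (Commute.one_left b)
      simp only
      rw [this.eq]
      exact Ideal.mul_mem_left _ _ (Ideal.subset_span ⟨i, rfl⟩)
    | zero => rw [zero_mul]; exact zero_mem _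
    | add x y _ _ hx hy => rw [add_mul]; exact add_mem hx hy
    | smul c x _ hx => rw [smul_eq_mul, mul_assoc]; exact Ideal.mul_mem_left _ _ hx

variable (D) in
/-- The quotient map of the double by `glueIdeal D`. -/
def glue : dbl D →ₐ[k] dbl D ⧸ glueIdeal D := Ideal.Quotient.mkₐ k (glueIdeal D)

lemma glue_eq_zero_iff (z : dbl D) : glue D z = 0 ↔ z ∈ glueIdeal D :=
  Ideal.Quotient.eq_zero_iff_mem

lemma glue_Kt (i : Fin n) : glue D ((skewPairing D).inr (K i)) =
    glue D ((skewPairing D).inl (K i)) := by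
  rw [← sub_eq_zero, ← map_sub, glue_eq_zero_iff]
  have : (skewPairing D).inr (K i) - (skewPairing D).inl (K i) =
      (skewPairing D).inl (K i) * (central i - 1) := by
    rw [central, mul_sub, mul_one, ← mul_assoc, ← map_mul, K_mul_Kinv, map_one, one_mul]
  rw [this]
  exact Ideal.mul_mem_left _ _ (Ideal.subset_span ⟨i, rfl⟩)

lemma glue_Ktinv (i : Fin n) : glue D ((skewPairing D).inr (Kinv i)) =
    glue D ((skewPairing D).inl (Kinv i)) := by
  refine left_inv_eq_right_inv (a := glue D ((skewPairing D).inl (K i))) ?_ ?_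
  · rw [← glue_Kt, ← map_mul, ← map_mul, Kinv_mul_K, map_one, map_one]
  · rw [← map_mul, ← map_mul, K_mul_Kinv, map_one, map_one]

variable (D) in
/-- The homomorphism from `U_q` to the quotient of the double. -/
def toGlue : Uq D →ₐ[k] dbl D ⧸ glueIdeal D :=
  Uq.lift ((isBorelPairing (D := D)).dRelations.uRelations (glue D) glue_Kt)

/-- A linear map that does not see the central elements vanishes on `glueIdeal D`. -/
lemma eq_zero_of_mem_glueIdeal {M : Type*} [AddCommGroup M] [Module k M] (r : dbl D →ₗ[k] M)
    (hr : ∀ x y i, r ((skewPairing D).tmul (x * Kinv i) (K i * y)) = r ((skewPairing D).tmul x y))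
    {z : dbl D} (hz : z ∈ glueIdeal D) : r z = 0 := by
  have hc (i : Fin n) (z : dbl D) : r (z * (central i - 1)) = 0 := by
    induction z using SkewPairing.double_induction with
    | zero => rw [zero_mul, map_zero]
    | add x y hx hy => rw [add_mul, map_add, hx, hy, add_zero]
    | tmul x y =>
      have : (skewPairing D).tmul x y * central i =
          (skewPairing D).tmul (x * Kinv i) (K i * y) := by
        rw [← (skewPairing D).inl_mul_inr, ← (skewPairing D).inl_mul_inr, mul_assoc,
          ← (central_commute i _).eq, central, map_mul, map_mul]
        simp only [mul_assoc]
      rw [mul_sub, mul_one, map_sub, this, hr, sub_self]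
  suffices H : ∀ d, r (d * z) = 0 by simpa using H 1
  induction hz using Submodule.span_induction with
  | mem x hx =>
    obtain ⟨i, rfl⟩ := hx
    exact fun d => hc i d
  | zero => exact fun d => by rw [mul_zero, map_zero]
  | add x y _ _ hx hy => exact fun d => by rw [mul_add, map_add, hx, hy, add_zero]
  | smul c x _ hx => exact fun d => by rw [smul_eq_mul, ← mul_assoc, hx]

lemma relations_torus (η η' : ℤ) :
    BorelRelations D η (B := Borel D η') (fun _ => 0) K Kinv where
  K_K := (relations D η').K_K
  K_Kinv := (relations D η').K_Kinv
  Kinv_K := (relations D η').Kinv_K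
  K_E i j := by simp
  serre_E i j hij := by simp [serre]

variable (D) in
/-- The homomorphism between Borel algebras with `E_i ↦ 0` and `K_i ↦ K_i`. -/
def torusHom (η η' : ℤ) : Borel D η →ₐ[k] Borel D η' := lift (relations_torus η η')

/-- The map `x ⊗ y ↦ x p(y)`, where `p` kills the `F_j` and sends `K̃_j` to `K_j`, is a left inverse
of `x ↦ x ⊗ 1` and kills the ideal generated by the `K_i⁻¹ K̃_i - 1`. -/
lemma glue_inl_injective : Function.Injective ((glue D).comp (skewPairing D).inl) := by
  rw [injective_iff_map_eq_zero]
  intro x hx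
  let r : dbl D →ₗ[k] Borel D 1 := (LinearMap.mul' k (Borel D 1) ∘ₗ
    (torusHom D (-1) 1).toLinearMap.lTensor (Borel D 1) :)
  have hr (x y) : r ((skewPairing D).tmul x y) = x * torusHom D (-1) 1 y := rfl
  have := eq_zero_of_mem_glueIdeal r (fun x y i => by
    rw [hr, hr, map_mul, torusHom, lift_K, mul_assoc, ← mul_assoc (Kinv i), Kinv_mul_K, one_mul])
    ((glue_eq_zero_iff _).1 hx)
  change r ((skewPairing D).tmul x 1) = 0 at this
  rwa [hr, map_one, mul_one] at this

/-- The map `x ⊗ y ↦ p(x) y`, where `p` kills the `E_j` and sends `K_j` to `K̃_j`, is a left inverse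
of `y ↦ 1 ⊗ y` and kills the ideal generated by the `K_i⁻¹ K̃_i - 1`. -/
lemma glue_inr_injective : Function.Injective ((glue D).comp (skewPairing D).inr) := by
  rw [injective_iff_map_eq_zero]
  intro y hy
  let r : dbl D →ₗ[k] Borel D (-1) := (LinearMap.mul' k (Borel D (-1)) ∘ₗ
    (torusHom D 1 (-1)).toLinearMap.rTensor (Borel D (-1)) :)
  have hr (x y) : r ((skewPairing D).tmul x y) = torusHom D 1 (-1) x * y := rfl
  have := eq_zero_of_mem_glueIdeal r (fun x y i => by
    rw [hr, hr, map_mul, torusHom, lift_Kinv, mul_assoc, ← mul_assoc (Kinv i), Kinv_mul_K, one_mul])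
    ((glue_eq_zero_iff _).1 hy)
  change r ((skewPairing D).tmul 1 y) = 0 at this
  rwa [hr, map_one, one_mul] at this

lemma relations_pos : BorelRelations D 1 (B := Uq D) Uq.E Uq.K Uq.Kinv where
  K_K := Uq.relations.K_K
  K_Kinv := Uq.relations.K_Kinv
  Kinv_K := Uq.relations.Kinv_K
  K_E i j := by rw [one_mul]; exact Uq.relations.K_E i j
  serre_E := Uq.relations.serre_E

lemma relations_neg : BorelRelations D (-1) (B := Uq D) Uq.F Uq.K Uq.Kinv where
  K_K := Uq.relations.K_K
  K_Kinv := Uq.relations.K_Kinv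
  Kinv_K := Uq.relations.Kinv_K
  K_E i j := by rw [neg_one_mul]; exact Uq.relations.K_F i j
  serre_E := Uq.relations.serre_F

/-- The quotient of the double in which `K_i = K̃_i` detects the elements of the Borel algebra. -/
lemma lift_pos_injective : Function.Injective (lift (relations_pos (D := D))) := by
  refine Function.Injective.of_comp (f := toGlue D) ?_
  have : (toGlue D).comp (lift relations_pos) = (glue D).comp (skewPairing D).inl :=
    hom_ext (fun i => by simp [toGlue]) (fun i => by simp [toGlue]) (fun i => by simp [toGlue])
  rw [← AlgHom.coe_comp, this]
  exact glue_inl_injective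

/-- The endomorphism of a Borel algebra that scales the generators `E_i` by `c_i`. -/
def scaleHom (η : ℤ) (c : Fin n → k) : Borel D η →ₐ[k] Borel D η :=
  lift ((relations D η).smul c)

lemma scaleHom_injective {η : ℤ} {c : Fin n → k} (hc : ∀ i, c i ≠ 0) :
    Function.Injective (scaleHom (D := D) η c) := by
  have : (scaleHom η fun i => (c i)⁻¹).comp (scaleHom (D := D) η c) = AlgHom.id k _ :=
    hom_ext (fun i => by simp [scaleHom, hc]) (fun i => by simp [scaleHom])
      (fun i => by simp [scaleHom])
  exact Function.LeftInverse.injective (DFunLike.congr_fun this)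

lemma lift_neg_injective : Function.Injective (lift (relations_neg (D := D))) := by
  refine Function.Injective.of_comp (f := toGlue D) ?_
  have : (toGlue D).comp (lift relations_neg) =
      ((glue D).comp (skewPairing D).inr).comp (scaleHom (-1) D.qi) :=
    hom_ext (fun i => by simp [toGlue, scaleHom])
      (fun i => by simp [toGlue, scaleHom, glue_Kt])
      (fun i => by
        simp only [toGlue, scaleHom, AlgHom.comp_apply, lift_Kinv, Uq.lift_Kinv]
        exact glue_Ktinv i |>.symm)
  rw [← AlgHom.coe_comp, this, AlgHom.coe_comp]
  exact glue_inr_injective.comp (scaleHom_injective URelations.qi_ne_zero)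

end Borel

end Embedding

/-! ### The Hopf subalgebras as Borel algebras -/

section HopfSubalgebras

variable {k : Type u} [Field k] {n : ℕ} {D : Datum k n}

namespace Uq

open Borel (relations_pos relations_neg)
open IsHopfSubalgebra (map_val_injective)

lemma map_comul_geZero (x : geZero D) :
    Algebra.TensorProduct.map (geZero D).val (geZero D).val (Coalgebra.comul (R := k) x) =
      comulHom D x :=
  isHopfSubalgebra_geZero.map_comulHom x

lemma map_comul_leZero (x : leZero D) :
    Algebra.TensorProduct.map (leZero D).val (leZero D).val (Coalgebra.comul (R := k) x) =
      comulHom D x :=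
  isHopfSubalgebra_leZero.map_comulHom x

lemma comul_geE (i : Fin n) : Coalgebra.comul (R := k) (geE i : geZero D) =
    geE i ⊗ₜ 1 + geK i ⊗ₜ geE i := by
  apply map_val_injective
  rw [map_comul_geZero]
  simp [geE, geK, comulHom]

lemma comul_geK (i : Fin n) : Coalgebra.comul (R := k) (geK i : geZero D) =
    geK i ⊗ₜ geK i := by
  apply map_val_injective
  rw [map_comul_geZero]
  simp [geK, comulHom]

lemma comul_geKinv (i : Fin n) : Coalgebra.comul (R := k) (geKinv i : geZero D) =
    geKinv i ⊗ₜ geKinv i := by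
  apply map_val_injective
  rw [map_comul_geZero]
  simp [geKinv, comulHom]

lemma comul_leF (i : Fin n) : Coalgebra.comul (R := k) (leF i : leZero D) =
    leF i ⊗ₜ leKinv i + 1 ⊗ₜ leF i := by
  apply map_val_injective
  rw [map_comul_leZero]
  simp [leF, leKinv, comulHom]

lemma comul_leK (i : Fin n) : Coalgebra.comul (R := k) (leK i : leZero D) =
    leK i ⊗ₜ leK i := by
  apply map_val_injective
  rw [map_comul_leZero]
  simp [leK, comulHom]

lemma comul_leKinv (i : Fin n) : Coalgebra.comul (R := k) (leKinv i : leZero D) =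
    leKinv i ⊗ₜ leKinv i := by
  apply map_val_injective
  rw [map_comul_leZero]
  simp [leKinv, comulHom]

lemma counit_ge (x : geZero D) : Coalgebra.counit (R := k) x = counitHom D x := rfl
lemma counit_le (x : leZero D) : Coalgebra.counit (R := k) x = counitHom D x := rfl

lemma counit_geE (i : Fin n) : Coalgebra.counit (R := k) (geE i : geZero D) = 0 := by
  simp [counit_ge, geE, counitHom]
lemma counit_geK (i : Fin n) : Coalgebra.counit (R := k) (geK i : geZero D) = 1 := by
  simp [counit_ge, geK, counitHom]
lemma counit_geKinv (i : Fin n) : Coalgebra.counit (R := k) (geKinv i : geZero D) = 1 := by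
  simp [counit_ge, geKinv, counitHom]
lemma counit_leF (i : Fin n) : Coalgebra.counit (R := k) (leF i : leZero D) = 0 := by
  simp [counit_le, leF, counitHom]
lemma counit_leK (i : Fin n) : Coalgebra.counit (R := k) (leK i : leZero D) = 1 := by
  simp [counit_le, leK, counitHom]
lemma counit_leKinv (i : Fin n) : Coalgebra.counit (R := k) (leKinv i : leZero D) = 1 := by
  simp [counit_le, leKinv, counitHom]

variable (D) in
lemma relations_ge : BorelRelations D 1 (B := geZero D) geE geK geKinv where
  K_K i j := Subtype.ext (relations.K_K i j)
  K_Kinv i := Subtype.ext (relations.K_Kinv i)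
  Kinv_K i := Subtype.ext (relations.Kinv_K i)
  K_E i j := Subtype.ext (relations_pos.K_E i j)
  serre_E i j hij := Subtype.ext
    ((serre_map (geZero D).val _ _ _ _).trans (relations.serre_E i j hij))

variable (D) in
lemma relations_le : BorelRelations D (-1) (B := leZero D) leF leK leKinv where
  K_K i j := Subtype.ext (relations.K_K i j)
  K_Kinv i := Subtype.ext (relations.K_Kinv i)
  Kinv_K i := Subtype.ext (relations.Kinv_K i)
  K_E i j := Subtype.ext (relations_neg.K_E i j)
  serre_E i j hij := Subtype.ext
    ((serre_map (leZero D).val _ _ _ _).trans (relations.serre_F i j hij))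

end Uq

open Uq

variable (D) in
/-- The algebra `U_q^{≥0}` is the Borel algebra with `η = 1`. -/
def posEquiv : Borel D 1 ≃ₐ[k] geZero D :=
  AlgEquiv.ofBijective (Borel.lift (relations_ge D)) <| by
    have h : (geZero D).val.comp (Borel.lift (relations_ge D)) = Borel.lift Borel.relations_pos :=
      Borel.hom_ext (fun i => by simp [geE]) (fun i => by simp [geK]) (fun i => by simp [geKinv])
    constructor
    · apply Function.Injective.of_comp (f := (geZero D).val)
      rw [← AlgHom.coe_comp, h]
      exact Borel.lift_pos_injective
    · rintro ⟨y, hy⟩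
      have hy' := hy
      rw [geZero, ← Borel.range_lift Borel.relations_pos] at hy'
      obtain ⟨x, rfl⟩ := hy'
      exact ⟨x, Subtype.ext (DFunLike.congr_fun h x)⟩

variable (D) in
/-- The algebra `U_q^{≤0}` is the Borel algebra with `η = -1`. -/
def negEquiv : Borel D (-1) ≃ₐ[k] leZero D :=
  AlgEquiv.ofBijective (Borel.lift (relations_le D)) <| by
    have h : (leZero D).val.comp (Borel.lift (relations_le D)) = Borel.lift Borel.relations_neg :=
      Borel.hom_ext (fun i => by simp [leF]) (fun i => by simp [leK]) (fun i => by simp [leKinv])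
    constructor
    · apply Function.Injective.of_comp (f := (leZero D).val)
      rw [← AlgHom.coe_comp, h]
      exact Borel.lift_neg_injective
    · rintro ⟨y, hy⟩
      have hy' := hy
      rw [leZero, ← Borel.range_lift Borel.relations_neg] at hy'
      obtain ⟨x, rfl⟩ := hy'
      exact ⟨x, Subtype.ext (DFunLike.congr_fun h x)⟩

@[simp] lemma posEquiv_E (i : Fin n) : posEquiv D (Borel.E i) = geE i := Borel.lift_E _ i
@[simp] lemma posEquiv_K (i : Fin n) : posEquiv D (Borel.K i) = geK i := Borel.lift_K _ i
@[simp] lemma posEquiv_Kinv (i : Fin n) : posEquiv D (Borel.Kinv i) = geKinv i :=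
  Borel.lift_Kinv _ i
@[simp] lemma negEquiv_E (i : Fin n) : negEquiv D (Borel.E i) = leF i := Borel.lift_E _ i
@[simp] lemma negEquiv_K (i : Fin n) : negEquiv D (Borel.K i) = leK i := Borel.lift_K _ i
@[simp] lemma negEquiv_Kinv (i : Fin n) : negEquiv D (Borel.Kinv i) = leKinv i :=
  Borel.lift_Kinv _ i

@[simp] lemma posEquiv_symm_E (i : Fin n) : (posEquiv D).symm (geE i) = Borel.E i := by
  rw [AlgEquiv.symm_apply_eq, posEquiv_E]
@[simp] lemma posEquiv_symm_K (i : Fin n) : (posEquiv D).symm (geK i) = Borel.K i := by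
  rw [AlgEquiv.symm_apply_eq, posEquiv_K]
@[simp] lemma posEquiv_symm_Kinv (i : Fin n) : (posEquiv D).symm (geKinv i) = Borel.Kinv i := by
  rw [AlgEquiv.symm_apply_eq, posEquiv_Kinv]
@[simp] lemma negEquiv_symm_E (i : Fin n) : (negEquiv D).symm (leF i) = Borel.E i := by
  rw [AlgEquiv.symm_apply_eq, negEquiv_E]
@[simp] lemma negEquiv_symm_K (i : Fin n) : (negEquiv D).symm (leK i) = Borel.K i := by
  rw [AlgEquiv.symm_apply_eq, negEquiv_K]
@[simp] lemma negEquiv_symm_Kinv (i : Fin n) : (negEquiv D).symm (leKinv i) = Borel.Kinv i := by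
  rw [AlgEquiv.symm_apply_eq, negEquiv_Kinv]

lemma comul_posEquiv_symm (x : geZero D) : Coalgebra.comul (R := k) ((posEquiv D).symm x) =
    Algebra.TensorProduct.map (posEquiv D).symm.toAlgHom (posEquiv D).symm.toAlgHom
      (Coalgebra.comul (R := k) x) := by
  obtain ⟨x, rfl⟩ := (posEquiv D).surjective x
  rw [AlgEquiv.symm_apply_apply]
  have : Borel.comulPos D = ((Algebra.TensorProduct.map (posEquiv D).symm.toAlgHom
      (posEquiv D).symm.toAlgHom).comp (Bialgebra.comulAlgHom k (geZero D))).comp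
      (posEquiv D).toAlgHom :=
    Borel.hom_ext (fun i => by simp [Borel.comulPos, comul_geE])
      (fun i => by simp [Borel.comulPos, comul_geK])
      (fun i => by simp [Borel.comulPos, comul_geKinv])
  exact DFunLike.congr_fun this x

lemma comul_negEquiv_symm (x : leZero D) : Coalgebra.comul (R := k) ((negEquiv D).symm x) =
    Algebra.TensorProduct.map (negEquiv D).symm.toAlgHom (negEquiv D).symm.toAlgHom
      (Coalgebra.comul (R := k) x) := by
  obtain ⟨x, rfl⟩ := (negEquiv D).surjective x
  rw [AlgEquiv.symm_apply_apply]
  have : Borel.comulNeg D = ((Algebra.TensorProduct.map (negEquiv D).symm.toAlgHom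
      (negEquiv D).symm.toAlgHom).comp (Bialgebra.comulAlgHom k (leZero D))).comp
      (negEquiv D).toAlgHom :=
    Borel.hom_ext (fun i => by simp [Borel.comulNeg, comul_leF])
      (fun i => by simp [Borel.comulNeg, comul_leK])
      (fun i => by simp [Borel.comulNeg, comul_leKinv])
  exact DFunLike.congr_fun this x

lemma counit_posEquiv_symm (x : geZero D) : Coalgebra.counit (R := k) ((posEquiv D).symm x) =
    Coalgebra.counit (R := k) x := by
  obtain ⟨x, rfl⟩ := (posEquiv D).surjective x
  rw [AlgEquiv.symm_apply_apply]
  have : Borel.counitHom D 1 = (Bialgebra.counitAlgHom k (geZero D)).comp (posEquiv D).toAlgHom :=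
    Borel.hom_ext (fun i => by simp [Borel.counitHom, counit_geE])
      (fun i => by simp [Borel.counitHom, counit_geK])
      (fun i => by simp [Borel.counitHom, counit_geKinv])
  exact DFunLike.congr_fun this x

lemma counit_negEquiv_symm (x : leZero D) : Coalgebra.counit (R := k) ((negEquiv D).symm x) =
    Coalgebra.counit (R := k) x := by
  obtain ⟨x, rfl⟩ := (negEquiv D).surjective x
  rw [AlgEquiv.symm_apply_apply]
  have : Borel.counitHom D (-1) =
      (Bialgebra.counitAlgHom k (leZero D)).comp (negEquiv D).toAlgHom :=
    Borel.hom_ext (fun i => by simp [Borel.counitHom, counit_leF])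
      (fun i => by simp [Borel.counitHom, counit_leK])
      (fun i => by simp [Borel.counitHom, counit_leKinv])
  exact DFunLike.congr_fun this x

variable (D) in
lemma posGens_ge : PosGens D (H := geZero D) geE geK geKinv where
  rel := relations_ge D
  comul_e := comul_geE
  comul_κ := comul_geK
  counit_e := counit_geE
  counit_κ := counit_geK
  counit_κ' := counit_geKinv
  adjoin := by
    rw [← Borel.range_lift (relations_ge D), AlgHom.range_eq_top]
    exact (posEquiv D).surjective

variable (D) in
lemma negGens_le : NegGens D (H' := leZero D) leF leK leKinv where
  rel := relations_le D
  comul_f := comul_leF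
  comul_τ := comul_leK
  comul_τ' := comul_leKinv
  counit_f := counit_leF
  counit_τ := counit_leK
  counit_τ' := counit_leKinv
  adjoin := by
    rw [← Borel.range_lift (relations_le D), AlgHom.range_eq_top]
    exact (negEquiv D).surjective

variable (D) in
/-- The pairing of the Borel algebras, as a pairing of `U_q^{≥0}` and `U_q^{≤0}`. -/
def lusztigPairing : geZero D →ₗ[k] leZero D →ₗ[k] k :=
  (Borel.pairing D).compl₁₂ (posEquiv D).symm.toLinearMap (negEquiv D).symm.toLinearMap

lemma lusztigPairing_apply (x : geZero D) (y : leZero D) :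
    lusztigPairing D x y = Borel.pairing D ((posEquiv D).symm x) ((negEquiv D).symm y) := rfl

lemma pairTensor_compl₁₂ {C₁ C₂ C₁' C₂' : Type*} [AddCommGroup C₁] [Module k C₁] [AddCommGroup C₂]
    [Module k C₂] [AddCommGroup C₁'] [Module k C₁'] [AddCommGroup C₂'] [Module k C₂']
    (φ : C₂ →ₗ[k] C₂' →ₗ[k] k) (g : C₁ →ₗ[k] C₂) (g' : C₁' →ₗ[k] C₂') (s : C₁ ⊗[k] C₁)
    (t : C₁' ⊗[k] C₁') :
    pairTensor (φ.compl₁₂ g g') s t =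
      pairTensor φ (TensorProduct.map g g s) (TensorProduct.map g' g' t) := by
  induction s with
  | zero => simp
  | add a b ha hb => simp only [map_add, LinearMap.add_apply, ha, hb]
  | tmul a b =>
    induction t with
    | zero => simp
    | add c d hc hd => simp only [map_add, hc, hd]
    | tmul c d => rfl

lemma lusztigPairing_one_left (y : leZero D) :
    lusztigPairing D 1 y = Coalgebra.counit (R := k) y := by
  rw [lusztigPairing_apply, map_one, Borel.pairing_one_left, counit_negEquiv_symm]

lemma lusztigPairing_one_right (x : geZero D) :
    lusztigPairing D x 1 = Coalgebra.counit (R := k) x := by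
  rw [lusztigPairing_apply, map_one, Borel.pairing_one_right, counit_posEquiv_symm]

lemma lusztigPairing_mul_left (x x' : geZero D) (y : leZero D) : lusztigPairing D (x * x') y =
    tensorPairing (lusztigPairing D) (x ⊗ₜ x') (Coalgebra.comul y) := by
  rw [lusztigPairing_apply, map_mul, Borel.pairing_mul_left, comul_negEquiv_symm]
  exact (pairTensor_compl₁₂ (Borel.pairing D) (posEquiv D).symm.toLinearMap
    (negEquiv D).symm.toLinearMap (x ⊗ₜ x') _).symm

lemma lusztigPairing_mul_right (x : geZero D) (y y' : leZero D) : lusztigPairing D x (y * y') =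
    tensorPairing (lusztigPairing D) (TensorProduct.comm k _ _ (Coalgebra.comul x)) (y ⊗ₜ y') := by
  rw [lusztigPairing_apply, map_mul, Borel.pairing_mul_right, comul_posEquiv_symm]
  refine Eq.trans ?_ (pairTensor_compl₁₂ (Borel.pairing D) (posEquiv D).symm.toLinearMap
    (negEquiv D).symm.toLinearMap _ (y ⊗ₜ y')).symm
  rw [TensorProduct.map_comm]
  rfl

lemma genValues_lusztigPairing :
    GenValues D 1 (lusztigPairing D) geE geK geKinv leF leK leKinv where
  e_f i j := by simpa [lusztigPairing_apply] using (Borel.genValues_pairing (D := D)).e_f i j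
  κ_f i j := by simpa [lusztigPairing_apply] using (Borel.genValues_pairing (D := D)).κ_f i j
  κ'_f i j := by simpa [lusztigPairing_apply] using (Borel.genValues_pairing (D := D)).κ'_f i j
  e_τ i j := by simpa [lusztigPairing_apply] using (Borel.genValues_pairing (D := D)).e_τ i j
  e_τ' i j := by simpa [lusztigPairing_apply] using (Borel.genValues_pairing (D := D)).e_τ' i j
  κ_τ i j := by simpa [lusztigPairing_apply] using (Borel.genValues_pairing (D := D)).κ_τ i j
  κ_τ' i j := by simpa [lusztigPairing_apply] using (Borel.genValues_pairing (D := D)).κ_τ' i j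
  κ'_τ i j := by simpa [lusztigPairing_apply] using (Borel.genValues_pairing (D := D)).κ'_τ i j
  κ'_τ' i j := by simpa [lusztigPairing_apply] using (Borel.genValues_pairing (D := D)).κ'_τ' i j

end HopfSubalgebras

/-! ### Hopf pairings and their values on generators -/

section HopfPairing

variable {k : Type u} [Field k]

section Antipode

variable {H : Type v} [Ring H] [HopfAlgebra k H]

open HopfAlgebra

variable (k) in
/-- The antipode reverses the comultiplication of `x`. -/
def AntipodeReverses (x : H) : Prop :=
  Coalgebra.comul (R := k) (antipode k x) =
    TensorProduct.comm k H H (TensorProduct.map (antipode k) (antipode k) (Coalgebra.comul x))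

lemma AntipodeReverses.mul {x y : H} (hx : AntipodeReverses k x) (hy : AntipodeReverses k y) :
    AntipodeReverses k (x * y) := by
  rw [AntipodeReverses] at *
  have key (s t : H ⊗[k] H) :
      TensorProduct.comm k H H (TensorProduct.map (antipode k) (antipode k) (s * t)) =
        TensorProduct.comm k H H (TensorProduct.map (antipode k) (antipode k) t) *
        TensorProduct.comm k H H (TensorProduct.map (antipode k) (antipode k) s) := by
    induction s with
    | zero => simp
    | add a b ha hb => simp only [add_mul, mul_add, map_add, ha, hb]
    | tmul a b =>
      induction t with
      | zero => simp
      | add c d hc hd => simp only [add_mul, mul_add, map_add, hc, hd]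
      | tmul c d => simp [antipode_mul_antidistrib]
  rw [antipode_mul_antidistrib, Bialgebra.comul_mul, hx, hy, Bialgebra.comul_mul, key]

lemma AntipodeReverses.add {x y : H} (hx : AntipodeReverses k x) (hy : AntipodeReverses k y) :
    AntipodeReverses k (x + y) := by
  rw [AntipodeReverses] at *
  simp only [map_add, hx, hy]

lemma AntipodeReverses.algebraMap (c : k) : AntipodeReverses k (algebraMap k H c) := by
  rw [AntipodeReverses, Algebra.algebraMap_eq_smul_one]
  simp only [map_smul, antipode_one, Bialgebra.comul_one, Algebra.TensorProduct.one_def,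
    TensorProduct.map_tmul, TensorProduct.comm_tmul]

variable [BijectiveAntipode k H]

lemma antipode_antipodeInv (x : H) : antipode k (antipodeInv k H x) = x :=
  LinearEquiv.apply_symm_apply (LinearEquiv.ofBijective (antipode k (A := H)) _) x

lemma antipodeInv_antipode (x : H) : antipodeInv k H (antipode k x) = x :=
  LinearEquiv.symm_apply_apply (LinearEquiv.ofBijective (antipode k (A := H)) _) x

lemma antipodeInv_eq {x y : H} (h : antipode k y = x) : antipodeInv k H x = y := by
  rw [← h, antipodeInv_antipode]

lemma antipodeInv_one : antipodeInv k H 1 = 1 := antipodeInv_eq antipode_one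

lemma antipodeInv_mul (x y : H) :
    antipodeInv k H (x * y) = antipodeInv k H y * antipodeInv k H x :=
  antipodeInv_eq (by simp only [antipode_mul_antidistrib, antipode_antipodeInv])

lemma counit_antipodeInv (x : H) :
    Coalgebra.counit (R := k) (antipodeInv k H x) = Coalgebra.counit (R := k) x := by
  rw [← counit_antipode (R := k), antipode_antipodeInv]

lemma comul_antipodeInv (h : ∀ x : H, AntipodeReverses k x) (x : H) :
    Coalgebra.comul (R := k) (antipodeInv k H x) = TensorProduct.comm k H H
      (TensorProduct.map (antipodeInv k H) (antipodeInv k H) (Coalgebra.comul x)) := by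
  obtain ⟨x, rfl⟩ : ∃ y, antipode k y = x := ⟨_, antipode_antipodeInv x⟩
  rw [h x, antipodeInv_antipode]
  generalize (Coalgebra.comul (R := k) x) = t
  induction t with
  | zero => simp
  | add a b ha hb => simpa only [map_add] using congrArg₂ (· + ·) ha hb
  | tmul a b => simp [antipodeInv_antipode]

end Antipode

section SkewPairing

variable {H : Type v} {H' : Type w} [Ring H] [HopfAlgebra k H] [Ring H'] [HopfAlgebra k H']
  [BijectiveAntipode k H']

/-- A pairing of Hopf algebras that is compatible with products and coproducts, together with the
opposite pairing `φ(x, S⁻¹(y))`. -/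
def SkewPairing.ofHopf (hS : ∀ y : H', AntipodeReverses k y) (φ : H →ₗ[k] H' →ₗ[k] k)
    (one_left : ∀ y, φ 1 y = Coalgebra.counit (R := k) y)
    (one_right : ∀ x, φ x 1 = Coalgebra.counit (R := k) x)
    (mul_left : ∀ x x' y, φ (x * x') y = tensorPairing φ (x ⊗ₜ x') (Coalgebra.comul y))
    (mul_right : ∀ x y y', φ x (y * y') =
      tensorPairing φ (TensorProduct.comm k H H (Coalgebra.comul x)) (y ⊗ₜ y')) :
    SkewPairing k H H' where
  φ := φ
  ψ := φ.compl₂ (antipodeInv k H')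
  one_left := one_left
  one_right := one_right
  mul_left := mul_left
  mul_right := mul_right
  one_left' y := by rw [LinearMap.compl₂_apply, one_left, counit_antipodeInv]
  one_right' x := by rw [LinearMap.compl₂_apply, antipodeInv_one, one_right]
  mul_left' x x' y := by
    rw [LinearMap.compl₂_apply, mul_left, comul_antipodeInv hS]
    generalize (Coalgebra.comul (R := k) y) = t
    induction t with
    | zero => simp
    | add a b ha hb => simp only [map_add, ha, hb]
    | tmul a b => exact mul_comm _ _
  mul_right' x y y' := by
    rw [LinearMap.compl₂_apply, antipodeInv_mul, mul_right]
    generalize (Coalgebra.comul (R := k) x) = t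
    induction t with
    | zero => simp
    | add a b ha hb => simp only [map_add, LinearMap.add_apply, ha, hb]
    | tmul a b => exact mul_comm _ _

end SkewPairing

section Extensionality

variable {n : ℕ} {D : Datum k n} {H : Type v} {H' : Type w} [Ring H] [Bialgebra k H] [Ring H']
  [Bialgebra k H'] {e κ κ' : Fin n → H} {f τ τ' : Fin n → H'}

/-- Two pairings agree on `x` and the elements `1, f_i, τ_i, τ'_i`. Their span is a
subcoalgebra, so that this property passes from `x` and `x'` to `x x'`. -/
structure AgreeAt (θ θ' : H →ₗ[k] H' →ₗ[k] k) (f τ τ' : Fin n → H') (x : H) : Prop where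
  one : θ x 1 = θ' x 1
  f : ∀ i, θ x (f i) = θ' x (f i)
  τ : ∀ i, θ x (τ i) = θ' x (τ i)
  τ' : ∀ i, θ x (τ' i) = θ' x (τ' i)

/-- Pairings are determined by their values on generators. The hypothesis `hmul` says how the
pairings of a product `x x'` with `1, f_i, τ_i, τ'_i` follow from those of `x` and `x'`. -/
lemma pairing_ext {η : ℤ} (hH : PosGens D e κ κ') (hH' : NegGens D f τ τ')
    {θ θ' : H →ₗ[k] H' →ₗ[k] k} (hθ : GenValues D η θ e κ κ' f τ τ')
    (hθ' : GenValues D η θ' e κ κ' f τ τ') (one_left : ∀ y, θ 1 y = θ' 1 y)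
    (one_right : ∀ x, θ x 1 = θ' x 1)
    (hmul : ∀ x x', AgreeAt θ θ' f τ τ' x → AgreeAt θ θ' f τ τ' x' →
      AgreeAt θ θ' f τ τ' (x * x'))
    (hmul' : ∀ y y', (∀ x, θ x y = θ' x y) → (∀ x, θ x y' = θ' x y') →
      ∀ x, θ x (y * y') = θ' x (y * y')) : θ = θ' := by
  have h (x : H) : AgreeAt θ θ' f τ τ' x := by
    induction x using adjoin_top_induction hH.adjoin with
    | he i => exact ⟨one_right _, fun j => by rw [hθ.e_f, hθ'.e_f],
        fun j => by rw [hθ.e_τ, hθ'.e_τ], fun j => by rw [hθ.e_τ', hθ'.e_τ']⟩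
    | hκ i => exact ⟨one_right _, fun j => by rw [hθ.κ_f, hθ'.κ_f],
        fun j => by rw [hθ.κ_τ, hθ'.κ_τ], fun j => by rw [hθ.κ_τ', hθ'.κ_τ']⟩
    | hκ' i => exact ⟨one_right _, fun j => by rw [hθ.κ'_f, hθ'.κ'_f],
        fun j => by rw [hθ.κ'_τ, hθ'.κ'_τ], fun j => by rw [hθ.κ'_τ', hθ'.κ'_τ']⟩
    | halg c =>
      simp only [Algebra.algebraMap_eq_smul_one]
      constructor <;> simp [one_left]
    | hadd x y hx hy =>
      exact ⟨one_right _, fun j => by simp only [map_add, LinearMap.add_apply, hx.f, hy.f],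
        fun j => by simp only [map_add, LinearMap.add_apply, hx.τ, hy.τ],
        fun j => by simp only [map_add, LinearMap.add_apply, hx.τ', hy.τ']⟩
    | hmul x y hx hy => exact hmul x y hx hy
  suffices ∀ y x, θ x y = θ' x y from LinearMap.ext fun x => LinearMap.ext fun y => this y x
  intro y
  induction y using adjoin_top_induction hH'.adjoin with
  | he i => exact fun x => (h x).f i
  | hκ i => exact fun x => (h x).τ i
  | hκ' i => exact fun x => (h x).τ' i
  | halg c => exact fun x => by rw [Algebra.algebraMap_eq_smul_one, map_smul, map_smul, one_right]
  | hadd x y hx hy => exact fun z => by rw [map_add, map_add, hx, hy]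
  | hmul y y' hy hy' => exact hmul' y y' hy hy'

lemma AgreeAt.pairTensor_comul {θ θ' : H →ₗ[k] H' →ₗ[k] k} (hH' : NegGens D f τ τ') {x x' : H}
    (hx : AgreeAt θ θ' f τ τ' x) (hx' : AgreeAt θ θ' f τ τ' x') :
    pairTensor θ (x ⊗ₜ x') (Coalgebra.comul 1) = pairTensor θ' (x ⊗ₜ x') (Coalgebra.comul 1) ∧
    (∀ i, pairTensor θ (x ⊗ₜ x') (Coalgebra.comul (f i)) =
      pairTensor θ' (x ⊗ₜ x') (Coalgebra.comul (f i))) ∧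
    (∀ i, pairTensor θ (x ⊗ₜ x') (Coalgebra.comul (τ i)) =
      pairTensor θ' (x ⊗ₜ x') (Coalgebra.comul (τ i))) ∧
    ∀ i, pairTensor θ (x ⊗ₜ x') (Coalgebra.comul (τ' i)) =
      pairTensor θ' (x ⊗ₜ x') (Coalgebra.comul (τ' i)) := by
  refine ⟨?_, fun i => ?_, fun i => ?_, fun i => ?_⟩
  · rw [Bialgebra.comul_one, Algebra.TensorProduct.one_def, pairTensor_tmul, pairTensor_tmul,
      hx.one, hx'.one]
  · rw [hH'.comul_f, map_add, map_add, pairTensor_tmul, pairTensor_tmul, pairTensor_tmul,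
      pairTensor_tmul, hx.one, hx.f, hx'.f, hx'.τ']
  · rw [hH'.comul_τ, pairTensor_tmul, pairTensor_tmul, hx.τ, hx'.τ]
  · rw [hH'.comul_τ', pairTensor_tmul, pairTensor_tmul, hx.τ', hx'.τ']

lemma pairTensor_congr_right {θ θ' : H →ₗ[k] H' →ₗ[k] k} {y y' : H'}
    (hy : ∀ x, θ x y = θ' x y) (hy' : ∀ x, θ x y' = θ' x y') (t : H ⊗[k] H) :
    pairTensor θ t (y ⊗ₜ y') = pairTensor θ' t (y ⊗ₜ y') := by
  induction t with
  | zero => simp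
  | add a b ha hb => simp only [map_add, LinearMap.add_apply, ha, hb]
  | tmul a b => rw [pairTensor_tmul, pairTensor_tmul, hy, hy']

end Extensionality

end HopfPairing

/-! ### Weights -/

section Weights

variable {k : Type u} [Field k] {n : ℕ} {D : Datum k n}

open Uq

/-- The elements of weight `μ` of a subalgebra `B` of `U_q` belong to the component `W μ` of every
multiplicative family of subspaces that contains the generators in the right degrees. -/
lemma mem_of_weight {B : Subalgebra k (Uq D)} (W : (Fin n → ℕ) → Submodule k B) {g κ κ' : Fin n → B}
    (hκ : ∀ i, (κ i : Uq D) = K i) (hκ' : ∀ i, (κ' i : Uq D) = Kinv i) (one : 1 ∈ W 0)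
    (mul : ∀ μ ν x y, x ∈ W μ → y ∈ W ν → x * y ∈ W (μ + ν)) (g_mem : ∀ i, g i ∈ W (Pi.single i 1))
    (κ_mem : ∀ i, κ i ∈ W 0) (κ'_mem : ∀ i, κ' i ∈ W 0) {μ : Fin n → ℕ} {x : B}
    (hx : (x : Uq D) ∈ Submodule.span k {x : Uq D | ∃ l : List (Fin n), (∀ i, l.count i = μ i) ∧
      ∃ u ∈ zeroPart D, x = (l.map fun i => (g i : Uq D)).prod * u}) : x ∈ W μ := by
  have hzero {u : Uq D} (hu : u ∈ zeroPart D) : ∃ v ∈ W 0, (v : Uq D) = u := by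
    induction hu using Algebra.adjoin_induction with
    | mem x hx =>
      obtain ⟨i, rfl⟩ | ⟨i, rfl⟩ := hx
      · exact ⟨κ i, κ_mem i, hκ i⟩
      · exact ⟨κ' i, κ'_mem i, hκ' i⟩
    | algebraMap c =>
      exact ⟨c • 1, (W 0).smul_mem c one, by simp [Algebra.algebraMap_eq_smul_one]⟩
    | add x y _ _ hx hy =>
      obtain ⟨⟨v, hv, rfl⟩, ⟨w, hw, rfl⟩⟩ := hx, hy
      exact ⟨v + w, add_mem hv hw, rfl⟩
    | mul x y _ _ hx hy =>
      obtain ⟨⟨v, hv, rfl⟩, ⟨w, hw, rfl⟩⟩ := hx, hy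
      exact ⟨v * w, by simpa using mul 0 0 v w hv hw, rfl⟩
  have hword (l : List (Fin n)) : (l.map g).prod ∈ W fun i => l.count i := by
    induction l with
    | nil => exact one
    | cons a l ih =>
      rw [List.map_cons, List.prod_cons]
      convert mul _ _ _ _ (g_mem a) ih using 1
      congr 1
      funext i
      rw [List.count_cons, Pi.add_apply, Pi.single_apply, add_comm]
      congr 1
      simp only [beq_iff_eq, @eq_comm _ i a]
  have hle : Submodule.span k {x : Uq D | ∃ l : List (Fin n), (∀ i, l.count i = μ i) ∧
      ∃ u ∈ zeroPart D, x = (l.map fun i => (g i : Uq D)).prod * u} ≤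
      (W μ).map B.val.toLinearMap := by
    rw [Submodule.span_le]
    rintro _ ⟨l, hl, u, hu, rfl⟩
    obtain ⟨v, hv, rfl⟩ := hzero hu
    refine ⟨(l.map g).prod * v, ?_, ?_⟩
    · have := mul _ _ _ _ (hword l) hv
      rwa [add_zero, show (fun i => l.count i) = μ from funext hl] at this
    · change B.val ((l.map g).prod * v) = (l.map fun i => (g i : Uq D)).prod * B.val v
      rw [map_mul, map_list_prod, List.map_map]
      rfl
  obtain ⟨x', hx', h⟩ := hle hx
  rwa [← Subtype.val_injective h]

/-- The degree of a generator of `U_q^{≥0}`. -/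
def genDeg : BGen n → Fin n → ℕ
  | .E i => Pi.single i 1
  | .K _ => 0
  | .Kinv _ => 0

/-- The degree of a word in the generators of `U_q^{≥0}`. -/
def wordDeg (l : List (BGen n)) : Fin n → ℕ := (l.map genDeg).sum

@[simp] lemma wordDeg_nil : wordDeg ([] : List (BGen n)) = 0 := rfl
@[simp] lemma wordDeg_cons (a : BGen n) (l : List (BGen n)) :
    wordDeg (a :: l) = genDeg a + wordDeg l := by simp [wordDeg]

variable (D) in
/-- The element of `U_q^{≥0}` given by a word in the generators. -/
def word (l : List (BGen n)) : geZero D := (l.map (Borel.genMap geE geK geKinv)).prod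

@[simp] lemma word_nil : word D [] = 1 := rfl
@[simp] lemma word_cons (a : BGen n) (l : List (BGen n)) :
    word D (a :: l) = Borel.genMap geE geK geKinv a * word D l := by simp [word]

variable (D) in
/-- The span of the words of degree `μ`. -/
def wordSpan (μ : Fin n → ℕ) : Submodule k (geZero D) :=
  Submodule.span k {x | ∃ l, wordDeg l = μ ∧ x = word D l}

lemma wordSpan_mul {μ ν : Fin n → ℕ} {x y : geZero D} (hx : x ∈ wordSpan D μ)
    (hy : y ∈ wordSpan D ν) : x * y ∈ wordSpan D (μ + ν) := by
  have := Submodule.mul_mem_mul hx hy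
  rw [wordSpan, wordSpan, Submodule.span_mul_span] at this
  refine Submodule.span_mono ?_ this
  rintro _ ⟨_, ⟨l, rfl, rfl⟩, _, ⟨l', rfl, rfl⟩, rfl⟩
  exact ⟨l ++ l', by simp [wordDeg], by simp [word]⟩

lemma mem_wordSpan {μ : Fin n → ℕ} {x : geZero D} (hx : (x : Uq D) ∈ posWeight D μ) :
    x ∈ wordSpan D μ :=
  mem_of_weight (wordSpan D) (fun _ => rfl) (fun _ => rfl)
    (Submodule.subset_span ⟨[], rfl, rfl⟩) (fun _ _ _ _ => wordSpan_mul)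
    (g := geE) (fun i => Submodule.subset_span ⟨[.E i], by simp [genDeg], by simp [Borel.genMap]⟩)
    (κ := geK) (fun i => Submodule.subset_span ⟨[.K i], by simp [genDeg], by simp [Borel.genMap]⟩)
    (κ' := geKinv)
    (fun i => Submodule.subset_span ⟨[.Kinv i], by simp [genDeg], by simp [Borel.genMap]⟩) hx

variable (D) in
/-- The span of the tensor products of two words of total degree `μ`. -/
def tensorSpan (μ : Fin n → ℕ) : Submodule k (geZero D ⊗[k] geZero D) :=
  Submodule.span k {x | ∃ l l', wordDeg l + wordDeg l' = μ ∧ x = word D l ⊗ₜ word D l'}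

lemma tensorSpan_mul {μ ν : Fin n → ℕ} {x y : geZero D ⊗[k] geZero D} (hx : x ∈ tensorSpan D μ)
    (hy : y ∈ tensorSpan D ν) : x * y ∈ tensorSpan D (μ + ν) := by
  have := Submodule.mul_mem_mul hx hy
  rw [tensorSpan, tensorSpan, Submodule.span_mul_span] at this
  refine Submodule.span_mono ?_ this
  rintro _ ⟨_, ⟨l, l', rfl, rfl⟩, _, ⟨m, m', rfl, rfl⟩, rfl⟩
  refine ⟨l ++ m, l' ++ m', ?_, by simp [word]⟩
  simp only [wordDeg, List.map_append, List.sum_append]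
  exact add_add_add_comm _ _ _ _

/-- The comultiplication of `U_q^{≥0}` respects degrees. -/
lemma comul_word_mem (l : List (BGen n)) :
    Coalgebra.comul (R := k) (word D l) ∈ tensorSpan D (wordDeg l) := by
  have mem (m m' : List (BGen n)) {μ} (h : wordDeg m + wordDeg m' = μ) :
      word D m ⊗ₜ word D m' ∈ tensorSpan D μ := Submodule.subset_span ⟨m, m', h, rfl⟩
  induction l with
  | nil =>
    rw [word_nil, Bialgebra.comul_one, Algebra.TensorProduct.one_def]
    exact mem [] [] rfl
  | cons a l ih =>
    rw [word_cons, Bialgebra.comul_mul, wordDeg_cons]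
    refine tensorSpan_mul ?_ ih
    cases a with
    | E i =>
      change Coalgebra.comul (geE i) ∈ _
      rw [comul_geE]
      exact add_mem (by simpa [Borel.genMap] using mem [.E i] [] (by simp))
        (by simpa [Borel.genMap] using mem [.K i] [.E i] (by simp [genDeg]))
    | K i =>
      change Coalgebra.comul (geK i) ∈ _
      rw [comul_geK]
      simpa [Borel.genMap] using mem [.K i] [.K i] (by simp [genDeg])
    | Kinv i =>
      change Coalgebra.comul (geKinv i) ∈ _
      rw [comul_geKinv]
      simpa [Borel.genMap] using mem [.Kinv i] [.Kinv i] (by simp [genDeg])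

/-- A pairing of `U_q^{≥0}` and `U_q^{≤0}` that is compatible with products, coproducts, units and
counits and takes the values of the Lusztig pairing on generators. -/
structure IsLusztigPrePairing (φ : geZero D →ₗ[k] leZero D →ₗ[k] k) : Prop where
  one_left : ∀ y, φ 1 y = Coalgebra.counit (R := k) y
  one_right : ∀ x, φ x 1 = Coalgebra.counit (R := k) x
  mul_left : ∀ x x' y, φ (x * x') y = pairTensor φ (x ⊗ₜ x') (Coalgebra.comul y)
  mul_right : ∀ x y y', φ x (y * y') =
    pairTensor φ (TensorProduct.comm k _ _ (Coalgebra.comul x)) (y ⊗ₜ y')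
  val : GenValues D 1 φ geE geK geKinv leF leK leKinv

lemma isLusztigPrePairing_lusztigPairing : IsLusztigPrePairing (lusztigPairing D) where
  one_left := lusztigPairing_one_left
  one_right := lusztigPairing_one_right
  mul_left := lusztigPairing_mul_left
  mul_right := lusztigPairing_mul_right
  val := genValues_lusztigPairing

/-- The elements of `U_q^{≤0}` that are orthogonal to the words of degrees other than `ν`. -/
def orthogonal (φ : geZero D →ₗ[k] leZero D →ₗ[k] k) (ν : Fin n → ℕ) : Submodule k (leZero D) where
  carrier := {y | ∀ l, wordDeg l ≠ ν → φ (word D l) y = 0}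
  zero_mem' l _ := map_zero _
  add_mem' hx hy l hl := by rw [map_add, hx l hl, hy l hl, add_zero]
  smul_mem' c x hx l hl := by rw [map_smul, hx l hl, smul_zero]

namespace IsLusztigPrePairing

variable {φ : geZero D →ₗ[k] leZero D →ₗ[k] k}

lemma mul_mem_orthogonal (h : IsLusztigPrePairing φ) {μ ν : Fin n → ℕ} {y y' : leZero D}
    (hy : y ∈ orthogonal φ μ) (hy' : y' ∈ orthogonal φ ν) : y * y' ∈ orthogonal φ (μ + ν) := by
  intro l hl
  rw [h.mul_right]
  have := comul_word_mem (D := D) l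
  generalize Coalgebra.comul (R := k) (word D l) = t at this
  induction this using Submodule.span_induction with
  | zero => simp
  | add a b _ _ ha hb => simp only [map_add, LinearMap.add_apply, ha, hb, add_zero]
  | smul c a _ ha => simp only [map_smul, LinearMap.smul_apply, ha, smul_zero]
  | mem x hx =>
    obtain ⟨m, m', hm, rfl⟩ := hx
    rw [TensorProduct.comm_tmul, pairTensor_tmul]
    by_cases h₁ : wordDeg m' = μ
    · rw [hy' m, mul_zero]
      rintro rfl
      exact hl (by rw [← hm, h₁, add_comm])
    · rw [hy m' h₁, zero_mul]

lemma mem_orthogonal_zero (h : IsLusztigPrePairing φ) {y : leZero D}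
    (hy : Coalgebra.comul (R := k) y = y ⊗ₜ y) (hE : ∀ i, φ (geE i) y = 0) :
    y ∈ orthogonal φ 0 := by
  intro l hl
  induction l with
  | nil => exact absurd rfl hl
  | cons a l ih =>
    rw [word_cons, h.mul_left, hy, pairTensor_tmul]
    rw [wordDeg_cons] at hl
    cases a with
    | E i => rw [Borel.genMap, hE, zero_mul]
    | K i => rw [ih (by simpa [genDeg] using hl), mul_zero]
    | Kinv i => rw [ih (by simpa [genDeg] using hl), mul_zero]

lemma leF_mem_orthogonal (h : IsLusztigPrePairing φ) (j : Fin n) :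
    leF j ∈ orthogonal φ (Pi.single j 1) := by
  intro l hl
  induction l with
  | nil => rw [word_nil, h.one_left, counit_leF]
  | cons a l ih =>
    rw [word_cons, h.mul_left, comul_leF, map_add, pairTensor_tmul, pairTensor_tmul]
    rw [wordDeg_cons] at hl
    cases a with
    | E i =>
      rw [Borel.genMap, h.val.e_f, h.one_right, counit_geE, zero_mul, add_zero]
      split_ifs with hij
      · subst hij
        rw [h.mem_orthogonal_zero (comul_leKinv i) (fun j => h.val.e_τ' j i) l, mul_zero]
        intro h0
        rw [h0, add_zero] at hl
        exact hl rfl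
      · rw [zero_mul]
    | K i => rw [Borel.genMap, h.val.κ_f, zero_mul, zero_add,
        ih (by simpa [genDeg] using hl), mul_zero]
    | Kinv i => rw [Borel.genMap, h.val.κ'_f, zero_mul, zero_add,
        ih (by simpa [genDeg] using hl), mul_zero]

/-- Elements of different weights are orthogonal. -/
lemma weight (h : IsLusztigPrePairing φ) (μ ν : Fin n → ℕ) (x : geZero D) (y : leZero D)
    (hμν : μ ≠ ν) (hx : (x : Uq D) ∈ posWeight D μ) (hy : (y : Uq D) ∈ negWeight D ν) :
    φ x y = 0 := by
  have hy' : y ∈ orthogonal φ ν :=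
    mem_of_weight (orthogonal φ) (fun _ => rfl) (fun _ => rfl)
      (h.mem_orthogonal_zero (by rw [Bialgebra.comul_one, Algebra.TensorProduct.one_def])
        fun i => by rw [h.one_right, counit_geE])
      (fun _ _ _ _ => h.mul_mem_orthogonal) (g := leF) h.leF_mem_orthogonal
      (κ := leK) (fun i => h.mem_orthogonal_zero (comul_leK i) (fun j => h.val.e_τ j i))
      (κ' := leKinv) (fun i => h.mem_orthogonal_zero (comul_leKinv i) (fun j => h.val.e_τ' j i)) hy
  have hx' := mem_wordSpan hx
  clear hx
  induction hx' using Submodule.span_induction with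
  | zero => simp
  | add a b _ _ ha hb => rw [map_add, LinearMap.add_apply, ha, hb, add_zero]
  | smul c a _ ha => rw [map_smul, LinearMap.smul_apply, ha, smul_zero]
  | mem x hx =>
    obtain ⟨l, rfl, rfl⟩ := hx
    exact hy' l hμν

end IsLusztigPrePairing

end Weights

/-! ### Existence and uniqueness of the Lusztig pairing -/

section LusztigPairing

variable {k : Type u} [Field k] {n : ℕ} {D : Datum k n}

open Uq

lemma one_mem_posWeight : ((1 : geZero D) : Uq D) ∈ posWeight D 0 :=
  Submodule.subset_span ⟨[], by simp, 1, one_mem _, by simp⟩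

lemma one_mem_negWeight : ((1 : leZero D) : Uq D) ∈ negWeight D 0 :=
  Submodule.subset_span ⟨[], by simp, 1, one_mem _, by simp⟩

lemma geE_mem_posWeight (i : Fin n) : ((geE i : geZero D) : Uq D) ∈ posWeight D (Pi.single i 1) :=
  Submodule.subset_span ⟨[i], fun j => by simp [List.count_singleton, Pi.single_apply, @eq_comm _ j],
    1, one_mem _, by simp [geE]⟩

lemma leF_mem_negWeight (i : Fin n) : ((leF i : leZero D) : Uq D) ∈ negWeight D (Pi.single i 1) :=
  Submodule.subset_span ⟨[i], fun j => by simp [List.count_singleton, Pi.single_apply, @eq_comm _ j],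
    1, one_mem _, by simp [leF]⟩

lemma K_mem_zeroPart (i : Fin n) : (K i : Uq D) ∈ zeroPart D :=
  Algebra.subset_adjoin (Or.inl ⟨i, rfl⟩)

lemma Kinv_mem_zeroPart (i : Fin n) : (Kinv i : Uq D) ∈ zeroPart D :=
  Algebra.subset_adjoin (Or.inr ⟨i, rfl⟩)

lemma geK_mem_posWeight (i : Fin n) : ((geK i : geZero D) : Uq D) ∈ posWeight D 0 :=
  Submodule.subset_span ⟨[], by simp, K i, K_mem_zeroPart i, by simp [geK]⟩

lemma geKinv_mem_posWeight (i : Fin n) : ((geKinv i : geZero D) : Uq D) ∈ posWeight D 0 :=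
  Submodule.subset_span ⟨[], by simp, Kinv i, Kinv_mem_zeroPart i, by simp [geKinv]⟩

lemma leK_mem_negWeight (i : Fin n) : ((leK i : leZero D) : Uq D) ∈ negWeight D 0 :=
  Submodule.subset_span ⟨[], by simp, K i, K_mem_zeroPart i, by simp [leK]⟩

lemma leKinv_mem_negWeight (i : Fin n) : ((leKinv i : leZero D) : Uq D) ∈ negWeight D 0 :=
  Submodule.subset_span ⟨[], by simp, Kinv i, Kinv_mem_zeroPart i, by simp [leKinv]⟩

namespace Uq.IsLusztigPairing

variable {φ : geZero D →ₗ[k] leZero D →ₗ[k] k}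

lemma mul_left' (h : IsLusztigPairing φ) (x x' : geZero D) (y : leZero D) :
    φ (x * x') y = pairTensor φ (x ⊗ₜ x') (Coalgebra.comul y) := h.mul_left x x' y

lemma mul_right' (h : IsLusztigPairing φ) (x : geZero D) (y y' : leZero D) : φ x (y * y') =
    pairTensor φ (TensorProduct.comm k _ _ (Coalgebra.comul x)) (y ⊗ₜ y') := h.mul_right x y y'

lemma one_left (h : IsLusztigPairing φ) (y : leZero D) :
    φ 1 y = Coalgebra.counit (R := k) y := by
  have hmul (y y' : leZero D) : φ 1 (y * y') = φ 1 y * φ 1 y' := by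
    rw [h.mul_right', Bialgebra.comul_one, Algebra.TensorProduct.one_def, TensorProduct.comm_tmul,
      pairTensor_tmul]
  induction y using adjoin_top_induction (negGens_le D).adjoin with
  | he i =>
    rw [counit_leF]
    exact h.weight _ _ _ _ (by simp [eq_comm]) one_mem_posWeight (leF_mem_negWeight i)
  | hκ i => rw [h.one_K, counit_leK]
  | hκ' i =>
    have := hmul (leK i) (leKinv i)
    rw [(relations_le D).K_Kinv, h.one_one, h.one_K, one_mul] at this
    rw [← this, counit_leKinv]
  | halg c => simp [Algebra.algebraMap_eq_smul_one, h.one_one]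
  | hadd x y hx hy => rw [map_add, map_add, hx, hy]
  | hmul x y hx hy => rw [hmul, hx, hy, Bialgebra.counit_mul]

lemma one_right (h : IsLusztigPairing φ) (x : geZero D) :
    φ x 1 = Coalgebra.counit (R := k) x := by
  have hmul (x x' : geZero D) : φ (x * x') 1 = φ x 1 * φ x' 1 := by
    rw [h.mul_left', Bialgebra.comul_one, Algebra.TensorProduct.one_def, pairTensor_tmul]
  induction x using adjoin_top_induction (posGens_ge D).adjoin with
  | he i =>
    rw [counit_geE]
    exact h.weight _ _ _ _ (by simp) (geE_mem_posWeight i) one_mem_negWeight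
  | hκ i => rw [h.K_one, counit_geK]
  | hκ' i =>
    have := hmul (geK i) (geKinv i)
    rw [(relations_ge D).K_Kinv, h.one_one, h.K_one, one_mul] at this
    rw [← this, counit_geKinv]
  | halg c => simp [Algebra.algebraMap_eq_smul_one, h.one_one]
  | hadd x y hx hy => rw [map_add, LinearMap.add_apply, map_add, hx, hy]
  | hmul x y hx hy => rw [hmul, hx, hy, Bialgebra.counit_mul]

lemma prePairing (h : IsLusztigPairing φ) : IsLusztigPrePairing φ where
  one_left := h.one_left
  one_right := h.one_right
  mul_left := h.mul_left'
  mul_right := h.mul_right'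
  val :=
    { e_f := fun i j => by rw [h.E_F, Int.cast_one, one_mul]
      κ_f := fun i j =>
        h.weight _ _ _ _ (by simp [eq_comm]) (geK_mem_posWeight i) (leF_mem_negWeight j)
      κ'_f := fun i j =>
        h.weight _ _ _ _ (by simp [eq_comm]) (geKinv_mem_posWeight i) (leF_mem_negWeight j)
      e_τ := fun i j => h.weight _ _ _ _ (by simp) (geE_mem_posWeight i) (leK_mem_negWeight j)
      e_τ' := fun i j => h.weight _ _ _ _ (by simp) (geE_mem_posWeight i) (leKinv_mem_negWeight j)
      κ_τ := fun i j => by rw [h.K_K, one_mul]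
      κ_τ' := fun i j => by rw [h.K_Kinv, one_mul]
      κ'_τ := fun i j => by
        have := h.mul_left' (geKinv i) (geK i) (leK j)
        rw [(relations_ge D).Kinv_K, h.one_K, comul_leK, pairTensor_tmul, h.K_K] at this
        rw [one_mul, zpow_neg, eq_inv_of_mul_eq_one_left this.symm]
      κ'_τ' := fun i j => by
        have := h.mul_left' (geKinv i) (geK i) (leKinv j)
        rw [(relations_ge D).Kinv_K, h.one_left, counit_leKinv, comul_leKinv, pairTensor_tmul,
          h.K_Kinv, zpow_neg] at this
        rw [one_mul, eq_inv_of_mul_eq_one_left this.symm, inv_inv] }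

end Uq.IsLusztigPairing

open HopfAlgebra

lemma antipode_geE (i : Fin n) : antipode k (geE i : geZero D) = -(geKinv i * geE i) :=
  Subtype.ext (S_E D i)
lemma antipode_geK (i : Fin n) : antipode k (geK i : geZero D) = geKinv i := Subtype.ext (S_K D i)
lemma antipode_geKinv (i : Fin n) : antipode k (geKinv i : geZero D) = geK i :=
  Subtype.ext (S_Kinv D i)
lemma antipode_leF (i : Fin n) : antipode k (leF i : leZero D) = -(leF i * leK i) :=
  Subtype.ext (S_F D i)
lemma antipode_leK (i : Fin n) : antipode k (leK i : leZero D) = leKinv i := Subtype.ext (S_K D i)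
lemma antipode_leKinv (i : Fin n) : antipode k (leKinv i : leZero D) = leK i :=
  Subtype.ext (S_Kinv D i)

lemma antipodeReverses_ge (x : geZero D) : AntipodeReverses k x := by
  induction x using adjoin_top_induction (posGens_ge D).adjoin with
  | he i =>
    rw [AntipodeReverses, antipode_geE, map_neg, Bialgebra.comul_mul, comul_geE, comul_geKinv]
    simp [mul_add, (relations_ge D).Kinv_K, antipode_geE, antipode_geK, TensorProduct.neg_tmul,
      TensorProduct.tmul_neg]
  | hκ i => simp [AntipodeReverses, antipode_geK, comul_geK, comul_geKinv]
  | hκ' i => simp [AntipodeReverses, antipode_geKinv, comul_geK, comul_geKinv]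
  | halg c => exact .algebraMap c
  | hadd x y hx hy => exact hx.add hy
  | hmul x y hx hy => exact hx.mul hy

lemma antipodeReverses_le (x : leZero D) : AntipodeReverses k x := by
  induction x using adjoin_top_induction (negGens_le D).adjoin with
  | he i =>
    rw [AntipodeReverses, antipode_leF, map_neg, Bialgebra.comul_mul, comul_leF, comul_leK]
    simp [add_mul, (relations_le D).Kinv_K, antipode_leF, antipode_leKinv, TensorProduct.neg_tmul,
      TensorProduct.tmul_neg]
  | hκ i => simp [AntipodeReverses, antipode_leK, comul_leK, comul_leKinv]
  | hκ' i => simp [AntipodeReverses, antipode_leKinv, comul_leK, comul_leKinv]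
  | halg c => exact .algebraMap c
  | hadd x y hx hy => exact hx.add hy
  | hmul x y hx hy => exact hx.mul hy

lemma antipodeInv_leF (i : Fin n) : antipodeInv k (leZero D) (leF i) = -(leK i * leF i) :=
  antipodeInv_eq (by
    rw [map_neg, antipode_mul_antidistrib, antipode_leF, antipode_leK, neg_mul, neg_neg, mul_assoc,
      (relations_le D).K_Kinv, mul_one])

lemma antipodeInv_leK (i : Fin n) : antipodeInv k (leZero D) (leK i) = leKinv i :=
  antipodeInv_eq (antipode_leKinv i)

lemma antipodeInv_leKinv (i : Fin n) : antipodeInv k (leZero D) (leKinv i) = leK i :=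
  antipodeInv_eq (antipode_leK i)

namespace IsLusztigPrePairing

variable {φ : geZero D →ₗ[k] leZero D →ₗ[k] k}

/-- The pairing `φ` together with `φ(x, S⁻¹(y))`. -/
def skewPairing (h : IsLusztigPrePairing φ) : SkewPairing k (geZero D) (leZero D) :=
  .ofHopf antipodeReverses_le φ h.one_left h.one_right h.mul_left h.mul_right

lemma genValues_antipodeInv (h : IsLusztigPrePairing φ) :
    GenValues D (-1) (φ.compl₂ (antipodeInv k (leZero D))) geE geK geKinv leF leK leKinv where
  e_f i j := by
    rw [LinearMap.compl₂_apply, antipodeInv_leF, map_neg, h.mul_right, comul_geE]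
    simp [h.val.e_f, h.val.e_τ, h.one_left, counit_leK]
    split_ifs <;> simp
  κ_f i j := by
    rw [LinearMap.compl₂_apply, antipodeInv_leF, map_neg, h.mul_right, comul_geK]
    simp [h.val.κ_f]
  κ'_f i j := by
    rw [LinearMap.compl₂_apply, antipodeInv_leF, map_neg, h.mul_right, comul_geKinv]
    simp [h.val.κ'_f]
  e_τ i j := by rw [LinearMap.compl₂_apply, antipodeInv_leK, h.val.e_τ']
  e_τ' i j := by rw [LinearMap.compl₂_apply, antipodeInv_leKinv, h.val.e_τ]
  κ_τ i j := by rw [LinearMap.compl₂_apply, antipodeInv_leK, h.val.κ_τ', one_mul, neg_one_mul]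
  κ_τ' i j := by
    rw [LinearMap.compl₂_apply, antipodeInv_leKinv, h.val.κ_τ, one_mul, neg_one_mul, neg_neg]
  κ'_τ i j := by
    rw [LinearMap.compl₂_apply, antipodeInv_leK, h.val.κ'_τ', one_mul, neg_one_mul, neg_neg]
  κ'_τ' i j := by rw [LinearMap.compl₂_apply, antipodeInv_leKinv, h.val.κ'_τ, one_mul, neg_one_mul]

lemma genValues_antipode (h : IsLusztigPrePairing φ) :
    GenValues D (-1) (φ ∘ₗ antipode k) geE geK geKinv leF leK leKinv where
  e_f i j := by
    rw [LinearMap.comp_apply, antipode_geE, map_neg, LinearMap.neg_apply, h.mul_left, comul_leF]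
    simp [h.val.κ'_f, h.val.e_f, h.one_right, counit_geKinv]
    split_ifs <;> simp
  κ_f i j := by rw [LinearMap.comp_apply, antipode_geK, h.val.κ'_f]
  κ'_f i j := by rw [LinearMap.comp_apply, antipode_geKinv, h.val.κ_f]
  e_τ i j := by
    rw [LinearMap.comp_apply, antipode_geE, map_neg, LinearMap.neg_apply, h.mul_left, comul_leK]
    simp [h.val.e_τ]
  e_τ' i j := by
    rw [LinearMap.comp_apply, antipode_geE, map_neg, LinearMap.neg_apply, h.mul_left, comul_leKinv]
    simp [h.val.e_τ']
  κ_τ i j := by rw [LinearMap.comp_apply, antipode_geK, h.val.κ'_τ, one_mul, neg_one_mul]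
  κ_τ' i j := by
    rw [LinearMap.comp_apply, antipode_geK, h.val.κ'_τ', one_mul, neg_one_mul, neg_neg]
  κ'_τ i j := by
    rw [LinearMap.comp_apply, antipode_geKinv, h.val.κ_τ, one_mul, neg_one_mul, neg_neg]
  κ'_τ' i j := by rw [LinearMap.comp_apply, antipode_geKinv, h.val.κ_τ', one_mul, neg_one_mul]

lemma isBorelPairing (h : IsLusztigPrePairing φ) :
    IsBorelPairing D h.skewPairing geE geK geKinv leF leK leKinv where
  pos := posGens_ge D
  neg := negGens_le D
  φ_val := h.val
  ψ_val := h.genValues_antipodeInv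

/-- A pairing is compatible with the antipodes: both `φ(S(x), y)` and `φ(x, S⁻¹(y))` reverse
products, and they agree on generators. -/
lemma antipode_apply (h : IsLusztigPrePairing φ) (x : geZero D) (y : leZero D) :
    φ (antipode k x) y = φ x (antipodeInv k _ y) := by
  have hmul (x x' : geZero D) (y : leZero D) : (φ ∘ₗ antipode k) (x * x') y =
      pairTensor (φ ∘ₗ antipode k) (x' ⊗ₜ x) (Coalgebra.comul y) := by
    rw [LinearMap.comp_apply, antipode_mul_antidistrib, h.mul_left]
    generalize (Coalgebra.comul (R := k) y) = t
    induction t with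
    | zero => simp
    | add a b ha hb => simp only [map_add, ha, hb]
    | tmul a b => rfl
  have hmul' (x : geZero D) (y y' : leZero D) : (φ ∘ₗ antipode k) x (y * y') =
      pairTensor (φ ∘ₗ antipode k) (Coalgebra.comul x) (y ⊗ₜ y') := by
    rw [LinearMap.comp_apply, h.mul_right, antipodeReverses_ge x]
    generalize (Coalgebra.comul (R := k) x) = t
    induction t with
    | zero => simp
    | add a b ha hb => simp only [map_add, LinearMap.add_apply, ha, hb]
    | tmul a b => rfl
  have := pairing_ext (posGens_ge D) (negGens_le D) h.genValues_antipode h.genValues_antipodeInv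
    (fun y => by rw [LinearMap.comp_apply, antipode_one, h.one_left]
                 exact (h.skewPairing.one_left' y).symm)
    (fun x => by rw [LinearMap.comp_apply, h.one_right, counit_antipode]
                 exact (h.skewPairing.one_right' x).symm)
    (fun x x' hx hx' => by
      obtain ⟨h₁, h₂, h₃, h₄⟩ := AgreeAt.pairTensor_comul (negGens_le D) hx' hx
      have hm := h.skewPairing.mul_left' x x'
      constructor
      · rw [hmul, h₁]; exact (hm _).symm
      · intro i; rw [hmul, h₂]; exact (hm _).symm
      · intro i; rw [hmul, h₃]; exact (hm _).symm
      · intro i; rw [hmul, h₄]; exact (hm _).symm)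
    (fun y y' hy hy' x => by
      rw [hmul', pairTensor_congr_right hy hy']
      exact (h.skewPairing.mul_right' x y y').symm)
  exact DFunLike.congr_fun (DFunLike.congr_fun this x) y

lemma isLusztigPairing (h : IsLusztigPrePairing φ) : IsLusztigPairing φ where
  mul_right := h.mul_right
  mul_left := h.mul_left
  antipode := h.antipode_apply
  one_one := by rw [h.one_left, Bialgebra.counit_one]
  one_K i := by rw [h.one_left, counit_leK]
  K_one i := by rw [h.one_right, counit_geK]
  weight := h.weight
  E_F i j := by rw [h.val.e_f, Int.cast_one, one_mul]
  K_K i j := by rw [h.val.κ_τ, one_mul]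
  K_Kinv i j := by rw [h.val.κ_τ', one_mul]

lemma unique (h : IsLusztigPrePairing φ) {φ' : geZero D →ₗ[k] leZero D →ₗ[k] k}
    (h' : IsLusztigPrePairing φ') : φ = φ' := by
  refine pairing_ext (posGens_ge D) (negGens_le D) h.val h'.val
    (fun y => by rw [h.one_left, h'.one_left]) (fun x => by rw [h.one_right, h'.one_right])
    (fun x x' hx hx' => ?_) (fun y y' hy hy' x => ?_)
  · obtain ⟨h₁, h₂, h₃, h₄⟩ := AgreeAt.pairTensor_comul (negGens_le D) hx hx'
    constructor
    · rw [h.mul_left, h'.mul_left, h₁]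
    · intro i; rw [h.mul_left, h'.mul_left, h₂]
    · intro i; rw [h.mul_left, h'.mul_left, h₃]
    · intro i; rw [h.mul_left, h'.mul_left, h₄]
  · rw [h.mul_right, h'.mul_right, pairTensor_congr_right hy hy']

end IsLusztigPrePairing

end LusztigPairing

/-! ### The presentation of the quantum double -/

section DoublePresentation

variable {k : Type u} [Field k] {n : ℕ} {D : Datum k n}

open Uq

namespace DPres

variable (D) in
/-- The homomorphism from `U_q^{≥0}` to the presented algebra. -/
def ofGe : geZero D →ₐ[k] DPres D :=
  (Borel.lift (relations D).pos).comp (posEquiv D).symm.toAlgHom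

variable (D) in
/-- The homomorphism from `U_q^{≤0}` to the presented algebra. It sends `F_i` to `q_i⁻¹ F_i`, as
`F_i` corresponds to `q_i (1 ⊗ F_i)` in the double. -/
def ofLe : leZero D →ₐ[k] DPres D :=
  (Borel.lift ((relations D).neg.smul fun i => (D.qi i)⁻¹)).comp (negEquiv D).symm.toAlgHom

@[simp] lemma ofGe_geE (i : Fin n) : ofGe D (geE i) = of D (.E i) := by simp [ofGe]
@[simp] lemma ofGe_geK (i : Fin n) : ofGe D (geK i) = of D (.K i) := by simp [ofGe]
@[simp] lemma ofGe_geKinv (i : Fin n) : ofGe D (geKinv i) = of D (.Kinv i) := by simp [ofGe]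
@[simp] lemma ofLe_leF (i : Fin n) : ofLe D (leF i) = (D.qi i)⁻¹ • of D (.F i) := by simp [ofLe]
@[simp] lemma ofLe_leK (i : Fin n) : ofLe D (leK i) = of D (.Kt i) := by simp [ofLe]
@[simp] lemma ofLe_leKinv (i : Fin n) : ofLe D (leKinv i) = of D (.Ktinv i) := by simp [ofLe]

variable (D) in
/-- The linear map `x ⊗ y ↦ x y` to the presented algebra. -/
def ofTensor : geZero D ⊗[k] leZero D →ₗ[k] DPres D :=
  LinearMap.mul' k (DPres D) ∘ₗ TensorProduct.map (ofGe D).toLinearMap (ofLe D).toLinearMap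

lemma ofTensor_tmul (x : geZero D) (y : leZero D) : ofTensor D (x ⊗ₜ y) = ofGe D x * ofLe D y := rfl

lemma ofGe_mul_mem {z : DPres D} (hz : z ∈ LinearMap.range (ofTensor D)) (x : geZero D) :
    ofGe D x * z ∈ LinearMap.range (ofTensor D) := by
  obtain ⟨t, rfl⟩ := hz
  induction t with
  | zero => simp
  | add a b ha hb => rw [map_add, mul_add]; exact add_mem ha hb
  | tmul a b => exact ⟨(x * a) ⊗ₜ b, by rw [ofTensor_tmul, ofTensor_tmul, map_mul, mul_assoc]⟩

lemma ofLe_mem (y : leZero D) : ofLe D y ∈ LinearMap.range (ofTensor D) :=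
  ⟨1 ⊗ₜ y, by rw [ofTensor_tmul, map_one, one_mul]⟩

/-- An element of the image of `ofTensor D` that stays there after left multiplication by the
generators `F_j, K̃_j, K̃_j⁻¹`. -/
structure IsStable (z : DPres D) : Prop where
  mem : z ∈ LinearMap.range (ofTensor D)
  F : ∀ j, of D (.F j) * z ∈ LinearMap.range (ofTensor D)
  Kt : ∀ j, of D (.Kt j) * z ∈ LinearMap.range (ofTensor D)
  Ktinv : ∀ j, of D (.Ktinv j) * z ∈ LinearMap.range (ofTensor D)

lemma isStable_ofLe (y : leZero D) : IsStable (ofLe D y) where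
  mem := ofLe_mem y
  F j := by
    have : of D (.F j) = D.qi j • ofLe D (leF j) := by
      rw [ofLe_leF, smul_inv_smul₀ (URelations.qi_ne_zero j)]
    rw [this, smul_mul_assoc, ← map_mul]
    exact Submodule.smul_mem _ _ (ofLe_mem _)
  Kt j := by rw [← ofLe_leK, ← map_mul]; exact ofLe_mem _
  Ktinv j := by rw [← ofLe_leKinv, ← map_mul]; exact ofLe_mem _

lemma mul_mem_of_comm {g x z : DPres D} {c : k} (h : g * x = c • (x * g)) {a : geZero D}
    (ha : ofGe D a = x) (hz : g * z ∈ LinearMap.range (ofTensor D)) :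
    g * (x * z) ∈ LinearMap.range (ofTensor D) := by
  rw [← mul_assoc, h, smul_mul_assoc, mul_assoc, ← ha]
  exact Submodule.smul_mem _ _ (ofGe_mul_mem hz a)

/-- The commutation relations move `F_j, K̃_j, K̃_j⁻¹` past the elements of `U_q^{≥0}`. -/
lemma IsStable.ofGe_mul {z : DPres D} (hz : IsStable z) (x : geZero D) :
    IsStable (ofGe D x * z) := by
  have h := relations D
  have hq (m : ℤ) : D.q ^ m ≠ 0 := zpow_ne_zero _ D.q_ne_zero
  induction x using adjoin_top_induction (posGens_ge D).adjoin generalizing z with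
  | he i =>
    refine ⟨ofGe_mul_mem hz.mem _, fun j => ?_, fun j => ?_, fun j => ?_⟩ <;> rw [ofGe_geE]
    · have hF := h.E_F i j
      rw [sub_eq_iff_eq_add', ← sub_eq_iff_eq_add] at hF
      rw [← mul_assoc, ← hF, sub_mul, mul_assoc]
      refine sub_mem (by simpa using ofGe_mul_mem (hz.F j) (geE i)) ?_
      split_ifs
      · rw [smul_mul_assoc, sub_mul]
        exact Submodule.smul_mem _ _
          (sub_mem (by simpa using ofGe_mul_mem hz.mem (geK i)) (hz.Ktinv i))
      · simp
    · exact mul_mem_of_comm (h.Kt_E j i) (ofGe_geE i) (hz.Kt j)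
    · exact mul_mem_of_comm (URelations.inv_comm (hq _) (h.neg.K_Kinv j) (h.neg.Kinv_K j)
        (h.Kt_E j i)) (ofGe_geE i) (hz.Ktinv j)
  | hκ i =>
    refine ⟨ofGe_mul_mem hz.mem _, fun j => ?_, fun j => ?_, fun j => ?_⟩ <;> rw [ofGe_geK]
    · exact mul_mem_of_comm (URelations.swap (hq _) (h.K_F i j)) (ofGe_geK i) (hz.F j)
    · exact mul_mem_of_comm (c := 1) (by rw [one_smul]; exact (h.K_Kt i j).symm) (ofGe_geK i)
        (hz.Kt j)
    · exact mul_mem_of_comm (URelations.inv_comm one_ne_zero (h.neg.K_Kinv j) (h.neg.Kinv_K j)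
        (by rw [one_smul]; exact (h.K_Kt i j).symm)) (ofGe_geK i) (hz.Ktinv j)
  | hκ' i =>
    have hKt (j) : of D (.Kt j) * of D (.Kinv i) = (1 : k) • (of D (.Kinv i) * of D (.Kt j)) := by
      rw [one_smul]
      exact DRelations.commute_inv (h.pos.K_Kinv i) (h.pos.Kinv_K i) (h.K_Kt i j).symm
    refine ⟨ofGe_mul_mem hz.mem _, fun j => ?_, fun j => ?_, fun j => ?_⟩ <;> rw [ofGe_geKinv]
    · exact mul_mem_of_comm (URelations.swap (hq _) (h.Kinv_F i j)) (ofGe_geKinv i) (hz.F j)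
    · exact mul_mem_of_comm (hKt j) (ofGe_geKinv i) (hz.Kt j)
    · exact mul_mem_of_comm (URelations.inv_comm one_ne_zero (h.neg.K_Kinv j) (h.neg.Kinv_K j)
        (hKt j)) (ofGe_geKinv i) (hz.Ktinv j)
  | halg c =>
    rw [AlgHom.commutes, ← Algebra.smul_def]
    refine ⟨Submodule.smul_mem _ _ hz.mem, fun j => ?_, fun j => ?_, fun j => ?_⟩ <;>
      rw [mul_smul_comm]
    · exact Submodule.smul_mem _ _ (hz.F j)
    · exact Submodule.smul_mem _ _ (hz.Kt j)
    · exact Submodule.smul_mem _ _ (hz.Ktinv j)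
  | hadd x y hx hy =>
    rw [map_add, add_mul]
    refine ⟨add_mem (hx hz).mem (hy hz).mem, fun j => ?_, fun j => ?_, fun j => ?_⟩ <;>
      rw [mul_add]
    · exact add_mem ((hx hz).F j) ((hy hz).F j)
    · exact add_mem ((hx hz).Kt j) ((hy hz).Kt j)
    · exact add_mem ((hx hz).Ktinv j) ((hy hz).Ktinv j)
  | hmul x y hx hy =>
    rw [map_mul, mul_assoc]
    exact hx (hy hz)

lemma isStable_of_mem {z : DPres D} (hz : z ∈ LinearMap.range (ofTensor D)) : IsStable z := by
  obtain ⟨t, rfl⟩ := hz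
  induction t with
  | zero => constructor <;> simp
  | add a b ha hb =>
    rw [map_add]
    refine ⟨add_mem ha.mem hb.mem, fun j => ?_, fun j => ?_, fun j => ?_⟩ <;> rw [mul_add]
    · exact add_mem (ha.F j) (hb.F j)
    · exact add_mem (ha.Kt j) (hb.Kt j)
    · exact add_mem (ha.Ktinv j) (hb.Ktinv j)
  | tmul a b => exact (isStable_ofLe b).ofGe_mul a

/-- The presented algebra is spanned by the products of elements of `U_q^{≥0}` and `U_q^{≤0}`. -/
lemma ofTensor_surjective : Function.Surjective (ofTensor D) := by
  have hmul (d : DPres D) : ∀ z ∈ LinearMap.range (ofTensor D),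
      d * z ∈ LinearMap.range (ofTensor D) := by
    induction d using DPres.induction with
    | hof x =>
      intro z hz
      cases x with
      | E i => simpa using ofGe_mul_mem hz (geE i)
      | K i => simpa using ofGe_mul_mem hz (geK i)
      | Kinv i => simpa using ofGe_mul_mem hz (geKinv i)
      | F i => exact (isStable_of_mem hz).F i
      | Kt i => exact (isStable_of_mem hz).Kt i
      | Ktinv i => exact (isStable_of_mem hz).Ktinv i
    | halg c => intro z hz; rw [← Algebra.smul_def]; exact Submodule.smul_mem _ _ hz
    | hadd x y hx hy => intro z hz; rw [add_mul]; exact add_mem (hx z hz) (hy z hz)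
    | hmul x y hx hy => intro z hz; rw [mul_assoc]; exact hx _ (hy z hz)
  intro d
  have := hmul d 1 (by simpa using ofLe_mem (D := D) 1)
  rwa [mul_one] at this

/-- The homomorphism from the presented algebra to the double. -/
def toDouble {P : SkewPairing k (geZero D) (leZero D)}
    (hP : IsBorelPairing D P geE geK geKinv leF leK leKinv) : DPres D →ₐ[k] P.Double :=
  lift hP.dRelations

variable {P : SkewPairing k (geZero D) (leZero D)}
  (hP : IsBorelPairing D P geE geK geKinv leF leK leKinv)

lemma toDouble_ofGe (x : geZero D) : toDouble hP (ofGe D x) = P.inl x := by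
  induction x using adjoin_top_induction (posGens_ge D).adjoin with
  | he i => rw [ofGe_geE, toDouble, lift_of, genMap]
  | hκ i => rw [ofGe_geK, toDouble, lift_of, genMap]
  | hκ' i => rw [ofGe_geKinv, toDouble, lift_of, genMap]
  | halg c => simp only [AlgHom.commutes]
  | hadd x y hx hy => simp only [map_add, hx, hy]
  | hmul x y hx hy => simp only [map_mul, hx, hy]

lemma toDouble_ofLe (y : leZero D) : toDouble hP (ofLe D y) = P.inr y := by
  induction y using adjoin_top_induction (negGens_le D).adjoin with
  | he i => rw [ofLe_leF, map_smul, toDouble, lift_of, genMap,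
      inv_smul_smul₀ (URelations.qi_ne_zero i)]
  | hκ i => rw [ofLe_leK, toDouble, lift_of, genMap]
  | hκ' i => rw [ofLe_leKinv, toDouble, lift_of, genMap]
  | halg c => simp only [AlgHom.commutes]
  | hadd x y hx hy => simp only [map_add, hx, hy]
  | hmul x y hx hy => simp only [map_mul, hx, hy]

lemma toDouble_ofTensor (z : P.Double) : toDouble hP (ofTensor D z) = z := by
  induction z using SkewPairing.double_induction with
  | zero => exact (congrArg _ (map_zero (ofTensor D))).trans (map_zero _)
  | add a b ha hb =>
    exact (congrArg _ (map_add (ofTensor D) a b)).trans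
      ((map_add _ _ _).trans (congrArg₂ (· + ·) ha hb))
  | tmul x y =>
    refine (congrArg _ (ofTensor_tmul x y)).trans ?_
    rw [map_mul, toDouble_ofGe, toDouble_ofLe, P.inl_mul_inr]

/-- The presented algebra is the double: `ofTensor D` is a section of `toDouble hP`, and it is
surjective. -/
lemma toDouble_bijective : Function.Bijective (toDouble hP) := by
  refine ⟨fun a b hab => ?_, fun z => ⟨_, toDouble_ofTensor hP z⟩⟩
  obtain ⟨a, rfl⟩ := ofTensor_surjective a
  obtain ⟨b, rfl⟩ := ofTensor_surjective b
  rw [show a = b from (toDouble_ofTensor hP a).symm.trans (hab.trans (toDouble_ofTensor hP b))]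

end DPres

end DoublePresentation

end QD

end

theorem theorem5p1 {k : Type*} [Field k] {n : ℕ} (D : QD.Datum k n) :
    (∃! φ : QD.Uq.geZero D →ₗ[k] QD.Uq.leZero D →ₗ[k] k, QD.Uq.IsLusztigPairing φ) ∧
    ∀ φ : QD.Uq.geZero D →ₗ[k] QD.Uq.leZero D →ₗ[k] k, QD.Uq.IsLusztigPairing φ →
      ∃ ψ : QD.DPres D ≃ₗ[k] QD.QuantumDouble φ,
        ψ 1 = 1 ∧ (∀ a b : QD.DPres D, ψ (a * b) = ψ a * ψ b) ∧
        ∀ i : Fin n,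
          ψ (QD.DPres.of D (.E i)) = QD.QuantumDouble.tmul φ (QD.Uq.geE i) 1 ∧
          ψ (QD.DPres.of D (.F i)) = D.qi i • QD.QuantumDouble.tmul φ 1 (QD.Uq.leF i) ∧
          ψ (QD.DPres.of D (.K i)) = QD.QuantumDouble.tmul φ (QD.Uq.geK i) 1 ∧
          ψ (QD.DPres.of D (.Kinv i)) = QD.QuantumDouble.tmul φ (QD.Uq.geKinv i) 1 ∧
          ψ (QD.DPres.of D (.Kt i)) = QD.QuantumDouble.tmul φ 1 (QD.Uq.leK i) ∧
          ψ (QD.DPres.of D (.Ktinv i)) = QD.QuantumDouble.tmul φ 1 (QD.Uq.leKinv i) := by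
  refine ⟨⟨QD.lusztigPairing D, QD.isLusztigPrePairing_lusztigPairing.isLusztigPairing,
    fun φ hφ => hφ.prePairing.unique QD.isLusztigPrePairing_lusztigPairing⟩, fun φ hφ => ?_⟩
  have hP := hφ.prePairing.isBorelPairing
  let ψ : QD.DPres D ≃ₗ[k] hφ.prePairing.skewPairing.Double :=
    LinearEquiv.ofBijective (QD.DPres.toDouble hP).toLinearMap (QD.DPres.toDouble_bijective hP)
  have hof (x : QD.DGen n) : ψ (QD.DPres.of D x) = _ := QD.DPres.lift_of hP.dRelations x
  exact ⟨ψ, map_one (QD.DPres.toDouble hP), map_mul (QD.DPres.toDouble hP),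
    fun i => ⟨hof _, hof _, hof _, hof _, hof _, hof _⟩⟩
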